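/- Let $\alpha>0$ and let $\gamma\subset\mathbb{C}$ be a $C^{5+\alpha}$ Jordan arc with endpoints $-1$ and $1$, i.e. $\gamma=p([0,1])$ for an injective $p:[0,1]\to\mathbb{C}$ with $p(0)=-1$, $p(1)=1$, $p'\neq 0$ on $[0,1]$, such that, writing $5+\alpha=k+\beta$ with $k\in\mathbb{N}$ and $0<\beta\le 1$, $p$ is $k$ times continuously differentiable on $[0,1]$ with $p^{(k)}$ Hölder continuous of exponent $\beta$. Let $\nu_e$ be the equilibrium measure of $\gamma$, that is, the minimizer of $I[\mu]=\iint\log|z-w|^{-1}\,d\mu(z)\,d\mu(w)$ among probability measures on $\gamma$, let $\mathrm{cap}(\gamma)=e^{-I[\nu_e]}$, and let $z_e:[-1,1]\to\gamma$ be the equilibrium parametrization, i.e. the homeomorphism with $z_e(\pm1)=\pm1$ and $$\nu_e(z_e([-1,t]))=\frac1\pi\int_{-1}^t\frac{ds}{\sqrt{1-s^2}},\qquad t\in[-1,1].$$ Let $a_{kl}\in\mathbb{R}$, $k,l\ge1$, be the arc-Grunsky coefficients of $\gamma$, defined by the expansion $$\log\left|\frac{z_e(s)-z_e(t)}{s-t}\right|=\log(2\,\mathrm{cap}(\gamma))-2\sum_{k,l\ge1}a_{kl}T_k(s)T_l(t),$$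 uniformly for $s\ne t$ in $[-1,1]$, where $T_k$ is the $k$-th Chebyshev polynomial of the first kind. The arc-Grunsky operator $B$ of $\gamma$ is the operator on the real Hilbert space $\ell^2(\mathbb{Z}_+)$ acting by multiplication with the matrix $(b_{kl})_{k,l\ge1}$, $b_{kl}=\sqrt{kl}\,a_{kl}$. Then $B$ is a well-defined (existing and uniquely determined by $\gamma$) bounded operator, and there is a constant $0\le\kappa<1$ such that $$B\ge-\kappa I,$$ that is, $B$ is self-adjoint with $\langle Bx,x\rangle\ge-\kappa\|x\|^2$ for all $x\in\ell^2(\mathbb{Z}_+)$; in particular all eigenvalues of $B$ are at least $-\kappa$, and $I+sB$ is invertible for every $s\in[0,1]$. -/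

import Mathlib

open MeasureTheory Set

noncomputable section

/-- `p` is of class `C^r` on `[0,1]`, `r > 0` real: writing `r = k + β` with `k` a natural number
and `0 < β ≤ 1`, the function is `k` times continuously differentiable on `[0,1]` (one-sided at the
endpoints) and its `k`-th derivative is Hölder continuous with exponent `β`. -/
def IsHolderClass (r : ℝ) (p : ℝ → ℂ) : Prop :=
  ∃ (k : ℕ) (β : NNReal), 0 < β ∧ β ≤ 1 ∧ r = k + β ∧ ContDiffOn ℝ k p (Icc 0 1) ∧
    ∃ C : NNReal, HolderOnWith C β (iteratedDerivWithin k p (Icc 0 1)) (Icc 0 1)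

/-- `γ` is a `C^r` Jordan arc with endpoints `-1` and `1`: the image of an injective regular
parametrization of class `C^r`. -/
def IsHolderJordanArc (r : ℝ) (γ : Set ℂ) : Prop :=
  ∃ p : ℝ → ℂ, IsHolderClass r p ∧ InjOn p (Icc 0 1) ∧
    (∀ t ∈ Icc (0 : ℝ) 1, derivWithin p (Icc 0 1) t ≠ 0) ∧
    p 0 = -1 ∧ p 1 = 1 ∧ p '' Icc 0 1 = γ

/-- The logarithmic energy `∬ log |z - w|⁻¹ dμ(z) dμ(w)`, as the integral of the positive part
minus the integral of the negative part; the kernel is `+∞` on the diagonal. For a probability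
measure on a compact set the negative part has finite integral. -/
def logEnergy (μ : Measure ℂ) : EReal :=
  ((∫⁻ z, ∫⁻ w, (-ENNReal.log (edist z w)).toENNReal ∂μ ∂μ : ENNReal) : EReal) -
    ((∫⁻ z, ∫⁻ w, (ENNReal.log (edist z w)).toENNReal ∂μ ∂μ : ENNReal) : EReal)

/-- The probability measures on `K`. -/
def probabilityMeasuresOn (K : Set ℂ) : Set (Measure ℂ) :=
  {μ | IsProbabilityMeasure μ ∧ μ Kᶜ = 0}

/-- `ν` is an equilibrium measure of `K`: a probability measure on `K` of least energy. -/
def IsEquilibriumMeasure (K : Set ℂ) (ν : Measure ℂ) : Prop :=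
  ν ∈ probabilityMeasuresOn K ∧ ∀ μ ∈ probabilityMeasuresOn K, logEnergy ν ≤ logEnergy μ

/-- The logarithmic capacity `exp (- inf_μ I_K[μ])` (the infimum is the energy of the equilibrium
measure). -/
def logCapacity (K : Set ℂ) : ℝ :=
  (EReal.exp (-(⨅ μ ∈ probabilityMeasuresOn K, logEnergy μ))).toReal

/-- `z`, restricted to `[-1,1]`, is the parametrization of the arc `γ` from `-1` to `1` that carries
the arcsine distribution (the equilibrium measure of `[-1,1]`) to the measure `ν`. -/
def IsEquilibriumParametrization (γ : Set ℂ) (ν : Measure ℂ) (z : ℝ → ℂ) : Prop :=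
  ContinuousOn z (Icc (-1) 1) ∧ InjOn z (Icc (-1) 1) ∧ z '' Icc (-1) 1 = γ ∧
    z (-1) = -1 ∧ z 1 = 1 ∧
    ∀ t ∈ Icc (-1 : ℝ) 1, ν (z '' Icc (-1) t) =
      ENNReal.ofReal (1 / Real.pi * ∫ s in (-1 : ℝ)..t, 1 / Real.sqrt (1 - s ^ 2))

/-- `a` is the family of arc-Grunsky coefficients of `γ`: with the equilibrium parametrization `z`,
`log |(z s - z t) / (s - t)| = log (2 cap γ) - 2 ∑_{k,l ≥ 1} a_{kl} T_k(s) T_l(t)` uniformly for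
`s ≠ t` in `[-1,1]`. (On the diagonal the left-hand side is understood as a limit, so nothing is
lost by leaving the diagonal out.) -/
def IsArcGrunskyCoeff (γ : Set ℂ) (a : ℕ+ → ℕ+ → ℝ) : Prop :=
  ∃ (ν : Measure ℂ) (z : ℝ → ℂ), IsEquilibriumMeasure γ ν ∧ IsEquilibriumParametrization γ ν z ∧
    ∃ S : ℝ × ℝ → ℝ,
      HasSumUniformlyOn
        (fun (kl : ℕ+ × ℕ+) (st : ℝ × ℝ) => a kl.1 kl.2 *
          (Polynomial.Chebyshev.T ℝ (kl.1 : ℕ)).eval st.1 *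
          (Polynomial.Chebyshev.T ℝ (kl.2 : ℕ)).eval st.2)
        S (Icc (-1 : ℝ) 1).offDiag ∧
      ∀ st ∈ (Icc (-1 : ℝ) 1).offDiag,
        Real.log ‖(z st.1 - z st.2) / ((st.1 - st.2 : ℝ) : ℂ)‖ =
          Real.log (2 * logCapacity γ) - 2 * S st

/-- The real sequence space `ℓ²(ℤ₊)`. -/
abbrev SeqL2 : Type := lp (fun _ : ℕ+ => ℝ) 2

/-- `B` is the arc-Grunsky operator of `γ`: the bounded operator on `ℓ²(ℤ₊)` that acts by
multiplication with the matrix `b_{kl} = √(kl) a_{kl}`. -/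
def IsArcGrunskyOperator (γ : Set ℂ) (B : SeqL2 →L[ℝ] SeqL2) : Prop :=
  ∃ a : ℕ+ → ℕ+ → ℝ, IsArcGrunskyCoeff γ a ∧
    ∀ (x : SeqL2) (k : ℕ+),
      HasSum (fun l : ℕ+ => Real.sqrt ((k : ℝ) * (l : ℝ)) * a k l * x l) (B x k)

end

/-! Write a parametrization of the arc in an angle as `ζ φ`, `0 ≤ φ ≤ π`, and split log|ζ(x) - ζ(y)|
= log|cos x - cos y| + F(x, y). The cosines diagonalize the first kernel: integrating it against
cos(ky) gives -(π/k) cos(kx) for k ≥ 1. Hence, for the density m = ∑ √k x_k cos(kφ), which has total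
mass zero, the logarithmic energy -∬ log|ζ(x) - ζ(y)| m(x) m(y) equals (π²/2)⟨x + Bx, x⟩, where B
has the entries -√(kl) c_kl / 2 and the c_kl are the cosine coefficients of F. A lower bound for B
is thus a statement about positivity of energy (`IsLogKernel.energy_cosDensity`).

Positivity comes from Gaussians. Frullani's integral writes -2 log|z - w| as the integral of
(exp(-t|z - w|²) - exp(-t)) dt/t over t > 0, and exp(-t|z - w|²) is 4t/π times the integral over u
of exp(-2t|z - u|²) exp(-2t|w - u|²). For mass zero the term exp(-t) drops out, and the energy
becomes an integral of squares of Gaussian transforms. So I + B ≥ 0.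

If F is C², B is Hilbert–Schmidt, hence compact, and a nonnegative I + B is bounded below by a
positive constant as soon as it is injective (`exists_coercive`). For injectivity
(`IsLogKernel.eq_zero_of_add_eq_zero`), x = -Bx forces √k x_k to be square summable, so m makes
sense as a functional on continuous functions. Its energy is zero, so by Fatou its Gaussian
transform vanishes for some t, and Stone–Weierstrass makes the functional zero.

It remains to know that the equilibrium parametrization is regular enough for this, and the same
coercivity supplies it. For the given C⁵ parametrization q(cos φ), F is C⁴, even and periodic.
Inverting I + B produces a C² density w of mass π whose potential is a constant V on the arc
(`IsLogKernel.exists_density`). The potential minus V is harmonic off the arc, zero on it and large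
at infinity, so the minimum principle makes it nonnegative, and positive off the arc because the
complement is connected. Comparing circle averages at points of the arc gives w ≥ 0, and a Hopf-type
bound from a disc touching the arc gives w > 0 (`IsEquilibriumDensity.pos`), endpoints included.
Then ∫ w is a C³ change of the angle. Its inverse turns the equilibrium measure into normalized
angular measure and keeps the regular part of the kernel C² (`IsAngleChange.isLogKernel`).

Finally, the energy identity applied to differences of probability measures shows that this is the
only equilibrium measure. The endpoints and the measure condition determine the parametrization, and
uniform convergence determines the coefficients. Constancy of the potential removes the mixed
coefficients with an index 0, so the arc-Grunsky coefficients are -c_kl/2 and B is the arc-Grunsky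
operator. -/

/-! ### Parametric integrals, divided differences and extension of smooth functions. -/

-- The derivative of such an integral is again such an integral, with values in a space of linear
-- maps. This is why the induction leaves the target space `E` free.
open Filter Topology intervalIntegral in
theorem contDiff_integral_unitInterval {H : Type} [NormedAddCommGroup H] [NormedSpace ℝ H]
    [FiniteDimensional ℝ H] (n : ℕ) : ∀ {E : Type} [NormedAddCommGroup E] [NormedSpace ℝ E]
    [CompleteSpace E] {f : H × ℝ → E}, ContDiff ℝ n f →
      ContDiff ℝ n (fun x => ∫ u in (0 : ℝ)..1, f (x, u)) := by
  have : ProperSpace H := FiniteDimensional.proper ℝ H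
  induction n with
  | zero =>
    intro E _ _ _ f hf
    refine contDiff_zero.2 ?_
    exact continuous_parametric_intervalIntegral_of_continuous'
      (f := fun x u => f (x, u)) hf.continuous 0 1
  | succ n ih =>
    intro E _ _ _ f hf
    have hf' : ContDiff ℝ n (fun p : H × ℝ =>
        (fderiv ℝ f p).comp (ContinuousLinearMap.inl ℝ H ℝ)) :=
      (hf.fderiv_right (m := n) (by norm_cast)).clm_comp contDiff_const
    refine contDiff_succ_iff_hasFDerivAt.2 ⟨_, ih hf', fun x₀ => ?_⟩
    -- A constant dominates the derivative near `x₀`, by compactness of a closed ball times the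
    -- interval of integration.
    obtain ⟨M, hM⟩ := ((isCompact_closedBall x₀ 1).prod (isCompact_Icc (a := (0 : ℝ))
      (b := 1))).exists_bound_of_continuousOn hf'.continuous.continuousOn
    refine hasFDerivAt_integral_of_dominated_of_fderiv_le (F := fun x u => f (x, u))
      (F' := fun x u => (fderiv ℝ f (x, u)).comp (ContinuousLinearMap.inl ℝ H ℝ))
      (bound := fun _ => M)
      (Metric.closedBall_mem_nhds x₀ one_pos) ?_ ?_ ?_ ?_ ?_ ?_
    · exact Eventually.of_forall fun x =>
        (hf.continuous.comp (by fun_prop : Continuous fun u : ℝ => (x, u))).aestronglyMeasurable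
    · exact (hf.continuous.comp
        (by fun_prop : Continuous fun u : ℝ => (x₀, u))).intervalIntegrable _ _
    · exact (hf'.continuous.comp
        (by fun_prop : Continuous fun u : ℝ => (x₀, u))).aestronglyMeasurable
    · refine Eventually.of_forall fun u hu x hx => hM (x, u) ⟨hx, ?_⟩
      rw [uIoc_of_le zero_le_one] at hu
      exact ⟨hu.1.le, hu.2⟩
    · exact intervalIntegrable_const
    · refine Eventually.of_forall fun u _ x _ => ?_
      exact ((hf.differentiable (by simp)) (x, u)).hasFDerivAt.comp x
        (hasFDerivAt_prodMk_left x u)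

/-- The divided difference `(f x - f y) / (x - y)` of a continuously differentiable function,
extended to the diagonal by the derivative. -/
noncomputable def dividedDiff {E : Type} [NormedAddCommGroup E] [NormedSpace ℝ E]
    (f : ℝ → E) (p : ℝ × ℝ) : E :=
  ∫ u in (0 : ℝ)..1, deriv f (p.2 + u * (p.1 - p.2))

section dividedDiff
variable {E : Type} [NormedAddCommGroup E] [NormedSpace ℝ E] [CompleteSpace E] {f : ℝ → E}

/-- Averaging the derivative along the segment costs only one order of smoothness, on the diagonal
as well, where the quotient itself says nothing. -/
theorem contDiff_dividedDiff {n : ℕ} (hf : ContDiff ℝ (n + 1) f) :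
    ContDiff ℝ n (dividedDiff f) := by
  have h : ContDiff ℝ n (deriv f) := ((contDiff_succ_iff_deriv (n := (n : WithTop ℕ∞))).1 hf).2.2
  have h2 : ContDiff ℝ n fun q : (ℝ × ℝ) × ℝ => deriv f (q.1.2 + q.2 * (q.1.1 - q.1.2)) :=
    h.comp (by fun_prop)
  exact contDiff_integral_unitInterval n h2

theorem dividedDiff_self (x : ℝ) : dividedDiff f (x, x) = deriv f x := by
  simp [dividedDiff]

theorem smul_dividedDiff (hf : ContDiff ℝ 1 f) (x y : ℝ) :
    (x - y) • dividedDiff f (x, y) = f x - f y := by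
  have h := intervalIntegral.integral_eq_sub_of_hasDerivAt (a := 0) (b := 1)
    (f := fun u => f (y + u * (x - y))) (f' := fun u => (x - y) • deriv f (y + u * (x - y)))
    (fun u _ => by
      have h1 : HasDerivAt f (deriv f (y + u * (x - y))) (y + u * (x - y)) :=
        ((hf.differentiable (by simp)) _).hasDerivAt
      have h2 : HasDerivAt (fun u : ℝ => y + u * (x - y)) (x - y) u := by
        simpa using ((hasDerivAt_id u).mul_const (x - y)).const_add y
      exact h1.scomp u h2)
    (by
      apply Continuous.intervalIntegrable
      have : Continuous (deriv f) := hf.continuous_deriv le_rfl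
      fun_prop)
  rw [intervalIntegral.integral_smul] at h
  simpa [dividedDiff] using h

theorem dividedDiff_eq (hf : ContDiff ℝ 1 f) {x y : ℝ} (h : x ≠ y) :
    dividedDiff f (x, y) = (x - y)⁻¹ • (f x - f y) := by
  rw [← smul_dividedDiff hf, smul_smul, inv_mul_cancel₀ (sub_ne_zero.2 h), one_smul]

theorem dividedDiff_comm (hf : ContDiff ℝ 1 f) (x y : ℝ) :
    dividedDiff f (x, y) = dividedDiff f (y, x) := by
  rcases eq_or_ne x y with rfl | h
  · rfl
  · rw [dividedDiff_eq hf h, dividedDiff_eq hf h.symm, ← neg_sub (f x), ← neg_sub x y, inv_neg,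
      neg_smul_neg]

end dividedDiff

/-- Extend the derivative first and integrate it from `a`. At order zero the function is continued
by its endpoint values. -/
theorem exists_contDiff_extension {a b : ℝ} (hab : a < b) (n : ℕ) : ∀ {f : ℝ → ℂ},
    ContDiffOn ℝ n f (Icc a b) → ∃ g : ℝ → ℂ, ContDiff ℝ n g ∧ EqOn f g (Icc a b) := by
  induction n with
  | zero =>
    intro f hf
    refine ⟨IccExtend hab.le ((Icc a b).domRestrict f), contDiff_zero.2 ?_, fun x hx => ?_⟩
    · exact (continuousOn_iff_continuous_domRestrict.1 hf.continuousOn).Icc_extend'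
    · rw [IccExtend_of_mem _ _ hx]; rfl
  | succ n ih =>
    intro f hf
    have hu := uniqueDiffOn_Icc hab
    have hf' := (contDiffOn_succ_iff_derivWithin (n := (n : WithTop ℕ∞)) hu).1 (by exact_mod_cast hf)
    obtain ⟨g, hg, hfg⟩ := ih hf'.2.2
    have hd : ∀ x, HasDerivAt (fun x => f a + ∫ t in a..x, g t) (g x) x := fun x =>
      (intervalIntegral.integral_hasDerivAt_right (hg.continuous.intervalIntegrable _ _)
        hg.continuous.stronglyMeasurable.stronglyMeasurableAtFilter
        hg.continuous.continuousAt).const_add _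
    refine ⟨fun x => f a + ∫ t in a..x, g t, ?_, fun x hx => ?_⟩
    · have hde : deriv (fun x => f a + ∫ t in a..x, g t) = g := funext fun x => (hd x).deriv
      have := (contDiff_succ_iff_deriv (n := (n : WithTop ℕ∞))
        (f := fun x => f a + ∫ t in a..x, g t)).2
        ⟨fun x => (hd x).differentiableAt, by simp, by rw [hde]; exact hg⟩
      exact_mod_cast this
    · have h := intervalIntegral.integral_eq_sub_of_hasDeriv_right_of_le (f := f) (f' := g)
        hx.1 (hf.continuousOn.mono (Icc_subset_Icc_right hx.2))
        (fun t ht => ?_) (hg.continuous.intervalIntegrable _ _)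
      · simp [h]
      · have htb : t ∈ Ico a b := ⟨ht.1.le, ht.2.trans_le hx.2⟩
        have h1 : HasDerivWithinAt f (derivWithin f (Icc a b) t) (Icc a b) t :=
          (hf'.1 t (Ico_subset_Icc_self htb)).hasDerivWithinAt
        rw [hfg (Ico_subset_Icc_self htb)] at h1
        exact h1.mono_of_mem_nhdsWithin (Icc_mem_nhdsGT_of_mem htb)


/-! ### Cosine and sine systems on the angles, and Bessel's inequality. -/

/-- Lebesgue measure on the interval of angles `(0, π]`. -/
noncomputable def angleMeasure : Measure ℝ := volume.restrict (Ioc 0 Real.pi)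

instance : IsFiniteMeasure angleMeasure := by
  unfold angleMeasure; infer_instance

theorem integral_angleMeasure (f : ℝ → ℝ) :
    ∫ x, f x ∂angleMeasure = ∫ x in (0 : ℝ)..Real.pi, f x := by
  rw [intervalIntegral.integral_of_le Real.pi_pos.le]; rfl

theorem integrable_angleMeasure_iff {f : ℝ → ℝ} :
    Integrable f angleMeasure ↔ IntervalIntegrable f volume 0 Real.pi := by
  rw [intervalIntegrable_iff_integrableOn_Ioc_of_le Real.pi_pos.le]; rfl

theorem Continuous.integrable_angleMeasure {f : ℝ → ℝ} (hf : Continuous f) :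
    Integrable f angleMeasure :=
  integrable_angleMeasure_iff.2 (hf.intervalIntegrable _ _)

theorem angleMeasure_prod_eq : angleMeasure.prod angleMeasure =
    (volume : Measure (ℝ × ℝ)).restrict (Ioc 0 Real.pi ×ˢ Ioc 0 Real.pi) := by
  rw [angleMeasure, Measure.prod_restrict]; rfl

theorem Continuous.integrable_angleMeasure_prod {f : ℝ × ℝ → ℝ} (hf : Continuous f) :
    Integrable f (angleMeasure.prod angleMeasure) := by
  rw [angleMeasure_prod_eq]
  exact (hf.continuousOn.integrableOn_compact (isCompact_Icc.prod isCompact_Icc)).mono_set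
    (prod_mono Ioc_subset_Icc_self Ioc_subset_Icc_self)

/-- Expand the nonnegative integral of (f - ∑ (a_i / C) e_i)². Only an upper bound on the norms is
used, so cos(0·x), of larger norm than the other cosines, and sin(0·x) = 0 may stay in the systems.
-/
theorem bessel_integral {Ω ι : Type*} [MeasurableSpace Ω] {μ : Measure Ω} {f : Ω → ℝ}
    {e : ι → Ω → ℝ} {C : ℝ} (hC : 0 < C) (hff : Integrable (fun x => f x * f x) μ)
    (hfe : ∀ i, Integrable (fun x => f x * e i x) μ)
    (hee : ∀ i j, Integrable (fun x => e i x * e j x) μ)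
    (horth : ∀ i j, i ≠ j → ∫ x, e i x * e j x ∂μ = 0)
    (hnorm : ∀ i, ∫ x, e i x * e i x ∂μ ≤ C) (s : Finset ι) :
    ∑ i ∈ s, (∫ x, f x * e i x ∂μ) ^ 2 ≤ C * ∫ x, f x * f x ∂μ := by
  classical
  set a : ι → ℝ := fun i => ∫ x, f x * e i x ∂μ with ha
  have h0 : 0 ≤ ∫ x, (f x - ∑ i ∈ s, a i / C * e i x) * (f x - ∑ i ∈ s, a i / C * e i x) ∂μ :=
    integral_nonneg fun x => mul_self_nonneg _
  have hexp : ∀ x, (f x - ∑ i ∈ s, a i / C * e i x) * (f x - ∑ i ∈ s, a i / C * e i x) =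
      f x * f x - 2 * ∑ i ∈ s, a i / C * (f x * e i x) +
        ∑ i ∈ s, ∑ j ∈ s, a i / C * (a j / C) * (e i x * e j x) := by
    intro x
    have h1 : (∑ i ∈ s, a i / C * e i x) * (∑ i ∈ s, a i / C * e i x) =
        ∑ i ∈ s, ∑ j ∈ s, a i / C * (a j / C) * (e i x * e j x) := by
      rw [Finset.sum_mul_sum]
      exact Finset.sum_congr rfl fun i _ => Finset.sum_congr rfl fun j _ => by ring
    have h2 : f x * (∑ i ∈ s, a i / C * e i x) = ∑ i ∈ s, a i / C * (f x * e i x) := by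
      rw [Finset.mul_sum]
      exact Finset.sum_congr rfl fun i _ => by ring
    rw [← h1, ← h2]; ring
  have hi1 : Integrable (fun x => ∑ i ∈ s, a i / C * (f x * e i x)) μ :=
    integrable_finsetSum _ fun i _ => (hfe i).const_mul _
  have hi2 : Integrable (fun x => ∑ i ∈ s, ∑ j ∈ s, a i / C * (a j / C) * (e i x * e j x)) μ :=
    integrable_finsetSum _ fun i _ => integrable_finsetSum _ fun j _ => (hee i j).const_mul _
  simp_rw [hexp] at h0
  have hi3 : Integrable (fun x => f x * f x - 2 * ∑ i ∈ s, a i / C * (f x * e i x)) μ :=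
    hff.sub (hi1.const_mul 2)
  rw [integral_add hi3 hi2, integral_sub hff (hi1.const_mul 2), integral_const_mul,
    integral_finsetSum _ (fun i _ => (hfe i).const_mul _),
    integral_finsetSum _ (fun i _ => integrable_finsetSum _ fun j _ => (hee i j).const_mul _)] at h0
  have h3 : ∀ i ∈ s, ∫ x, ∑ j ∈ s, a i / C * (a j / C) * (e i x * e j x) ∂μ ≤ a i ^ 2 / C := by
    intro i hi
    rw [integral_finsetSum _ (fun j _ => (hee i j).const_mul _), Finset.sum_eq_single i]
    · rw [integral_const_mul]
      calc a i / C * (a i / C) * ∫ x, e i x * e i x ∂μ ≤ a i / C * (a i / C) * C :=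
            mul_le_mul_of_nonneg_left (hnorm i) (mul_self_nonneg _)
        _ = a i ^ 2 / C := by field_simp
    · intro j _ hj
      rw [integral_const_mul, horth i j hj.symm, mul_zero]
    · exact fun h => absurd hi h
  have h4 : ∀ i ∈ s, ∫ x, a i / C * (f x * e i x) ∂μ = a i ^ 2 / C := by
    intro i _
    rw [integral_const_mul]; change a i / C * a i = _; ring
  rw [Finset.sum_congr rfl h4] at h0
  have h5 := Finset.sum_le_sum h3
  rw [← Finset.sum_div] at h0 h5
  have h6 : (∑ i ∈ s, a i ^ 2) / C ≤ ∫ x, f x * f x ∂μ := by linarith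
  rwa [div_le_iff₀' hC] at h6

/-- A sequence of continuous functions that are pairwise orthogonal on `(0, π]`, with square
integrals at most `π`. -/
structure OrthogonalSeq (g : ℕ → ℝ → ℝ) : Prop where
  continuous : ∀ k, Continuous (g k)
  orthogonal : ∀ k l, k ≠ l → ∫ x, g k x * g l x ∂angleMeasure = 0
  norm_le : ∀ k, ∫ x, g k x * g k x ∂angleMeasure ≤ Real.pi

theorem integral_cos_int_mul (n : ℤ) :
    ∫ x, Real.cos (n * x) ∂angleMeasure = if n = 0 then Real.pi else 0 := by
  rw [integral_angleMeasure]
  split_ifs with h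
  · simp [h]
  · have hn : (n : ℝ) ≠ 0 := by exact_mod_cast h
    rw [intervalIntegral.integral_comp_mul_left (fun x => Real.cos x) hn, integral_cos]
    simp [Real.sin_int_mul_pi]

theorem integral_cos_nat_mul (n : ℕ) :
    ∫ x, Real.cos (n * x) ∂angleMeasure = if n = 0 then Real.pi else 0 := by
  simpa using integral_cos_int_mul n

theorem integral_cos_mul_cos (k l : ℕ) :
    ∫ x, Real.cos (k * x) * Real.cos (l * x) ∂angleMeasure =
      if k = l then (if k = 0 then Real.pi else Real.pi / 2) else 0 := by
  have h : ∀ x : ℝ, Real.cos (k * x) * Real.cos (l * x) =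
      (Real.cos (((k - l : ℤ) : ℝ) * x) + Real.cos (((k + l : ℤ) : ℝ) * x)) * (1 / 2) := by
    intro x
    push_cast
    rw [sub_mul (k : ℝ), add_mul (k : ℝ), Real.cos_sub, Real.cos_add]; ring
  simp_rw [h]
  rw [integral_mul_const, integral_add, integral_cos_int_mul, integral_cos_int_mul]
  · have e1 : ((k : ℤ) - l = 0) ↔ k = l := by omega
    have e2 : ((k : ℤ) + l = 0) ↔ k = 0 ∧ l = 0 := by omega
    simp only [e1, e2]
    split_ifs <;> first | (exfalso; omega) | ring
  all_goals exact Continuous.integrable_angleMeasure (by fun_prop)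

theorem integral_sin_mul_sin (k l : ℕ) :
    ∫ x, Real.sin (k * x) * Real.sin (l * x) ∂angleMeasure =
      if k = l then (if k = 0 then 0 else Real.pi / 2) else 0 := by
  have h : ∀ x : ℝ, Real.sin (k * x) * Real.sin (l * x) =
      (Real.cos (((k - l : ℤ) : ℝ) * x) - Real.cos (((k + l : ℤ) : ℝ) * x)) * (1 / 2) := by
    intro x
    push_cast
    rw [sub_mul (k : ℝ), add_mul (k : ℝ), Real.cos_sub, Real.cos_add]; ring
  simp_rw [h]
  rw [integral_mul_const, integral_sub, integral_cos_int_mul, integral_cos_int_mul]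
  · have e1 : ((k : ℤ) - l = 0) ↔ k = l := by omega
    have e2 : ((k : ℤ) + l = 0) ↔ k = 0 ∧ l = 0 := by omega
    simp only [e1, e2]
    split_ifs <;> first | (exfalso; omega) | ring
  all_goals exact Continuous.integrable_angleMeasure (by fun_prop)

theorem orthogonalSeq_cos : OrthogonalSeq fun k x => Real.cos (k * x) where
  continuous k := by fun_prop
  orthogonal k l h := by rw [integral_cos_mul_cos, if_neg h]
  norm_le k := by
    rw [integral_cos_mul_cos, if_pos rfl]
    split_ifs <;> linarith [Real.pi_pos]

theorem orthogonalSeq_sin : OrthogonalSeq fun k x => Real.sin (k * x) where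
  continuous k := by fun_prop
  orthogonal k l h := by rw [integral_sin_mul_sin, if_neg h]
  norm_le k := by
    rw [integral_sin_mul_sin, if_pos rfl]
    split_ifs <;> linarith [Real.pi_pos]

theorem OrthogonalSeq.bessel {g : ℕ → ℝ → ℝ} (hg : OrthogonalSeq g) {f : ℝ → ℝ}
    (hf : Continuous f) (s : Finset ℕ) : ∑ k ∈ s, (∫ x, f x * g k x ∂angleMeasure) ^ 2 ≤
      Real.pi * ∫ x, f x * f x ∂angleMeasure :=
  bessel_integral Real.pi_pos (hf.fun_mul hf).integrable_angleMeasure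
    (fun i => (hf.fun_mul (hg.continuous i)).integrable_angleMeasure)
    (fun i j => ((hg.continuous i).fun_mul (hg.continuous j)).integrable_angleMeasure)
    hg.orthogonal hg.norm_le s

/-- The integral of `F(x, y) g(x) h(y)` over the square of angles. -/
noncomputable def pairing (F : ℝ × ℝ → ℝ) (g h : ℝ → ℝ) : ℝ :=
  ∫ p, F p * (g p.1 * h p.2) ∂(angleMeasure.prod angleMeasure)

/-- The products g_k(x) h_l(y) are again orthogonal, with square integrals at most π², so Bessel's
inequality applies on the square. -/
theorem summable_pairing_sq {g h : ℕ → ℝ → ℝ} (hg : OrthogonalSeq g) (hh : OrthogonalSeq h)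
    {F : ℝ × ℝ → ℝ} (hF : Continuous F) :
    Summable fun kl : ℕ × ℕ => (pairing F (g kl.1) (h kl.2)) ^ 2 := by
  have hc : ∀ kl : ℕ × ℕ, Continuous fun p : ℝ × ℝ => g kl.1 p.1 * h kl.2 p.2 := fun kl =>
    ((hg.continuous _).comp continuous_fst).mul ((hh.continuous _).comp continuous_snd)
  have hprod : ∀ i j : ℕ × ℕ, ∫ p : ℝ × ℝ, (g i.1 p.1 * h i.2 p.2) * (g j.1 p.1 * h j.2 p.2)
      ∂(angleMeasure.prod angleMeasure) = (∫ x, g i.1 x * g j.1 x ∂angleMeasure) *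
        ∫ x, h i.2 x * h j.2 x ∂angleMeasure := by
    intro i j
    rw [← integral_prod_mul]
    exact integral_congr_ae (Filter.Eventually.of_forall fun p => by ring)
  refine summable_of_sum_le (fun _ => sq_nonneg _)
    (c := Real.pi ^ 2 * ∫ p, F p * F p ∂(angleMeasure.prod angleMeasure)) fun s => ?_
  refine bessel_integral (e := fun (kl : ℕ × ℕ) (p : ℝ × ℝ) => g kl.1 p.1 * h kl.2 p.2)
    (by positivity) (hF.fun_mul hF).integrable_angleMeasure_prod
    (fun i => (hF.fun_mul (hc i)).integrable_angleMeasure_prod)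
    (fun i j => ((hc i).fun_mul (hc j)).integrable_angleMeasure_prod) (fun i j hij => ?_)
    (fun i => ?_) s
  · rw [hprod]
    by_cases h1 : i.1 = j.1
    · rw [hh.orthogonal i.2 j.2 (fun h2 => hij (Prod.ext h1 h2)), mul_zero]
    · rw [hg.orthogonal i.1 j.1 h1, zero_mul]
  · rw [hprod, sq]
    exact mul_le_mul (hg.norm_le _) (hh.norm_le _)
      (integral_nonneg fun x => mul_self_nonneg _) Real.pi_pos.le

/-! ### Integration by parts -/

theorem nat_mul_integral_mul_cos {f f' : ℝ → ℝ} (hf : ∀ x, HasDerivAt f (f' x) x)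
    (hf' : Continuous f') (k : ℕ) : k * ∫ x, f x * Real.cos (k * x) ∂angleMeasure =
      -∫ x, f' x * Real.sin (k * x) ∂angleMeasure := by
  rw [integral_angleMeasure, integral_angleMeasure]
  have hd : ∀ x : ℝ, HasDerivAt (fun x => Real.sin (k * x)) (k * Real.cos (k * x)) x := fun x => by
    simpa [mul_comm] using ((hasDerivAt_id x).const_mul (k : ℝ)).sin
  have h := intervalIntegral.integral_mul_deriv_eq_deriv_mul (a := 0) (b := Real.pi)
    (fun x _ => hf x) (fun x _ => hd x) (hf'.intervalIntegrable _ _)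
    (by apply Continuous.intervalIntegrable; fun_prop)
  simp only [Real.sin_nat_mul_pi, mul_zero, Real.sin_zero, sub_self, zero_sub] at h
  rw [← h, ← intervalIntegral.integral_const_mul]
  congr 1; ext x; ring

/-- Unlike for cosines, the primitive of the sine does not vanish at 0 and π, so the function has
to. -/
theorem nat_mul_integral_mul_sin {f f' : ℝ → ℝ} (hf : ∀ x, HasDerivAt f (f' x) x)
    (hf' : Continuous f') (h0 : f 0 = 0) (hpi : f Real.pi = 0) (k : ℕ) :
    k * ∫ x, f x * Real.sin (k * x) ∂angleMeasure =
      ∫ x, f' x * Real.cos (k * x) ∂angleMeasure := by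
  rw [integral_angleMeasure, integral_angleMeasure]
  have hd : ∀ x : ℝ, HasDerivAt (fun x => -Real.cos (k * x)) (k * Real.sin (k * x)) x := fun x => by
    have := (((hasDerivAt_id x).const_mul (k : ℝ)).cos).fun_neg
    simpa [mul_comm] using this
  have h := intervalIntegral.integral_mul_deriv_eq_deriv_mul (a := 0) (b := Real.pi)
    (fun x _ => hf x) (fun x _ => hd x) (hf'.intervalIntegrable _ _)
    (by apply Continuous.intervalIntegrable; fun_prop)
  simp only [h0, hpi, zero_mul, sub_self, zero_sub, mul_neg, intervalIntegral.integral_neg,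
    neg_neg] at h
  rw [← h, ← intervalIntegral.integral_const_mul]
  congr 1; ext x; ring

/-- The partial derivative in the first variable. -/
noncomputable def partialFst (F : ℝ × ℝ → ℝ) (p : ℝ × ℝ) : ℝ := fderiv ℝ F p (1, 0)

/-- The partial derivative in the second variable. -/
noncomputable def partialSnd (F : ℝ × ℝ → ℝ) (p : ℝ × ℝ) : ℝ := fderiv ℝ F p (0, 1)

theorem contDiff_partialFst {n : ℕ} {F : ℝ × ℝ → ℝ} (hF : ContDiff ℝ (n + 1) F) :
    ContDiff ℝ n (partialFst F) :=
  (hF.fderiv_right (m := n) (by norm_cast)).clm_apply contDiff_const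

theorem contDiff_partialSnd {n : ℕ} {F : ℝ × ℝ → ℝ} (hF : ContDiff ℝ (n + 1) F) :
    ContDiff ℝ n (partialSnd F) :=
  (hF.fderiv_right (m := n) (by norm_cast)).clm_apply contDiff_const

theorem hasDerivAt_partialFst {F : ℝ × ℝ → ℝ} (hF : ContDiff ℝ 1 F) (x y : ℝ) :
    HasDerivAt (fun x => F (x, y)) (partialFst F (x, y)) x :=
  (hF.differentiable (by simp) (x, y)).hasFDerivAt.comp_hasDerivAt x
    ((hasDerivAt_id x).prodMk (hasDerivAt_const x y))

theorem hasDerivAt_partialSnd {F : ℝ × ℝ → ℝ} (hF : ContDiff ℝ 1 F) (x y : ℝ) :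
    HasDerivAt (fun y => F (x, y)) (partialSnd F (x, y)) y :=
  (hF.differentiable (by simp) (x, y)).hasFDerivAt.comp_hasDerivAt y
    ((hasDerivAt_const y x).prodMk (hasDerivAt_id y))

theorem continuous_partialFst {F : ℝ × ℝ → ℝ} (hF : ContDiff ℝ 1 F) : Continuous (partialFst F) :=
  (contDiff_partialFst (n := 0) (by simpa using hF)).continuous

theorem continuous_partialSnd {F : ℝ × ℝ → ℝ} (hF : ContDiff ℝ 1 F) : Continuous (partialSnd F) :=
  (contDiff_partialSnd (n := 0) (by simpa using hF)).continuous

theorem pairing_eq_integral {F : ℝ × ℝ → ℝ} {g h : ℝ → ℝ} (hF : Continuous F) (hg : Continuous g)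
    (hh : Continuous h) : pairing F g h =
      ∫ x, (∫ y, F (x, y) * h y ∂angleMeasure) * g x ∂angleMeasure := by
  rw [pairing, integral_prod]
  · refine integral_congr_ae (Filter.Eventually.of_forall fun x => ?_)
    simp only
    rw [← integral_mul_const]
    congr 1; ext y; ring
  · exact Continuous.integrable_angleMeasure_prod (by fun_prop)

theorem pairing_eq_integral' {F : ℝ × ℝ → ℝ} {g h : ℝ → ℝ} (hF : Continuous F) (hg : Continuous g)
    (hh : Continuous h) : pairing F g h =
      ∫ y, (∫ x, F (x, y) * g x ∂angleMeasure) * h y ∂angleMeasure := by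
  rw [pairing, integral_prod_symm]
  · refine integral_congr_ae (Filter.Eventually.of_forall fun x => ?_)
    simp only
    rw [← integral_mul_const]
    congr 1; ext y; ring
  · exact Continuous.integrable_angleMeasure_prod (by fun_prop)

theorem nat_mul_pairing_cos_fst {F : ℝ × ℝ → ℝ} (hF : ContDiff ℝ 1 F) {h : ℝ → ℝ}
    (hh : Continuous h) (k : ℕ) : k * pairing F (fun x => Real.cos (k * x)) h =
      -pairing (partialFst F) (fun x => Real.sin (k * x)) h := by
  have h1 := continuous_partialFst hF
  rw [pairing_eq_integral' hF.continuous (by fun_prop) hh,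
    pairing_eq_integral' h1 (by fun_prop) hh, ← integral_const_mul, ← integral_neg]
  congr 1; ext y
  rw [← mul_assoc, nat_mul_integral_mul_cos (fun x => hasDerivAt_partialFst hF x y)
    (h1.comp (by fun_prop)), neg_mul]

theorem nat_mul_pairing_cos_snd {F : ℝ × ℝ → ℝ} (hF : ContDiff ℝ 1 F) {g : ℝ → ℝ}
    (hg : Continuous g) (l : ℕ) : l * pairing F g (fun y => Real.cos (l * y)) =
      -pairing (partialSnd F) g (fun y => Real.sin (l * y)) := by
  have h1 := continuous_partialSnd hF
  rw [pairing_eq_integral hF.continuous hg (by fun_prop),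
    pairing_eq_integral h1 hg (by fun_prop), ← integral_const_mul, ← integral_neg]
  congr 1; ext y
  rw [← mul_assoc, nat_mul_integral_mul_cos (fun x => hasDerivAt_partialSnd hF y x)
    (h1.comp (by fun_prop)), neg_mul]

theorem nat_mul_pairing_sin_fst {F : ℝ × ℝ → ℝ} (hF : ContDiff ℝ 1 F) {h : ℝ → ℝ}
    (hh : Continuous h) (h0 : ∀ y, F (0, y) = 0) (hpi : ∀ y, F (Real.pi, y) = 0) (k : ℕ) :
    k * pairing F (fun x => Real.sin (k * x)) h =
      pairing (partialFst F) (fun x => Real.cos (k * x)) h := by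
  have h1 := continuous_partialFst hF
  rw [pairing_eq_integral' hF.continuous (by fun_prop) hh,
    pairing_eq_integral' h1 (by fun_prop) hh, ← integral_const_mul]
  congr 1; ext y
  rw [← mul_assoc, nat_mul_integral_mul_sin (fun x => hasDerivAt_partialFst hF x y)
    (h1.comp (by fun_prop)) (h0 y) (hpi y)]

/-! ### Completeness of the cosines -/

/-- Multiplication by cos x replaces cos(kx) by the mean of the neighbours k ± 1. Integer
frequencies keep this recursion valid at k = 0. -/
theorem integral_mul_polynomial_cos_eq_zero {h : ℝ → ℝ} (hh : Continuous h)
    (h0 : ∀ k : ℕ, ∫ x, h x * Real.cos (k * x) ∂angleMeasure = 0) (p : Polynomial ℝ) :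
    ∫ x, h x * p.eval (Real.cos x) ∂angleMeasure = 0 := by
  have hz : ∀ k : ℤ, ∫ x, h x * Real.cos (k * x) ∂angleMeasure = 0 := by
    intro k
    obtain ⟨n, rfl | rfl⟩ := k.eq_nat_or_neg
    · simpa using h0 n
    · simpa [neg_mul, Real.cos_neg] using h0 n
  have hpow : ∀ (n : ℕ) (k : ℤ),
      ∫ x, h x * (Real.cos (k * x) * Real.cos x ^ n) ∂angleMeasure = 0 := by
    intro n
    induction n with
    | zero => intro k; simpa using hz k
    | succ n ih =>
      intro k
      have e : ∀ x, h x * (Real.cos (k * x) * Real.cos x ^ (n + 1)) =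
          (1 / 2) * (h x * (Real.cos (((k + 1 : ℤ) : ℝ) * x) * Real.cos x ^ n)) +
          (1 / 2) * (h x * (Real.cos (((k - 1 : ℤ) : ℝ) * x) * Real.cos x ^ n)) := by
        intro x
        push_cast
        rw [sub_mul, add_mul, one_mul, Real.cos_sub, Real.cos_add]; ring
      simp_rw [e]
      rw [integral_add, integral_const_mul, integral_const_mul, ih, ih]
      · simp
      all_goals exact Continuous.integrable_angleMeasure (by fun_prop)
  induction p using Polynomial.induction_on' with
  | add p q hp hq =>
    simp_rw [Polynomial.eval_add, mul_add]
    rw [integral_add, hp, hq, add_zero]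
    all_goals exact Continuous.integrable_angleMeasure (by fun_prop)
  | monomial n a =>
    have := hpow n 0
    simp only [Int.cast_zero, zero_mul, Real.cos_zero, one_mul] at this
    simp_rw [Polynomial.eval_monomial, mul_left_comm _ a]
    rw [integral_const_mul, this, mul_zero]

theorem eqOn_zero_of_integral_sq_eq_zero {h : ℝ → ℝ} (hh : Continuous h)
    (h0 : ∫ x, h x * h x ∂angleMeasure = 0) : ∀ x ∈ Icc 0 Real.pi, h x = 0 := by
  have hae : (fun x => h x * h x) =ᵐ[angleMeasure] 0 :=
    (integral_eq_zero_iff_of_nonneg (fun x => mul_self_nonneg _)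
      (hh.fun_mul hh).integrable_angleMeasure).1 h0
  have hae2 : (fun x => h x * h x) =ᵐ[volume.restrict (Icc 0 Real.pi)] fun _ => 0 := by
    rw [← restrict_Ioc_eq_restrict_Icc]; exact hae
  intro x hx
  have := Measure.eqOn_Icc_of_ae_eq volume Real.pi_pos.ne hae2 (hh.fun_mul hh).continuousOn
    continuousOn_const hx
  exact mul_self_eq_zero.1 this

/-- By Weierstrass, h is uniformly close to a polynomial in cos x, and h is orthogonal to that
polynomial. Hence ∫ h² equals ∫ h·(h - p(cos x)), which is arbitrarily small. -/
theorem eqOn_zero_of_cos_coeff_eq_zero {h : ℝ → ℝ} (hh : Continuous h)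
    (h0 : ∀ k : ℕ, ∫ x, h x * Real.cos (k * x) ∂angleMeasure = 0) :
    ∀ x ∈ Icc 0 Real.pi, h x = 0 := by
  refine eqOn_zero_of_integral_sq_eq_zero hh (le_antisymm ?_
    (integral_nonneg fun x => mul_self_nonneg _))
  set J := ∫ x, |h x| ∂angleMeasure
  have hJ : 0 ≤ J := integral_nonneg fun x => abs_nonneg _
  refine le_of_forall_pos_le_add fun ε hε => ?_
  obtain ⟨p, hp⟩ := exists_polynomial_near_of_continuousOn (-1) 1 (fun t => h (Real.arccos t))
    (hh.comp Real.continuous_arccos).continuousOn (ε / (J + 1)) (by positivity)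
  have hzero := integral_mul_polynomial_cos_eq_zero hh h0 p
  have hpc : Continuous fun x => p.eval (Real.cos x) := by fun_prop
  calc ∫ x, h x * h x ∂angleMeasure
      = ∫ x, h x * (h x - p.eval (Real.cos x)) ∂angleMeasure := by
        simp_rw [mul_sub]
        rw [integral_sub (hh.fun_mul hh).integrable_angleMeasure
          (hh.fun_mul hpc).integrable_angleMeasure, hzero, sub_zero]
    _ ≤ ∫ x, |h x| * (ε / (J + 1)) ∂angleMeasure := by
        refine integral_mono_ae (hh.fun_mul (hh.fun_sub hpc)).integrable_angleMeasure
          (hh.abs.fun_mul continuous_const).integrable_angleMeasure ?_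
        have hmem : ∀ᵐ x ∂angleMeasure, x ∈ Ioc 0 Real.pi := ae_restrict_mem measurableSet_Ioc
        filter_upwards [hmem] with x hx
        have := hp (Real.cos x) ⟨Real.neg_one_le_cos x, Real.cos_le_one x⟩
        rw [Real.arccos_cos hx.1.le hx.2, abs_sub_comm] at this
        calc h x * (h x - p.eval (Real.cos x)) ≤ |h x * (h x - p.eval (Real.cos x))| := le_abs_self _
          _ = |h x| * |h x - p.eval (Real.cos x)| := abs_mul _ _
          _ ≤ _ := by gcongr
    _ = J * (ε / (J + 1)) := integral_mul_const _ _
    _ ≤ 0 + ε := by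
        rw [zero_add, mul_div_assoc', div_le_iff₀ (by positivity)]
        nlinarith


/-! ### Double cosine series of a smooth kernel. -/

theorem hasSum_integral_of_hasSumUniformlyOn {Ω ι : Type*} [MeasurableSpace Ω] {μ : Measure Ω}
    [IsFiniteMeasure μ] {f : ι → Ω → ℝ} {S : Ω → ℝ} {A : Set Ω} (hA : ∀ᵐ p ∂μ, p ∈ A)
    (h : HasSumUniformlyOn f S A) (hf : ∀ i, Integrable (f i) μ) (hS : Integrable S μ) :
    HasSum (fun i => ∫ p, f i p ∂μ) (∫ p, S p ∂μ) := by
  rw [hasSumUniformlyOn_iff_tendstoUniformlyOn, Metric.tendstoUniformlyOn_iff] at h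
  refine Metric.tendsto_nhds.2 fun ε hε => ?_
  set M := μ.real univ
  have hM : 0 ≤ M := measureReal_nonneg
  filter_upwards [h (ε / (M + 1)) (by positivity)] with s hs
  rw [dist_comm, Real.dist_eq, ← integral_finsetSum _ (fun i _ => hf i), ← integral_sub hS
    (integrable_finsetSum _ fun i _ => hf i)]
  calc |∫ p, S p - ∑ i ∈ s, f i p ∂μ| ≤ (ε / (M + 1)) * M := by
        rw [← Real.norm_eq_abs]
        refine norm_integral_le_of_norm_le_const (μ := μ) ?_
        filter_upwards [hA] with p hp
        exact (hs p hp).le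
    _ < ε := by
        rw [div_mul_eq_mul_div, div_lt_iff₀ (by positivity)]
        nlinarith

/-- The reciprocal of the mean square of `cos (k x)`. -/
noncomputable def cosWeight (k : ℕ) : ℝ := if k = 0 then 1 else 2

theorem cosWeight_nonneg (k : ℕ) : 0 ≤ cosWeight k := by unfold cosWeight; split_ifs <;> norm_num

theorem cosWeight_le_two (k : ℕ) : cosWeight k ≤ 2 := by unfold cosWeight; split_ifs <;> norm_num

theorem cosWeight_mul_integral (k l : ℕ) : cosWeight l *
    ∫ x, Real.cos (k * x) * Real.cos (l * x) ∂angleMeasure = if k = l then Real.pi else 0 := by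
  rw [integral_cos_mul_cos, cosWeight]
  split_ifs <;> first | (exfalso; omega) | ring

/-- The coefficients of the expansion of `F` in products of cosines. -/
noncomputable def cosCoeff (F : ℝ × ℝ → ℝ) (k l : ℕ) : ℝ :=
  cosWeight k * cosWeight l / Real.pi ^ 2 *
    pairing F (fun x => Real.cos (k * x)) (fun y => Real.cos (l * y))

theorem pairing_cos_cos (F : ℝ × ℝ → ℝ) {k l : ℕ} (hk : k ≠ 0) (hl : l ≠ 0) :
    pairing F (fun x => Real.cos (k * x)) (fun y => Real.cos (l * y)) =
      Real.pi ^ 2 / 4 * cosCoeff F k l := by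
  have := Real.pi_pos
  simp only [cosCoeff, cosWeight, hk, hl, if_false]
  field_simp
  norm_num

theorem sq_cosCoeff_le (F : ℝ × ℝ → ℝ) (k l : ℕ) : cosCoeff F k l ^ 2 ≤
    pairing F (fun x => Real.cos (k * x)) (fun y => Real.cos (l * y)) ^ 2 := by
  rw [cosCoeff, mul_pow]
  refine mul_le_of_le_one_left (sq_nonneg _) ?_
  have h1 := cosWeight_nonneg k
  have h2 := cosWeight_nonneg l
  have h3 : cosWeight k * cosWeight l ≤ 2 * 2 :=
    mul_le_mul (cosWeight_le_two k) (cosWeight_le_two l) h2 (by norm_num)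
  refine pow_le_one₀ (by positivity) ?_
  rw [div_le_one (by positivity)]
  nlinarith [Real.pi_gt_three]

theorem cosCoeff_comm {F : ℝ × ℝ → ℝ} (hF : ∀ x y, F (x, y) = F (y, x)) (k l : ℕ) :
    cosCoeff F k l = cosCoeff F l k := by
  rw [cosCoeff, cosCoeff, mul_comm (cosWeight k)]
  congr 1
  rw [pairing, pairing, ← integral_prod_swap]
  refine integral_congr_ae (Filter.Eventually.of_forall fun p => ?_)
  simp only [Prod.swap, hF p.2 p.1]
  ring

/-- Multiply out (1 + k²)(1 + l²): the four terms are, after integration by parts, dominated by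
Bessel sums for F, ∂₁F, ∂₂F and ∂₂∂₁F. Each variable is differentiated once, against a cosine, so no
boundary condition on F is needed. -/
theorem summable_weighted_sq_cosCoeff {F : ℝ × ℝ → ℝ} (hF : ContDiff ℝ 2 F) :
    Summable fun kl : ℕ × ℕ =>
      (1 + (kl.1 : ℝ) ^ 2) * (1 + (kl.2 : ℝ) ^ 2) * cosCoeff F kl.1 kl.2 ^ 2 := by
  have hF1 : ContDiff ℝ 1 F := hF.of_le (by norm_num)
  have hx1 : ContDiff ℝ 1 (partialFst F) := contDiff_partialFst (n := 1) (by exact_mod_cast hF)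
  have hy := continuous_partialSnd hF1
  have hxy := continuous_partialSnd hx1
  have s1 := summable_pairing_sq orthogonalSeq_cos orthogonalSeq_cos hF.continuous
  have s2 := summable_pairing_sq orthogonalSeq_sin orthogonalSeq_cos hx1.continuous
  have s3 := summable_pairing_sq orthogonalSeq_cos orthogonalSeq_sin hy
  have s4 := summable_pairing_sq orthogonalSeq_sin orthogonalSeq_sin hxy
  refine Summable.of_nonneg_of_le (fun _ => by positivity) (fun kl => ?_)
    (((s1.add s2).add s3).add s4)
  obtain ⟨k, l⟩ := kl
  set P := pairing F (fun x => Real.cos (k * x)) (fun y => Real.cos (l * y))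
  have e2 : pairing (partialFst F) (fun x => Real.sin (k * x)) (fun y => Real.cos (l * y)) =
      -(k * P) := by
    rw [nat_mul_pairing_cos_fst hF1 (by fun_prop)]; ring
  have e3 : pairing (partialSnd F) (fun x => Real.cos (k * x)) (fun y => Real.sin (l * y)) =
      -(l * P) := by
    rw [nat_mul_pairing_cos_snd hF1 (by fun_prop)]; ring
  have e4 : pairing (partialSnd (partialFst F)) (fun x => Real.sin (k * x))
      (fun y => Real.sin (l * y)) = l * (k * P) := by
    rw [nat_mul_pairing_cos_fst hF1 (by fun_prop), mul_neg,
      nat_mul_pairing_cos_snd hx1 (by fun_prop), neg_neg]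
  simp only [e2, e3, e4]
  calc _ ≤ (1 + (k : ℝ) ^ 2) * (1 + (l : ℝ) ^ 2) * P ^ 2 :=
        mul_le_mul_of_nonneg_left (sq_cosCoeff_le F k l) (by positivity)
    _ = _ := by ring

theorem summable_inv_one_add_sq : Summable fun k : ℕ => (1 + (k : ℝ) ^ 2)⁻¹ := by
  have h : Summable fun k : ℕ => ((k : ℝ) ^ 2)⁻¹ := Real.summable_nat_pow_inv.2 (by norm_num)
  refine (summable_nat_add_iff 1).1 ?_
  refine Summable.of_nonneg_of_le (fun k => by positivity) (fun k => ?_)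
    ((summable_nat_add_iff 1).2 h)
  gcongr
  linarith

/-- With A = (1 + k²)(1 + l²), the elementary bound |c| ≤ 1/A + A c² reduces absolute summability to
two known sums. -/
theorem summable_abs_cosCoeff {F : ℝ × ℝ → ℝ} (hF : ContDiff ℝ 2 F) :
    Summable fun kl : ℕ × ℕ => |cosCoeff F kl.1 kl.2| := by
  have h1 := summable_inv_one_add_sq.mul_of_nonneg summable_inv_one_add_sq
    (fun k => by positivity) (fun k => by positivity)
  refine Summable.of_nonneg_of_le (fun _ => abs_nonneg _) (fun kl => ?_)
    (h1.add (summable_weighted_sq_cosCoeff hF))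
  obtain ⟨k, l⟩ := kl
  simp only
  set A := (1 + (k : ℝ) ^ 2) * (1 + (l : ℝ) ^ 2) with hA
  have hA0 : 0 < A := by positivity
  rw [← mul_inv, ← hA, ← sq_abs]
  set c := |cosCoeff F k l|
  have hc : 0 ≤ c := abs_nonneg _
  have h : c * A ≤ (A⁻¹ + A * c ^ 2) * A := by
    have : A⁻¹ * A = 1 := inv_mul_cancel₀ hA0.ne'
    nlinarith [sq_nonneg (A * c - 1)]
  exact le_of_mul_le_mul_right h hA0

theorem abs_cos_mul_cos_le (c x y : ℝ) : |c * (Real.cos x * Real.cos y)| ≤ |c| := by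
  rw [abs_mul, abs_mul]
  exact mul_le_of_le_one_right (abs_nonneg _)
    (mul_le_one₀ (Real.abs_cos_le_one _) (abs_nonneg _) (Real.abs_cos_le_one _))

/-- Completeness of the cosines is used once in each variable: in y for fixed x, and before that in
x for the resulting y-coefficients. -/
theorem pairing_eq_zero_imp {h : ℝ × ℝ → ℝ} (hh : Continuous h)
    (h0 : ∀ k l : ℕ, pairing h (fun x => Real.cos (k * x)) (fun y => Real.cos (l * y)) = 0)
    {x y : ℝ} (hx : x ∈ Icc 0 Real.pi) (hy : y ∈ Icc 0 Real.pi) : h (x, y) = 0 := by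
  have hc : ∀ l : ℕ, Continuous fun x => ∫ y, h (x, y) * Real.cos (l * y) ∂angleMeasure := by
    intro l
    simp_rw [integral_angleMeasure]
    exact intervalIntegral.continuous_parametric_intervalIntegral_of_continuous'
      (f := fun x y => h (x, y) * Real.cos (l * y)) (by fun_prop) _ _
  refine eqOn_zero_of_cos_coeff_eq_zero (h := fun y => h (x, y)) (by fun_prop) (fun l => ?_) y hy
  refine eqOn_zero_of_cos_coeff_eq_zero (hc l) (fun k => ?_) x hx
  rw [← pairing_eq_integral hh (by fun_prop) (by fun_prop), h0]

theorem pairing_cos_mul_cos (a : ℝ) (k l m n : ℕ) :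
    pairing (fun p => a * (Real.cos (k * p.1) * Real.cos (l * p.2))) (fun x => Real.cos (m * x))
      (fun y => Real.cos (n * y)) =
    a * ((∫ x, Real.cos (k * x) * Real.cos (m * x) ∂angleMeasure) *
      ∫ x, Real.cos (l * x) * Real.cos (n * x) ∂angleMeasure) := by
  rw [← integral_prod_mul, ← integral_const_mul, pairing]
  exact integral_congr_ae (Filter.Eventually.of_forall fun p => by ring)

/-- The series converges absolutely and uniformly to a continuous function with the same cosine
coefficients as F. Completeness identifies the two on the square. -/
theorem hasSum_cosCoeff {F : ℝ × ℝ → ℝ} (hF : ContDiff ℝ 2 F) {x y : ℝ}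
    (hx : x ∈ Icc 0 Real.pi) (hy : y ∈ Icc 0 Real.pi) :
    HasSum (fun kl : ℕ × ℕ => cosCoeff F kl.1 kl.2 * (Real.cos (kl.1 * x) * Real.cos (kl.2 * y)))
      (F (x, y)) := by
  set f : ℕ × ℕ → ℝ × ℝ → ℝ := fun kl p =>
    cosCoeff F kl.1 kl.2 * (Real.cos (kl.1 * p.1) * Real.cos (kl.2 * p.2)) with hf
  have hs := summable_abs_cosCoeff hF
  have hb : ∀ kl p, ‖f kl p‖ ≤ |cosCoeff F kl.1 kl.2| := fun kl p => abs_cos_mul_cos_le _ _ _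
  have hfc : ∀ kl, Continuous (f kl) := fun kl => by fun_prop
  set G : ℝ × ℝ → ℝ := fun p => ∑' kl, f kl p with hG
  have hGc : Continuous G := continuous_tsum hfc hs hb
  have hu : HasSumUniformlyOn f G univ :=
    HasSumUniformlyOn.of_norm_le_summable hs fun kl p _ => hb kl p
  have hsum : Summable fun kl => f kl (x, y) := Summable.of_norm_bounded hs fun kl => hb kl _
  have key : F (x, y) - G (x, y) = 0 := by
    refine pairing_eq_zero_imp (h := fun p => F p - G p) (hF.continuous.sub hGc)
      (fun m n => ?_) hx hy
    have hgc : Continuous fun p : ℝ × ℝ => Real.cos (m * p.1) * Real.cos (n * p.2) := by fun_prop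
    have hu2 : HasSumUniformlyOn
        (fun kl p => f kl p * (Real.cos (m * p.1) * Real.cos (n * p.2)))
        (fun p => G p * (Real.cos (m * p.1) * Real.cos (n * p.2))) univ := by
      have := HasSumUniformlyOn.of_norm_le_summable (s := univ)
        (f := fun kl (p : ℝ × ℝ) => f kl p * (Real.cos (m * p.1) * Real.cos (n * p.2))) hs
        (fun kl p _ => by
          rw [norm_mul]
          exact (mul_le_of_le_one_right (norm_nonneg _)
            (by simpa using abs_cos_mul_cos_le 1 (m * p.1) (n * p.2))).trans (hb kl p))
      refine this.congr_right fun p _ => ?_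
      exact tsum_mul_right
    have hI := hasSum_integral_of_hasSumUniformlyOn (μ := angleMeasure.prod angleMeasure)
      (Filter.Eventually.of_forall fun p => mem_univ p) hu2
      (fun kl => ((hfc kl).mul hgc).integrable_angleMeasure_prod)
      (hGc.mul hgc).integrable_angleMeasure_prod
    have hI2 := hI.unique (hasSum_single (m, n) fun kl hkl => ?_)
    · simp only [pairing, sub_mul]
      rw [integral_sub (hF.continuous.fun_mul hgc).integrable_angleMeasure_prod
        (hGc.fun_mul hgc).integrable_angleMeasure_prod, hI2]
      change pairing F (fun x => Real.cos (m * x)) (fun y => Real.cos (n * y)) -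
        pairing (f (m, n)) (fun x => Real.cos (m * x)) (fun y => Real.cos (n * y)) = 0
      rw [hf, pairing_cos_mul_cos, cosCoeff]
      have h1 := cosWeight_mul_integral m m
      have h2 := cosWeight_mul_integral n n
      simp only [if_true] at h1 h2
      rw [sub_eq_zero]
      have hpi := Real.pi_pos
      set P := pairing F (fun x => Real.cos (m * x)) (fun y => Real.cos (n * y))
      set I1 := ∫ x, Real.cos (m * x) * Real.cos (m * x) ∂angleMeasure
      set I2 := ∫ x, Real.cos (n * x) * Real.cos (n * x) ∂angleMeasure
      calc P = P * (Real.pi * Real.pi) / Real.pi ^ 2 := by field_simp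
        _ = P * ((cosWeight m * I1) * (cosWeight n * I2)) / Real.pi ^ 2 := by rw [h1, h2]
        _ = _ := by ring
    · change pairing (f kl) (fun x => Real.cos (m * x)) (fun y => Real.cos (n * y)) = 0
      rw [hf, pairing_cos_mul_cos, integral_cos_mul_cos, integral_cos_mul_cos]
      by_cases h1 : kl.1 = m
      · by_cases h2 : kl.2 = n
        · exact absurd (Prod.ext h1 h2) hkl
        · simp [h2]
      · simp [h1]
  rw [sub_eq_zero.1 key]
  exact hsum.hasSum

/-- Evenness and periodicity make the first and third partial derivatives odd and periodic, so they
vanish at 0 and π. The boundary terms of four integrations by parts then disappear. -/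
theorem summable_pow_four_cosCoeff {F : ℝ × ℝ → ℝ} (hF : ContDiff ℝ 4 F)
    (heven : ∀ x y, F (-x, y) = F (x, y)) (hper : ∀ x y, F (x + 2 * Real.pi, y) = F (x, y)) :
    Summable fun kl : ℕ × ℕ => ((kl.1 : ℝ) ^ 4 * cosCoeff F kl.1 kl.2) ^ 2 := by
  have odd_of_even : ∀ G : ℝ × ℝ → ℝ, ContDiff ℝ 1 G → (∀ x y, G (-x, y) = G (x, y)) →
      (∀ x y, G (x + 2 * Real.pi, y) = G (x, y)) →
      (∀ x y, partialFst G (-x, y) = -partialFst G (x, y)) ∧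
      (∀ x y, partialFst G (x + 2 * Real.pi, y) = partialFst G (x, y)) := by
    intro G hG he hp
    refine ⟨fun x y => ?_, fun x y => ?_⟩
    · have h1 := hasDerivAt_partialFst hG (-x) y
      have h2 := h1.scomp x (hasDerivAt_neg x)
      have h3 : (fun x => G (x, y)) ∘ Neg.neg = fun x => G (x, y) := funext fun t => he t y
      rw [h3] at h2
      have := h2.unique (hasDerivAt_partialFst hG x y)
      simp at this
      linarith
    · have h1 := (hasDerivAt_partialFst hG (x + 2 * Real.pi) y).comp_add_const x (2 * Real.pi)
      simp_rw [hp] at h1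
      exact h1.unique (hasDerivAt_partialFst hG x y)
  have even_of_odd : ∀ G : ℝ × ℝ → ℝ, ContDiff ℝ 1 G → (∀ x y, G (-x, y) = -G (x, y)) →
      (∀ x y, G (x + 2 * Real.pi, y) = G (x, y)) →
      (∀ x y, partialFst G (-x, y) = partialFst G (x, y)) ∧
      (∀ x y, partialFst G (x + 2 * Real.pi, y) = partialFst G (x, y)) := by
    intro G hG he hp
    refine ⟨fun x y => ?_, fun x y => ?_⟩
    · have h1 := hasDerivAt_partialFst hG (-x) y
      have h2 := h1.scomp x (hasDerivAt_neg x)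
      have h3 : (fun x => G (x, y)) ∘ Neg.neg = fun x => -G (x, y) := funext fun t => he t y
      rw [h3] at h2
      have := h2.unique (hasDerivAt_partialFst hG x y).fun_neg
      simpa using this
    · have h1 := (hasDerivAt_partialFst hG (x + 2 * Real.pi) y).comp_add_const x (2 * Real.pi)
      simp_rw [hp] at h1
      exact h1.unique (hasDerivAt_partialFst hG x y)
  have vanish : ∀ G : ℝ × ℝ → ℝ, (∀ x y, G (-x, y) = -G (x, y)) →
      (∀ x y, G (x + 2 * Real.pi, y) = G (x, y)) →
      (∀ y, G (0, y) = 0) ∧ ∀ y, G (Real.pi, y) = 0 := by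
    intro G he hp
    refine ⟨fun y => ?_, fun y => ?_⟩
    · have := he 0 y
      rw [neg_zero] at this
      linarith
    · have h1 := he Real.pi y
      have h2 := hp (-Real.pi) y
      rw [show -Real.pi + 2 * Real.pi = Real.pi by ring] at h2
      linarith
  have c1 : ContDiff ℝ 3 (partialFst F) := contDiff_partialFst (n := 3) (by exact_mod_cast hF)
  have c2 : ContDiff ℝ 2 (partialFst (partialFst F)) :=
    contDiff_partialFst (n := 2) (by exact_mod_cast c1)
  have c3 : ContDiff ℝ 1 (partialFst (partialFst (partialFst F))) :=
    contDiff_partialFst (n := 1) (by exact_mod_cast c2)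
  have c4 := continuous_partialFst c3
  have d0 : ContDiff ℝ 1 F := hF.of_le (by norm_num)
  have d1 := c1.of_le (m := 1) (by norm_num)
  have d2 := c2.of_le (m := 1) (by norm_num)
  have o1 := odd_of_even F d0 heven hper
  have o2 := even_of_odd _ d1 o1.1 o1.2
  have o3 := odd_of_even _ d2 o2.1 o2.2
  have v1 := vanish _ o1.1 o1.2
  have v3 := vanish _ o3.1 o3.2
  refine Summable.of_nonneg_of_le (fun _ => sq_nonneg _) (fun kl => ?_)
    (summable_pairing_sq orthogonalSeq_cos orthogonalSeq_cos c4)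
  obtain ⟨k, l⟩ := kl
  have hl : Continuous fun y : ℝ => Real.cos (l * y) := by fun_prop
  have e1 := nat_mul_pairing_cos_fst d0 hl k
  have e2 := nat_mul_pairing_sin_fst d1 hl v1.1 v1.2 k
  have e3 := nat_mul_pairing_cos_fst d2 hl k
  have e4 := nat_mul_pairing_sin_fst c3 hl v3.1 v3.2 k
  simp only [← e4]
  have h5 : k * pairing (partialFst (partialFst (partialFst F))) (fun x => Real.sin (k * x))
      (fun y => Real.cos (l * y)) =
      k ^ 4 * pairing F (fun x => Real.cos (k * x)) (fun y => Real.cos (l * y)) := by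
    rw [neg_eq_iff_eq_neg.1 e3.symm, ← e2, neg_eq_iff_eq_neg.1 e1.symm]; ring
  rw [h5, mul_pow, mul_pow ((k : ℝ) ^ 4)]
  exact mul_le_mul_of_nonneg_left (sq_cosCoeff_le F k l) (by positivity)


/-! ### The logarithmic kernel of the segment in the angular variable. -/

theorem integrable_prod_of_bound {X Y : Type*} [MeasurableSpace X] [MeasurableSpace Y]
    {μ : Measure X} {ν : Measure Y} [IsFiniteMeasure μ] [SFinite ν] {f : X × Y → ℝ} {C : ℝ}
    (hf : AEStronglyMeasurable f (μ.prod ν)) (hs : ∀ᵐ x ∂μ, Integrable (fun y => f (x, y)) ν)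
    (hC : ∀ᵐ x ∂μ, ∫ y, |f (x, y)| ∂ν ≤ C) : Integrable f (μ.prod ν) := by
  refine (integrable_prod_iff hf).2 ⟨hs, ?_⟩
  refine Integrable.of_bound hf.norm.integral_prod_right' C ?_
  filter_upwards [hC] with x hx
  rw [Real.norm_of_nonneg (integral_nonneg fun y => norm_nonneg _)]
  exact hx

/-- `log |1 - exp (i v)|`, away from the multiples of `2 π`. -/
noncomputable def logChord (v : ℝ) : ℝ := Real.log 2 + Real.log (Real.sin (v / 2))

theorem logChord_neg (v : ℝ) : logChord (-v) = logChord v := by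
  simp [logChord, neg_div]

theorem logChord_add_two_pi (v : ℝ) : logChord (v + 2 * Real.pi) = logChord v := by
  rw [logChord, show (v + 2 * Real.pi) / 2 = v / 2 + Real.pi by ring, Real.sin_add_pi,
    Real.log_neg_eq_log, logChord]

theorem intervalIntegrable_logChord (a b : ℝ) : IntervalIntegrable logChord volume a b := by
  refine IntervalIntegrable.add intervalIntegrable_const ?_
  have h := (intervalIntegrable_log_sin (a := a / 2) (b := b / 2)).comp_mul_left (c := 1 / 2)
    (by norm_num)
  have e : (fun x : ℝ => Real.log (Real.sin (x / 2))) =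
      fun x => (Real.log ∘ Real.sin) (1 / 2 * x) := by
    ext x
    rw [Function.comp_apply, one_div, inv_mul_eq_div]
  rw [e]
  convert h using 1 <;> ring

theorem norm_one_sub_exp_mul_I (v : ℝ) :
    ‖1 - Complex.exp (v * Complex.I)‖ = 2 * |Real.sin (v / 2)| := by
  rw [norm_sub_rev, mul_comm, Complex.norm_exp_I_mul_ofReal_sub_one]
  simp

/-- Inside the unit disc, -log|1 - r exp(iv)| is the uniformly convergent series ∑ rⁿ cos(nv)/n.
Orthogonality leaves the term n = k. -/
theorem integral_log_norm_one_sub_mul_cos {r : ℝ} (hr0 : 0 ≤ r) (hr1 : r < 1) {k : ℕ}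
    (hk : k ≠ 0) : ∫ v, Real.log ‖1 - r * Complex.exp (v * Complex.I)‖ * Real.cos (k * v)
      ∂angleMeasure = -(Real.pi / 2 * (r ^ k / k)) := by
  have hnorm : ∀ v : ℝ, ‖(r : ℂ) * Complex.exp (v * Complex.I)‖ = r := fun v => by
    rw [norm_mul, Complex.norm_exp_ofReal_mul_I]; simp [abs_of_nonneg hr0]
  have hne : ∀ v : ℝ, 1 - (r : ℂ) * Complex.exp (v * Complex.I) ≠ 0 := fun v h => by
    have := hnorm v
    rw [← sub_eq_zero.1 h] at this
    simp at this
    linarith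
  have hsum : ∀ v : ℝ, HasSum (fun n : ℕ => r ^ n / n * Real.cos (n * v))
      (-Real.log ‖1 - r * Complex.exp (v * Complex.I)‖) := by
    intro v
    have h := Complex.hasSum_taylorSeries_neg_log (z := r * Complex.exp (v * Complex.I))
      (by rw [hnorm]; exact hr1)
    have h2 := Complex.hasSum_re h
    rw [Complex.neg_re, Complex.log_re] at h2
    convert h2 using 2 with n
    rw [mul_pow, ← Complex.exp_nat_mul, ← Complex.ofReal_pow, Complex.div_natCast_re,
      Complex.re_ofReal_mul, show (n : ℂ) * (v * Complex.I) = ((n * v : ℝ) : ℂ) * Complex.I by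
        push_cast; ring, Complex.exp_ofReal_mul_I_re]
    ring
  have hgeo : Summable fun n : ℕ => r ^ n := summable_geometric_of_lt_one hr0 hr1
  have hb : ∀ (n : ℕ) (v : ℝ), ‖r ^ n / n * Real.cos (n * v) * Real.cos (k * v)‖ ≤ r ^ n := by
    intro n v
    rw [mul_assoc]
    refine (abs_cos_mul_cos_le _ _ _).trans ?_
    rw [abs_of_nonneg (by positivity)]
    rcases Nat.eq_zero_or_pos n with rfl | hn
    · simp
    · exact div_le_self (by positivity) (by exact_mod_cast hn)
  have hu := HasSumUniformlyOn.of_norm_le_summable (s := univ) hgeo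
    (f := fun (n : ℕ) (v : ℝ) => r ^ n / n * Real.cos (n * v) * Real.cos (k * v))
    fun n v _ => hb n v
  have hu2 := hu.congr_right (g' := fun v : ℝ =>
    -Real.log ‖1 - r * Complex.exp (v * Complex.I)‖ * Real.cos (k * v))
    fun v _ => ((hsum v).mul_right _).tsum_eq
  have hlc : Continuous fun v : ℝ =>
      -Real.log ‖1 - r * Complex.exp (v * Complex.I)‖ * Real.cos (k * v) := by
    refine Continuous.mul (Continuous.neg (Continuous.log (by fun_prop) fun v => ?_)) (by fun_prop)
    exact norm_ne_zero_iff.2 (hne v)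
  have hI := hasSum_integral_of_hasSumUniformlyOn (μ := angleMeasure)
    (Filter.Eventually.of_forall fun p => mem_univ p) hu2
    (fun n => Continuous.integrable_angleMeasure (by fun_prop)) hlc.integrable_angleMeasure
  have hI2 := hI.unique (hasSum_single k fun n hn => ?_)
  · simp only [neg_mul, integral_neg, mul_assoc] at hI2
    rw [integral_const_mul, integral_cos_mul_cos, if_pos rfl, if_neg hk] at hI2
    linarith
  · simp_rw [mul_assoc]
    rw [integral_const_mul, integral_cos_mul_cos, if_neg hn, mul_zero]

-- Let r tend to 1 in the formula for r < 1. The logarithms are dominated by |log sin(v/2)| + log 2.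
open Filter Topology in
theorem integral_logChord_mul_cos {k : ℕ} (hk : k ≠ 0) :
    ∫ v, logChord v * Real.cos (k * v) ∂angleMeasure = -(Real.pi / 2 * (1 / k)) := by
  have hmem : ∀ᵐ x ∂angleMeasure, x ∈ Ioc 0 Real.pi := ae_restrict_mem measurableSet_Ioc
  have hsin : ∀ v ∈ Ioc 0 Real.pi, 0 < Real.sin (v / 2) := fun v hv =>
    Real.sin_pos_of_pos_of_lt_pi (by linarith [hv.1]) (by linarith [hv.2, Real.pi_pos])
  have h1 : Tendsto (fun r : ℝ => ∫ v, Real.log ‖1 - r * Complex.exp (v * Complex.I)‖ *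
      Real.cos (k * v) ∂angleMeasure) (𝓝[<] 1)
      (𝓝 (∫ v, logChord v * Real.cos (k * v) ∂angleMeasure)) := by
    refine tendsto_integral_filter_of_dominated_convergence
      (fun v => |Real.log (Real.sin (v / 2))| + Real.log 2) ?_ ?_ ?_ ?_
    · refine Eventually.of_forall fun r => Measurable.aestronglyMeasurable ?_
      fun_prop
    · filter_upwards [Ico_mem_nhdsLT (show (0 : ℝ) < 1 by norm_num)] with r hr
      filter_upwards [hmem] with v hv
      rw [norm_mul, Real.norm_eq_abs, Real.norm_eq_abs]
      refine (mul_le_of_le_one_right (abs_nonneg _) (Real.abs_cos_le_one _)).trans ?_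
      have hs := hsin v hv
      have hE : ‖Complex.exp (v * Complex.I)‖ = 1 := Complex.norm_exp_ofReal_mul_I v
      have hN := norm_one_sub_exp_mul_I v
      rw [abs_of_pos hs] at hN
      set e := Complex.exp (v * Complex.I)
      have hre : ‖(r : ℂ) * e‖ = r := by
        rw [norm_mul, hE]; simp [abs_of_nonneg hr.1]
      -- Since 1 - r ≤ |1 - re|, the triangle inequality gives |1 - e| ≤ 2|1 - re|. So sin(v/2) is a
      -- lower bound that does not depend on r.
      have l1 : 1 - r ≤ ‖1 - r * e‖ := by
        have := norm_sub_norm_le (1 : ℂ) (r * e)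
        rw [hre] at this; simpa using this
      have l2 : ‖1 - e‖ ≤ ‖1 - r * e‖ + (1 - r) := by
        have h3 : (1 : ℂ) - e = (1 - r * e) + (-(((1 - r : ℝ) : ℂ) * e)) := by push_cast; ring
        rw [h3]
        refine (norm_add_le _ _).trans ?_
        rw [norm_neg, norm_mul, hE, Complex.norm_real, Real.norm_of_nonneg (by linarith [hr.2])]
        simp
      have l3 : Real.sin (v / 2) ≤ ‖1 - r * e‖ := by linarith
      have l4 : ‖1 - r * e‖ ≤ 2 := by
        refine (norm_sub_le _ _).trans ?_
        rw [hre]; simp; linarith [hr.2]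
      have m1 := Real.log_le_log hs l3
      have m2 := Real.log_le_log (hs.trans_le l3) l4
      have m3 := neg_abs_le (Real.log (Real.sin (v / 2)))
      have m4 : 0 ≤ Real.log 2 := Real.log_nonneg (by norm_num)
      rw [abs_le]
      constructor
      · linarith
      · linarith [abs_nonneg (Real.log (Real.sin (v / 2)))]
    · refine Integrable.add ?_ (integrable_const _)
      refine Integrable.abs (integrable_angleMeasure_iff.2 ?_)
      have := (intervalIntegrable_logChord 0 Real.pi).sub
        (intervalIntegrable_const (c := Real.log 2))
      refine this.congr fun x _ => by simp [logChord]
    · filter_upwards [hmem] with v hv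
      refine Tendsto.mul_const _ ?_
      have hs := hsin v hv
      have hN := norm_one_sub_exp_mul_I v
      rw [abs_of_pos hs] at hN
      have hL : logChord v = Real.log ‖1 - ((1 : ℝ) : ℂ) * Complex.exp (v * Complex.I)‖ := by
        rw [Complex.ofReal_one, one_mul, hN, Real.log_mul two_ne_zero hs.ne', logChord]
      rw [hL]
      refine (ContinuousAt.tendsto (f := fun r : ℝ =>
        Real.log ‖1 - (r : ℂ) * Complex.exp (v * Complex.I)‖) ?_).mono_left nhdsWithin_le_nhds
      refine ContinuousAt.log (by fun_prop) ?_
      rw [Complex.ofReal_one, one_mul, hN]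
      positivity
  refine tendsto_nhds_unique h1 ?_
  have h2 : Tendsto (fun r : ℝ => -(Real.pi / 2 * (r ^ k / k))) (𝓝[<] 1)
      (𝓝 (-(Real.pi / 2 * (1 ^ k / k)))) :=
    (Continuous.tendsto (by fun_prop) 1).mono_left nhdsWithin_le_nhds
  rw [one_pow] at h2
  refine h2.congr' ?_
  filter_upwards [Ico_mem_nhdsLT (show (0 : ℝ) < 1 by norm_num)] with r hr
  rw [integral_log_norm_one_sub_mul_cos hr.1 hr.2 hk]

theorem integral_logChord : ∫ v, logChord v ∂angleMeasure = 0 := by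
  rw [integral_angleMeasure]
  have h := intervalIntegral.integral_comp_mul_left (a := 0) (b := Real.pi)
    (fun x => Real.log (Real.sin x)) (c := 1 / 2) (by norm_num)
  simp only [logChord]
  rw [intervalIntegral.integral_add intervalIntegrable_const]
  · have e : (fun x : ℝ => Real.log (Real.sin (x / 2))) =
        fun x => Real.log (Real.sin (1 / 2 * x)) := by
      ext x; congr 2; ring
    rw [e, h, show 1 / 2 * 0 = (0 : ℝ) by ring, show 1 / 2 * Real.pi = Real.pi / 2 by ring,
      integral_log_sin_zero_pi_div_two]
    simp; ring
  · refine ((intervalIntegrable_logChord 0 Real.pi).sub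
        (intervalIntegrable_const (c := Real.log 2))).congr
        fun x _ => by simp [logChord]

theorem log_abs_cos_sub_cos {x y : ℝ} (h : Real.cos x ≠ Real.cos y) :
    Real.log |Real.cos x - Real.cos y| = logChord (x - y) + logChord (x + y) - Real.log 2 := by
  have e := Real.cos_sub_cos x y
  have hne : Real.sin ((x + y) / 2) * Real.sin ((x - y) / 2) ≠ 0 := by
    intro h0
    apply h
    rw [← sub_eq_zero, e, mul_assoc, h0, mul_zero]
  have h1 := left_ne_zero_of_mul hne
  have h2 := right_ne_zero_of_mul hne
  rw [Real.log_abs, e, mul_assoc, Real.log_mul (by norm_num) hne, Real.log_mul h1 h2,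
    Real.log_neg_eq_log, logChord, logChord]
  ring

theorem cos_ne_cos {x y : ℝ} (hx : x ∈ Icc 0 Real.pi) (hy : y ∈ Icc 0 Real.pi) (h : x ≠ y) :
    Real.cos x ≠ Real.cos y := fun he => h (Real.injOn_cos hx hy he)

theorem ae_angleMeasure_mem : ∀ᵐ x ∂angleMeasure, x ∈ Icc 0 Real.pi := by
  filter_upwards [(ae_restrict_mem measurableSet_Ioc :
    ∀ᵐ x ∂angleMeasure, x ∈ Ioc 0 Real.pi)] with x hx
  exact Ioc_subset_Icc_self hx

theorem ae_angleMeasure_ne (x : ℝ) : ∀ᵐ y ∂angleMeasure, x ≠ y := by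
  have : ∀ᵐ y : ℝ, y ≠ x := by simp [ae_iff]
  filter_upwards [ae_restrict_of_ae this] with y hy using hy.symm

theorem log_abs_cos_sub_cos_ae {x : ℝ} (hx : x ∈ Icc 0 Real.pi) :
    (fun y => Real.log |Real.cos x - Real.cos y|) =ᵐ[angleMeasure]
      fun y => logChord (x - y) + logChord (x + y) - Real.log 2 := by
  filter_upwards [ae_angleMeasure_mem, ae_angleMeasure_ne x] with y hy hxy
  exact log_abs_cos_sub_cos (cos_ne_cos hx hy hxy)

theorem integrable_logChord_comp (x : ℝ) :
    Integrable (fun y => logChord (x - y)) angleMeasure ∧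
      Integrable (fun y => logChord (x + y)) angleMeasure := by
  constructor
  · refine integrable_angleMeasure_iff.2 ?_
    have h := (intervalIntegrable_logChord (x - 0) (x - Real.pi)).comp_sub_left x
    simpa using h
  · refine integrable_angleMeasure_iff.2 ?_
    have h := (intervalIntegrable_logChord (x + 0) (x + Real.pi)).comp_add_left x
    simpa using h

theorem integrable_log_abs_cos_sub_cos {x : ℝ} (hx : x ∈ Icc 0 Real.pi) :
    Integrable (fun y => Real.log |Real.cos x - Real.cos y|) angleMeasure := by
  have h := integrable_logChord_comp x
  exact ((h.1.add h.2).sub (integrable_const (Real.log 2))).congr (log_abs_cos_sub_cos_ae hx).symm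

theorem MeasureTheory.Integrable.mul_continuous_angleMeasure {f g : ℝ → ℝ} (hf : Integrable f angleMeasure)
    (hg : Continuous g) : Integrable (fun y => f y * g y) angleMeasure := by
  rw [integrable_angleMeasure_iff] at *
  exact hf.mul_continuousOn hg.continuousOn

/-- The two translates are the values at y and -y, so the integral over (0, π] unfolds to a full
period. Translation then moves x into the cosine, and the sine part vanishes because `logChord` is
even. -/
theorem integral_logChord_sub_add_mul_cos (x : ℝ) (k : ℕ) :
    ∫ y, (logChord (x - y) + logChord (x + y)) * Real.cos (k * y) ∂angleMeasure =
      2 * Real.cos (k * x) * ∫ v, logChord v * Real.cos (k * v) ∂angleMeasure := by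
  have h := integrable_logChord_comp x
  have hc : Continuous fun y : ℝ => Real.cos (k * y) := by fun_prop
  have hs : Continuous fun y : ℝ => Real.sin (k * y) := by fun_prop
  have i0 : ∀ a b : ℝ, IntervalIntegrable (fun v => logChord v * Real.cos (k * v)) volume a b :=
    fun a b => (intervalIntegrable_logChord a b).mul_continuousOn hc.continuousOn
  have i1 : ∀ a b : ℝ, IntervalIntegrable (fun v => logChord v * Real.sin (k * v)) volume a b :=
    fun a b => (intervalIntegrable_logChord a b).mul_continuousOn hs.continuousOn
  have iadd : ∀ a b : ℝ, IntervalIntegrable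
      (fun v => logChord (x + v) * Real.cos (k * v)) volume a b := fun a b => by
    have h := (intervalIntegrable_logChord (x + a) (x + b)).comp_add_left x
    exact (by simpa using h : IntervalIntegrable (fun v => logChord (x + v)) volume a b).mul_continuousOn
      hc.continuousOn
  simp_rw [add_mul]
  rw [integral_add (h.1.mul_continuous_angleMeasure hc) (h.2.mul_continuous_angleMeasure hc)]
  simp_rw [integral_angleMeasure]
  have e1 : ∫ y in (0 : ℝ)..Real.pi, logChord (x - y) * Real.cos (k * y) =
      ∫ y in (-Real.pi)..0, logChord (x + y) * Real.cos (k * y) := by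
    rw [← neg_zero, ← intervalIntegral.integral_comp_neg]
    simp [sub_eq_add_neg]
  rw [e1, intervalIntegral.integral_add_adjacent_intervals (iadd _ _) (iadd _ _)]
  have e2 : ∫ y in (-Real.pi)..Real.pi, logChord (x + y) * Real.cos (k * y) =
      ∫ v in (x + -Real.pi)..(x + Real.pi), logChord v * Real.cos (k * (v - x)) := by
    rw [← intervalIntegral.integral_comp_add_left
      (fun v => logChord v * Real.cos (k * (v - x))) x]
    simp
  have hper : Function.Periodic (fun v => logChord v * Real.cos (k * (v - x))) (2 * Real.pi) := by
    intro v
    simp only [logChord_add_two_pi]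
    rw [show (k : ℝ) * (v + 2 * Real.pi - x) = k * (v - x) + k * (2 * Real.pi) by ring,
      Real.cos_add_nat_mul_two_pi]
  have e3 : ∫ v in (x + -Real.pi)..(x + Real.pi), logChord v * Real.cos (k * (v - x)) =
      ∫ v in (-Real.pi)..Real.pi, logChord v * Real.cos (k * (v - x)) := by
    have := hper.intervalIntegral_add_eq (x + -Real.pi) (-Real.pi)
    rw [show x + -Real.pi + 2 * Real.pi = x + Real.pi by ring,
      show -Real.pi + 2 * Real.pi = Real.pi by ring] at this
    exact this
  have e4 : ∀ v : ℝ, logChord v * Real.cos (k * (v - x)) =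
      Real.cos (k * x) * (logChord v * Real.cos (k * v)) +
        Real.sin (k * x) * (logChord v * Real.sin (k * v)) := by
    intro v
    rw [mul_sub, Real.cos_sub]; ring
  rw [e2, e3]
  simp_rw [e4]
  rw [intervalIntegral.integral_add ((i0 _ _).const_mul _) ((i1 _ _).const_mul _),
    intervalIntegral.integral_const_mul, intervalIntegral.integral_const_mul,
    ← intervalIntegral.integral_add_adjacent_intervals (i0 (-Real.pi) 0) (i0 0 Real.pi),
    ← intervalIntegral.integral_add_adjacent_intervals (i1 (-Real.pi) 0) (i1 0 Real.pi)]
  have e5 : ∫ v in (-Real.pi)..0, logChord v * Real.cos (k * v) =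
      ∫ v in (0 : ℝ)..Real.pi, logChord v * Real.cos (k * v) := by
    rw [← neg_zero, ← intervalIntegral.integral_comp_neg]
    simp [logChord_neg]
  have e6 : ∫ v in (-Real.pi)..0, logChord v * Real.sin (k * v) =
      -∫ v in (0 : ℝ)..Real.pi, logChord v * Real.sin (k * v) := by
    rw [← neg_zero, ← intervalIntegral.integral_comp_neg]
    simp [logChord_neg]
  rw [e5, e6]
  ring

/-- The cosines are eigenfunctions of the kernel of [-1, 1] with eigenvalues -π/k. This is the
source of the weights √k in the arc-Grunsky matrix. -/
theorem integral_log_abs_cos_sub_cos_mul_cos {x : ℝ} (hx : x ∈ Icc 0 Real.pi) {k : ℕ}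
    (hk : k ≠ 0) : ∫ y, Real.log |Real.cos x - Real.cos y| * Real.cos (k * y) ∂angleMeasure =
      -(Real.pi / k * Real.cos (k * x)) := by
  have h := integrable_logChord_comp x
  have hc : Continuous fun y : ℝ => Real.cos (k * y) := by fun_prop
  have e : (fun y => Real.log |Real.cos x - Real.cos y| * Real.cos (k * y)) =ᵐ[angleMeasure]
      fun y => (logChord (x - y) + logChord (x + y)) * Real.cos (k * y) -
        Real.log 2 * Real.cos (k * y) := by
    filter_upwards [log_abs_cos_sub_cos_ae hx] with y hy
    rw [hy]; ring
  rw [integral_congr_ae e, integral_sub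
    ((h.1.fun_add h.2).mul_continuous_angleMeasure hc)
    (Continuous.integrable_angleMeasure (by fun_prop)), integral_logChord_sub_add_mul_cos,
    integral_logChord_mul_cos hk, integral_const_mul, integral_cos_nat_mul, if_neg hk]
  field_simp
  ring

theorem integral_log_abs_cos_sub_cos {x : ℝ} (hx : x ∈ Icc 0 Real.pi) :
    ∫ y, Real.log |Real.cos x - Real.cos y| ∂angleMeasure = -(Real.pi * Real.log 2) := by
  have h := integrable_logChord_comp x
  have h0 := integral_logChord_sub_add_mul_cos x 0
  simp only [Nat.cast_zero, zero_mul, Real.cos_zero, mul_one, integral_logChord, mul_zero] at h0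
  rw [integral_congr_ae (log_abs_cos_sub_cos_ae hx), integral_sub (h.1.fun_add h.2)
    (integrable_const _)]
  have h1 := integral_cos_nat_mul 0
  simp at h1
  rw [h0, integral_const, h1]
  simp

theorem measurable_log_abs_cos_sub_cos :
    Measurable fun p : ℝ × ℝ => Real.log |Real.cos p.1 - Real.cos p.2| := by
  fun_prop

/-- The logarithm never exceeds log 2, so its modulus is at most 2 log 2 minus it, and the integral
of the latter does not depend on x. -/
theorem integral_abs_log_abs_cos_sub_cos_le {x : ℝ} (hx : x ∈ Icc 0 Real.pi) :
    ∫ y, |Real.log (|Real.cos x - Real.cos y|)| ∂angleMeasure ≤ 3 * (Real.pi * Real.log 2) := by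
  have hi := integrable_log_abs_cos_sub_cos hx
  have h2 : 0 ≤ Real.log 2 := Real.log_nonneg (by norm_num)
  have hle : ∀ y, Real.log |Real.cos x - Real.cos y| ≤ Real.log 2 := by
    intro y
    by_cases h0 : |Real.cos x - Real.cos y| = 0
    · rw [h0]; simpa using h2
    · refine Real.log_le_log (lt_of_le_of_ne (abs_nonneg _) (Ne.symm h0)) ?_
      rw [abs_le]
      constructor <;> linarith [Real.neg_one_le_cos x, Real.neg_one_le_cos y, Real.cos_le_one x,
        Real.cos_le_one y]
  have h1 := integral_cos_nat_mul 0
  simp at h1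
  calc ∫ y, |Real.log (|Real.cos x - Real.cos y|)| ∂angleMeasure
      ≤ ∫ y, (2 * Real.log 2 - Real.log |Real.cos x - Real.cos y|) ∂angleMeasure := by
        refine integral_mono hi.abs ((integrable_const _).sub hi) fun y => ?_
        simp only
        rcases abs_cases (Real.log |Real.cos x - Real.cos y|) with h | h <;> linarith [hle y, h.1]
    _ = 3 * (Real.pi * Real.log 2) := by
        rw [integral_sub (integrable_const _) hi, integral_log_abs_cos_sub_cos hx,
          integral_const, h1]
        simp; ring

theorem integrable_log_abs_cos_sub_cos_prod :
    Integrable (fun p : ℝ × ℝ => Real.log |Real.cos p.1 - Real.cos p.2|)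
      (angleMeasure.prod angleMeasure) := by
  refine integrable_prod_of_bound (C := 3 * (Real.pi * Real.log 2))
    measurable_log_abs_cos_sub_cos.aestronglyMeasurable ?_ ?_
  · filter_upwards [ae_angleMeasure_mem] with x hx using integrable_log_abs_cos_sub_cos hx
  · filter_upwards [ae_angleMeasure_mem] with x hx using integral_abs_log_abs_cos_sub_cos_le hx


/-! ### The logarithmic energy as an integral of squares of Gaussian transforms. -/

-- Near t = 0 the difference of exponentials is O(t), which cancels the factor 1/t. The bound
-- retains the slower exponential, hence integrability at infinity.
open Filter Topology in
theorem integrableOn_exp_sub_exp_div {a : ℝ} (ha : 0 < a) :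
    IntegrableOn (fun t : ℝ => t⁻¹ * (Real.exp (-(a * t)) - Real.exp (-t))) (Ioi 0) := by
  set c := min a 1
  have hc : 0 < c := lt_min ha one_pos
  have hb : IntegrableOn (fun t : ℝ => |a - 1| * Real.exp (-c * t)) (Ioi 0) :=
    (integrableOn_exp_mul_Ioi (by linarith) 0).const_mul _
  refine Integrable.mono' hb (by apply Measurable.aestronglyMeasurable; fun_prop) ?_
  filter_upwards [ae_restrict_mem measurableSet_Ioi] with t ht
  have ht : 0 < t := ht
  have key : ∀ p q : ℝ, p ≤ q →
      |Real.exp (-(p * t)) - Real.exp (-(q * t))| ≤ t * ((q - p) * Real.exp (-p * t)) := by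
    intro p q hpq
    have h1 : Real.exp (-(q * t)) = Real.exp (-p * t) * Real.exp (-((q - p) * t)) := by
      rw [← Real.exp_add]; congr 1; ring
    have h2 := Real.add_one_le_exp (-((q - p) * t))
    have h3 : Real.exp (-((q - p) * t)) ≤ 1 := Real.exp_le_one_iff.2 (by
      have := mul_nonneg (sub_nonneg.2 hpq) ht.le; linarith)
    have h4 := Real.exp_pos (-p * t)
    rw [show -(p * t) = -p * t by ring, h1, abs_of_nonneg (by nlinarith)]
    nlinarith
  rw [norm_mul, norm_inv, Real.norm_of_nonneg ht.le, Real.norm_eq_abs, inv_mul_le_iff₀ ht]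
  rcases le_total a 1 with h | h
  · have := key a 1 h
    rw [one_mul] at this
    simpa [c, min_eq_left h, abs_of_nonpos (sub_nonpos.2 h)] using this
  · have := key 1 a h
    rw [one_mul, abs_sub_comm] at this
    simpa [c, min_eq_right h, abs_of_nonneg (sub_nonneg.2 h)] using this

open Filter Topology in
theorem integral_exp_sub_exp_div {a : ℝ} (ha : 0 < a) :
    ∫ t in Ioi (0 : ℝ), t⁻¹ * (Real.exp (-(a * t)) - Real.exp (-t)) = -Real.log a := by
  have h := Frullani.integral_Ioi_eq (f := fun x => Real.exp (-x)) (L := 1) (R := 0) (a := a)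
    (b := 1) ((by fun_prop : Continuous fun x : ℝ => Real.exp (-x)).locallyIntegrable.locallyIntegrableOn _)
    ha one_pos ?_ ?_ ?_
  · simpa [Real.log_inv] using h
  · have : Tendsto (fun x : ℝ => Real.exp (-x)) (𝓝 0) (𝓝 (Real.exp (-0))) :=
      Continuous.tendsto (by fun_prop) 0
    simpa using this.mono_left nhdsWithin_le_nhds
  · exact Real.tendsto_exp_neg_atTop_nhds_zero
  · simpa using integrableOn_exp_sub_exp_div ha

/-- The integrand has constant sign. The exact value makes Fubini in the energy formula equivalent
to absolute integrability of the logarithm. -/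
theorem integral_abs_exp_sub_exp_div {a : ℝ} (ha : 0 < a) :
    ∫ t in Ioi (0 : ℝ), |t⁻¹ * (Real.exp (-(a * t)) - Real.exp (-t))| = |Real.log a| := by
  rcases le_total a 1 with h | h
  · rw [abs_of_nonpos (Real.log_nonpos ha.le h), ← integral_exp_sub_exp_div ha]
    refine setIntegral_congr_fun measurableSet_Ioi fun t ht => abs_of_nonneg ?_
    have ht : 0 < t := ht
    refine mul_nonneg (inv_nonneg.2 ht.le) (sub_nonneg.2 (Real.exp_le_exp.2 ?_))
    nlinarith
  · rw [abs_of_nonneg (Real.log_nonneg h), ← neg_neg (Real.log a), ← integral_exp_sub_exp_div ha,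
      ← integral_neg]
    refine setIntegral_congr_fun measurableSet_Ioi fun t ht => abs_of_nonpos ?_
    have ht : 0 < t := ht
    refine mul_nonpos_of_nonneg_of_nonpos (inv_nonneg.2 ht.le)
      (sub_nonpos.2 (Real.exp_le_exp.2 ?_))
    nlinarith

section
variable {X Y : Type*} [MeasurableSpace X] [MeasurableSpace Y] {σ : Measure X} {τ : Measure Y}
  {ζ : X → ℂ} {η : Y → ℂ} {m : X → ℝ} {n : Y → ℝ}

theorem integrable_gaussian_mul (hζ : Measurable ζ) (hη : Measurable η) (hm : Integrable m σ)
    (hn : Integrable n τ) {t : ℝ} (ht : 0 ≤ t) :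
    Integrable (fun p : X × Y => Real.exp (-(‖ζ p.1 - η p.2‖ ^ 2 * t)) * (m p.1 * n p.2))
      (σ.prod τ) := by
  refine (hm.mul_prod hn).bdd_mul (c := 1)
    (by apply Measurable.aestronglyMeasurable; fun_prop) ?_
  refine Filter.Eventually.of_forall fun p => ?_
  rw [Real.norm_of_nonneg (Real.exp_pos _).le, Real.exp_le_one_iff]
  have := mul_nonneg (sq_nonneg ‖ζ p.1 - η p.2‖) ht
  linarith

/-- Frullani's integral with a = |ζ - η|², followed by Fubini. The inner L¹ norm is twice the
modulus of the logarithmic integrand, so `hlog` is just what Fubini needs. -/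
theorem log_energy_eq_integral_gaussian [SFinite σ] [SFinite τ] (hζ : Measurable ζ) (hη : Measurable η)
    (hm : Integrable m σ) (hn : Integrable n τ)
    (hne : ∀ᵐ p ∂(σ.prod τ), ζ p.1 ≠ η p.2)
    (hlog : Integrable (fun p : X × Y => Real.log ‖ζ p.1 - η p.2‖ * (m p.1 * n p.2))
      (σ.prod τ)) :
    IntegrableOn (fun t : ℝ => t⁻¹ *
      ((∫ p, Real.exp (-(‖ζ p.1 - η p.2‖ ^ 2 * t)) * (m p.1 * n p.2) ∂(σ.prod τ)) -
        Real.exp (-t) * ((∫ x, m x ∂σ) * ∫ y, n y ∂τ))) (Ioi 0) ∧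
    ∫ t in Ioi (0 : ℝ), t⁻¹ *
      ((∫ p, Real.exp (-(‖ζ p.1 - η p.2‖ ^ 2 * t)) * (m p.1 * n p.2) ∂(σ.prod τ)) -
        Real.exp (-t) * ((∫ x, m x ∂σ) * ∫ y, n y ∂τ)) =
      -(2 * ∫ p, Real.log ‖ζ p.1 - η p.2‖ * (m p.1 * n p.2) ∂(σ.prod τ)) := by
  set Φ : (X × Y) × ℝ → ℝ := fun q => (q.2⁻¹ *
    (Real.exp (-(‖ζ q.1.1 - η q.1.2‖ ^ 2 * q.2)) - Real.exp (-q.2))) * (m q.1.1 * n q.1.2) with hΦ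
  have hmn := hm.mul_prod hn
  have hmeas : AEStronglyMeasurable Φ ((σ.prod τ).prod (volume.restrict (Ioi 0))) := by
    refine AEStronglyMeasurable.mul ?_ ?_
    · apply Measurable.aestronglyMeasurable
      fun_prop
    · exact hmn.aestronglyMeasurable.comp_fst
  have hnorm : ∀ᵐ p ∂(σ.prod τ), ∫ t in Ioi (0 : ℝ), ‖Φ (p, t)‖ =
      2 * ‖Real.log ‖ζ p.1 - η p.2‖ * (m p.1 * n p.2)‖ := by
    filter_upwards [hne] with p hp
    have h0 : 0 < ‖ζ p.1 - η p.2‖ ^ 2 := by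
      have := norm_pos_iff.2 (sub_ne_zero.2 hp); positivity
    simp only [hΦ, norm_mul (_ * _) (m p.1 * n p.2)]
    rw [integral_mul_const]
    simp only [Real.norm_eq_abs]
    rw [integral_abs_exp_sub_exp_div h0, Real.log_pow, abs_mul (_ : ℝ) (Real.log _), abs_mul]
    simp
    ring
  have hint : Integrable Φ ((σ.prod τ).prod (volume.restrict (Ioi 0))) := by
    refine (integrable_prod_iff hmeas).2 ⟨?_, ?_⟩
    · filter_upwards [hne] with p hp
      have h0 : 0 < ‖ζ p.1 - η p.2‖ ^ 2 := by
        have := norm_pos_iff.2 (sub_ne_zero.2 hp); positivity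
      exact Integrable.mul_const (integrableOn_exp_sub_exp_div h0) (m p.1 * n p.2)
    · exact (hlog.norm.const_mul 2).congr (hnorm.mono fun p hp => hp.symm)
  have hinner : ∀ t ∈ Ioi (0 : ℝ), ∫ p, Φ (p, t) ∂(σ.prod τ) = t⁻¹ *
      ((∫ p, Real.exp (-(‖ζ p.1 - η p.2‖ ^ 2 * t)) * (m p.1 * n p.2) ∂(σ.prod τ)) -
        Real.exp (-t) * ((∫ x, m x ∂σ) * ∫ y, n y ∂τ)) := by
    intro t ht
    rw [← integral_prod_mul, ← integral_const_mul, ← integral_sub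
      (integrable_gaussian_mul hζ hη hm hn (le_of_lt ht)) (hmn.const_mul _), ← integral_const_mul]
    congr 1; ext p
    simp only [hΦ]; ring
  have hswap := integral_prod_symm _ hint
  rw [integral_prod _ hint] at hswap
  constructor
  · exact hint.integral_prod_right.congr
      ((ae_restrict_mem measurableSet_Ioi).mono fun t ht => hinner t ht)
  · rw [← setIntegral_congr_fun measurableSet_Ioi hinner, ← hswap, ← integral_const_mul,
      ← integral_neg]
    refine integral_congr_ae ?_
    filter_upwards [hne] with p hp
    have h0 : 0 < ‖ζ p.1 - η p.2‖ ^ 2 := by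
      have := norm_pos_iff.2 (sub_ne_zero.2 hp); positivity
    simp only [hΦ]
    rw [integral_mul_const, integral_exp_sub_exp_div h0, Real.log_pow]
    push_cast
    ring

/-- The function `u ↦ ∫ exp (-2 t |ζ - u|²) m` for a density `m`. -/
noncomputable def gaussTransform {X : Type*} [MeasurableSpace X] (σ : Measure X) (ζ : X → ℂ)
    (m : X → ℝ) (t : ℝ) (u : ℂ) : ℝ :=
  ∫ x, Real.exp (-(2 * t * ‖ζ x - u‖ ^ 2)) * m x ∂σ

/-- The parallelogram law: 2|z - u|² + 2|w - u|² = |z - w|² + 4|u - (z + w)/2|². -/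
theorem exp_mul_exp_eq (t : ℝ) (z w u : ℂ) :
    Real.exp (-(2 * t * ‖z - u‖ ^ 2)) * Real.exp (-(2 * t * ‖w - u‖ ^ 2)) =
      Real.exp (-(‖z - w‖ ^ 2 * t)) * Real.exp (-(4 * t) * ‖u - (z + w) / 2‖ ^ 2) := by
  rw [← Real.exp_add, ← Real.exp_add]
  congr 1
  simp only [← Complex.normSq_eq_norm_sq, Complex.normSq_apply, Complex.sub_re, Complex.sub_im,
    Complex.add_re, Complex.add_im, Complex.div_ofNat_re, Complex.div_ofNat_im]
  ring

theorem integrable_exp_mul_exp {t : ℝ} (ht : 0 < t) (z w : ℂ) :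
    Integrable fun u : ℂ =>
      Real.exp (-(2 * t * ‖z - u‖ ^ 2)) * Real.exp (-(2 * t * ‖w - u‖ ^ 2)) := by
  simp_rw [exp_mul_exp_eq]
  refine Integrable.const_mul ?_ _
  have := GaussianFourier.integrable_cexp_neg_mul_sq_norm_add (V := ℂ) (b := ((4 * t : ℝ) : ℂ))
    (by simpa using ht) 0 0
  have h2 : Integrable fun v : ℂ => Real.exp (-(4 * t) * ‖v‖ ^ 2) := by
    refine this.norm.congr (Filter.Eventually.of_forall fun v => ?_)
    simp only [Complex.norm_exp]
    congr 1
    rw [zero_mul, add_zero, ← Complex.ofReal_pow, ← Complex.ofReal_neg, ← Complex.ofReal_mul,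
      Complex.ofReal_re]
  exact h2.comp_sub_right _

theorem integral_exp_mul_exp {t : ℝ} (ht : 0 < t) (z w : ℂ) :
    ∫ u : ℂ, Real.exp (-(2 * t * ‖z - u‖ ^ 2)) * Real.exp (-(2 * t * ‖w - u‖ ^ 2)) =
      Real.pi / (4 * t) * Real.exp (-(‖z - w‖ ^ 2 * t)) := by
  simp_rw [exp_mul_exp_eq]
  rw [integral_const_mul, integral_sub_right_eq_self
    (fun u : ℂ => Real.exp (-(4 * t) * ‖u‖ ^ 2)) ((z + w) / 2),
    GaussianFourier.integral_rexp_neg_mul_sq_norm (by positivity)]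
  simp
  ring

/-- A Gaussian of z - w is an integral over u of a Gaussian in z - u times one in w - u. Thus the
Gaussian pairing of two densities is an L² product, and its positivity becomes visible. -/
theorem gaussTransform_pairing [SFinite σ] [SFinite τ] (hζ : Measurable ζ) (hη : Measurable η) (hm : Integrable m σ)
    (hn : Integrable n τ) {t : ℝ} (ht : 0 < t) :
    Integrable (fun u => gaussTransform σ ζ m t u * gaussTransform τ η n t u) ∧
    ∫ u, gaussTransform σ ζ m t u * gaussTransform τ η n t u =
      Real.pi / (4 * t) *
        ∫ p, Real.exp (-(‖ζ p.1 - η p.2‖ ^ 2 * t)) * (m p.1 * n p.2) ∂(σ.prod τ) := by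
  set Ψ : (X × Y) × ℂ → ℝ := fun q => (Real.exp (-(2 * t * ‖ζ q.1.1 - q.2‖ ^ 2)) *
    Real.exp (-(2 * t * ‖η q.1.2 - q.2‖ ^ 2))) * (m q.1.1 * n q.1.2) with hΨ
  have hmn := hm.mul_prod hn
  have hmeas : AEStronglyMeasurable Ψ ((σ.prod τ).prod volume) := by
    refine AEStronglyMeasurable.mul ?_ ?_
    · apply Measurable.aestronglyMeasurable
      fun_prop
    · exact hmn.aestronglyMeasurable.comp_fst
  have hint : Integrable Ψ ((σ.prod τ).prod volume) := by
    refine (integrable_prod_iff hmeas).2 ⟨Filter.Eventually.of_forall fun p =>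
      (integrable_exp_mul_exp ht (ζ p.1) (η p.2)).mul_const (m p.1 * n p.2), ?_⟩
    refine (((integrable_gaussian_mul hζ hη hm hn ht.le).norm).const_mul
      (Real.pi / (4 * t))).congr (Filter.Eventually.of_forall fun p => ?_)
    simp only [hΨ, norm_mul (_ * _) (m p.1 * n p.2)]
    rw [integral_mul_const]
    have e : ∀ u : ℂ, ‖Real.exp (-(2 * t * ‖ζ p.1 - u‖ ^ 2)) *
        Real.exp (-(2 * t * ‖η p.2 - u‖ ^ 2))‖ = Real.exp (-(2 * t * ‖ζ p.1 - u‖ ^ 2)) *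
        Real.exp (-(2 * t * ‖η p.2 - u‖ ^ 2)) := fun u => Real.norm_of_nonneg (by positivity)
    simp_rw [e]
    rw [integral_exp_mul_exp ht, norm_mul, Real.norm_of_nonneg (Real.exp_pos _).le, mul_assoc]
  have hinner : ∀ u : ℂ, ∫ p, Ψ (p, u) ∂(σ.prod τ) =
      gaussTransform σ ζ m t u * gaussTransform τ η n t u := by
    intro u
    rw [gaussTransform, gaussTransform, ← integral_prod_mul]
    congr 1; ext p
    simp only [hΨ]; ring
  constructor
  · exact hint.integral_prod_right.congr (Filter.Eventually.of_forall hinner)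
  · simp_rw [← hinner]
    rw [← integral_prod_symm _ hint, integral_prod _ hint, ← integral_const_mul]
    congr 1; ext p
    simp only [hΨ]
    rw [integral_mul_const, integral_exp_mul_exp ht, mul_assoc]

theorem measurable_gaussTransform [SFinite σ] (hζ : Measurable ζ) (hm : Measurable m) :
    Measurable fun q : ℝ × ℂ => gaussTransform σ ζ m q.1 q.2 := by
  refine StronglyMeasurable.measurable ?_
  refine StronglyMeasurable.integral_prod_right'
    (f := fun r : (ℝ × ℂ) × X => Real.exp (-(2 * r.1.1 * ‖ζ r.2 - r.1.2‖ ^ 2)) * m r.2) ?_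
  apply Measurable.stronglyMeasurable
  fun_prop

theorem continuous_gaussTransform (hζ : Measurable ζ) (hm : Integrable m σ) {t : ℝ}
    (ht : 0 ≤ t) : Continuous (gaussTransform σ ζ m t) := by
  refine continuous_of_dominated (bound := fun x => |m x|) (fun u => ?_) (fun u => ?_) hm.abs ?_
  · refine AEStronglyMeasurable.mul ?_ hm.aestronglyMeasurable
    apply Measurable.aestronglyMeasurable
    fun_prop
  · refine Filter.Eventually.of_forall fun x => ?_
    rw [norm_mul, Real.norm_of_nonneg (Real.exp_pos _).le]
    refine mul_le_of_le_one_left (norm_nonneg _) (Real.exp_le_one_iff.2 ?_)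
    have : 0 ≤ 2 * t * ‖ζ x - u‖ ^ 2 := by positivity
    linarith
  · exact Filter.Eventually.of_forall fun x => by fun_prop

end

/-- If the square integrals of `D t` represent the energy `E`, then `E` controls `D`. -/
theorem lintegral_sq_eq_of_energy {D : ℝ → ℂ → ℝ} {E : ℝ}
    (h1 : ∀ t > 0, Integrable fun u => D t u * D t u)
    (h2 : IntegrableOn (fun t : ℝ => t⁻¹ * (4 * t / Real.pi * ∫ u, D t u * D t u)) (Ioi 0))
    (h3 : ∫ t in Ioi (0 : ℝ), t⁻¹ * (4 * t / Real.pi * ∫ u, D t u * D t u) = 2 * E) :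
    ∫⁻ t in Ioi (0 : ℝ), ∫⁻ u, ENNReal.ofReal (D t u * D t u) =
      ENNReal.ofReal (Real.pi / 2 * E) := by
  have hpi := Real.pi_pos
  have e1 : ∀ t ∈ Ioi (0 : ℝ), t⁻¹ * (4 * t / Real.pi * ∫ u, D t u * D t u) =
      4 / Real.pi * ∫ u, D t u * D t u := by
    intro t ht
    have : t ≠ 0 := (ne_of_gt ht)
    field_simp
  have h2' : IntegrableOn (fun t : ℝ => ∫ u, D t u * D t u) (Ioi 0) := by
    refine (h2.const_mul (Real.pi / 4)).congr ((ae_restrict_mem measurableSet_Ioi).mono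
      fun t ht => ?_)
    simp only
    rw [e1 t ht]; field_simp
  rw [setIntegral_congr_fun measurableSet_Ioi e1, integral_const_mul] at h3
  have h4 : ∫ t in Ioi (0 : ℝ), ∫ u, D t u * D t u = Real.pi / 2 * E := by
    field_simp at h3 ⊢
    linarith
  rw [← h4, ofReal_integral_eq_lintegral_ofReal h2'
    (Filter.Eventually.of_forall fun t => integral_nonneg fun u => mul_self_nonneg _)]
  refine setLIntegral_congr_fun measurableSet_Ioi fun t ht => ?_
  rw [ofReal_integral_eq_lintegral_ofReal (h1 t ht)
    (Filter.Eventually.of_forall fun u => mul_self_nonneg _)]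

theorem energy_nonneg {D : ℝ → ℂ → ℝ} {E : ℝ}
    (h3 : ∫ t in Ioi (0 : ℝ), t⁻¹ * (4 * t / Real.pi * ∫ u, D t u * D t u) = 2 * E) : 0 ≤ E := by
  have : 0 ≤ ∫ t in Ioi (0 : ℝ), t⁻¹ * (4 * t / Real.pi * ∫ u, D t u * D t u) := by
    refine setIntegral_nonneg measurableSet_Ioi fun t ht => ?_
    have ht : 0 < t := ht
    have := Real.pi_pos
    have : 0 ≤ ∫ u, D t u * D t u := integral_nonneg fun u => mul_self_nonneg _
    positivity
  linarith

/-- For almost every t the function vanishes for almost every u, and continuity in u then gives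
every u. A single such t suffices later. -/
theorem exists_forall_eq_zero_of_lintegral_eq_zero {D : ℝ → ℂ → ℝ}
    (hmeas : Measurable fun q : ℝ × ℂ => D q.1 q.2) (hcont : ∀ t > 0, Continuous (D t))
    (h0 : ∫⁻ t in Ioi (0 : ℝ), ∫⁻ u, ENNReal.ofReal (D t u * D t u) = 0) :
    ∃ t > 0, ∀ u, D t u = 0 := by
  have hm : Measurable fun q : ℝ × ℂ => ENNReal.ofReal (D q.1 q.2 * D q.1 q.2) := by fun_prop
  rw [lintegral_eq_zero_iff hm.lintegral_prod_right'] at h0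
  have h1 : ∀ᵐ t ∂(volume.restrict (Ioi (0 : ℝ))), t ∈ Ioi (0 : ℝ) :=
    ae_restrict_mem measurableSet_Ioi
  have hne : (ae (volume.restrict (Ioi (0 : ℝ)))).NeBot := by
    rw [ae_neBot]
    intro h
    have := Measure.restrict_eq_zero.1 h
    simp at this
  obtain ⟨t, ht0, ht⟩ := (h0.and h1).exists
  refine ⟨t, ht, fun u => ?_⟩
  replace ht0 : ∫⁻ u, ENNReal.ofReal (D t u * D t u) = 0 := ht0
  have hmt : Measurable fun u : ℂ => ENNReal.ofReal (D t u * D t u) :=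
    hm.comp measurable_prodMk_left
  rw [lintegral_eq_zero_iff hmt] at ht0
  have h2 : (fun u => D t u) =ᵐ[volume] fun _ => 0 := by
    filter_upwards [ht0] with u hu
    have h3 : D t u * D t u ≤ 0 := ENNReal.ofReal_eq_zero.1 hu
    exact mul_self_eq_zero.1 (le_antisymm h3 (mul_self_nonneg _))
  exact congrFun ((hcont t ht).ae_eq_iff_eq volume continuous_const |>.1 h2) u


/-! ### Hilbert–Schmidt operators on ℓ² and coercivity. -/

section operator
open scoped ENNReal

theorem SeqL2.norm_sq_eq (x : SeqL2) : HasSum (fun k => x k ^ 2) (‖x‖ ^ 2) := by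
  have h := lp.hasSum_inner (𝕜 := ℝ) x x
  rw [real_inner_self_eq_norm_sq] at h
  simpa [sq] using h

/-- The element of `ℓ²(ℤ₊)` with given square summable coordinates. -/
def SeqL2.mk (f : ℕ+ → ℝ) (hf : Summable fun k => f k ^ 2) : SeqL2 :=
  ⟨f, (memℓp_gen_iff (by norm_num)).2 (by simpa using hf)⟩

theorem SeqL2.inner_hasSum (x y : SeqL2) : HasSum (fun k => x k * y k) (inner ℝ x y) := by
  have h := lp.hasSum_inner (𝕜 := ℝ) x y
  simpa [mul_comm] using h

/-- Keeping finitely many rows gives a finite rank operator. Its distance to B in operator norm is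
at most the square root of the tail of ∑ ‖r_k‖². -/
theorem isCompactOperator_of_matrix {b : ℕ+ → ℕ+ → ℝ}
    (hb : Summable fun p : ℕ+ × ℕ+ => b p.1 p.2 ^ 2) :
    ∃ B : SeqL2 →L[ℝ] SeqL2, (∀ x k, HasSum (fun l => b k l * x l) (B x k)) ∧
      IsCompactOperator B := by
  have hrow : ∀ k, Summable fun l => b k l ^ 2 := fun k => hb.prod_factor k
  set r : ℕ+ → SeqL2 := fun k => SeqL2.mk (b k) (hrow k) with hr
  have hrn : Summable fun k => ‖r k‖ ^ 2 := by
    have := hb.prod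
    refine this.congr fun k => ?_
    exact (SeqL2.norm_sq_eq (r k)).tsum_eq
  have hle : ∀ (x : SeqL2) k, inner ℝ (r k) x ^ 2 ≤ ‖r k‖ ^ 2 * ‖x‖ ^ 2 := fun x k => by
    rw [← mul_pow, ← sq_abs]
    exact pow_le_pow_left₀ (abs_nonneg _) (abs_real_inner_le_norm _ _) 2
  have hmem : ∀ x : SeqL2, Summable fun k => inner ℝ (r k) x ^ 2 := fun x =>
    Summable.of_nonneg_of_le (fun _ => sq_nonneg _) (hle x) (hrn.mul_right _)
  let L : SeqL2 →ₗ[ℝ] SeqL2 :=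
    { toFun := fun x => SeqL2.mk (fun k => inner ℝ (r k) x) (hmem x)
      map_add' := fun x y => by
        ext k
        change inner ℝ (r k) (x + y) = inner ℝ (r k) x + inner ℝ (r k) y
        rw [inner_add_right]
      map_smul' := fun c x => by
        ext k
        change inner ℝ (r k) (c • x) = c * inner ℝ (r k) x
        rw [real_inner_smul_right] }
  have hL : ∀ x k, L x k = inner ℝ (r k) x := fun x k => rfl
  set C := ∑' k, ‖r k‖ ^ 2 with hC
  have hbound : ∀ x, ‖L x‖ ≤ Real.sqrt C * ‖x‖ := by
    intro x
    refine le_of_sq_le_sq ?_ (by positivity)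
    rw [mul_pow, Real.sq_sqrt (tsum_nonneg fun _ => sq_nonneg _), ← tsum_mul_right]
    exact (SeqL2.norm_sq_eq (L x)).tsum_eq.symm.le.trans
      ((hmem x).tsum_le_tsum (hle x) (hrn.mul_right _))
  set B : SeqL2 →L[ℝ] SeqL2 := L.mkContinuous _ hbound with hB
  have hBapp : ∀ x k, B x k = inner ℝ (r k) x := fun x k => rfl
  refine ⟨B, fun x k => ?_, ?_⟩
  · rw [hBapp]
    exact SeqL2.inner_hasSum (r k) x
  classical
  set Bs : Finset ℕ+ → SeqL2 →L[ℝ] SeqL2 := fun s => ∑ k ∈ s,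
    (lp.singleContinuousLinearMap ℝ (fun _ : ℕ+ => ℝ) 2 k).comp (innerSL ℝ (r k)) with hBs
  have hcomp : ∀ s, IsCompactOperator (Bs s) := by
    intro s
    induction s using Finset.induction_on with
    | empty => simpa [hBs] using isCompactOperator_zero
    | insert a s ha ih =>
      simp only [hBs, Finset.sum_insert ha]
      refine IsCompactOperator.add ?_ ih
      exact (isCompactOperator_of_locallyCompactSpace_dom (innerSL ℝ (r a))).clm_comp
        (lp.singleContinuousLinearMap ℝ (fun _ : ℕ+ => ℝ) 2 a)
  have hBsapp : ∀ s x k, Bs s x k = if k ∈ s then inner ℝ (r k) x else 0 := by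
    intro s x k
    simp only [hBs, sum_apply, lp.coeFn_sum, Finset.sum_apply]
    simp [lp.single_apply, Pi.single_apply]
  have hlim : Filter.Tendsto Bs Filter.atTop (nhds B) := by
    rw [tendsto_iff_norm_sub_tendsto_zero]
    have htail : Filter.Tendsto (fun s : Finset ℕ+ => Real.sqrt (C - ∑ k ∈ s, ‖r k‖ ^ 2))
        Filter.atTop (nhds 0) := by
      have : Filter.Tendsto (fun s : Finset ℕ+ => C - ∑ k ∈ s, ‖r k‖ ^ 2) Filter.atTop
          (nhds (C - C)) := tendsto_const_nhds.sub hrn.hasSum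
      rw [sub_self] at this
      simpa using this.sqrt
    refine squeeze_zero (fun _ => norm_nonneg _) (fun s => ?_) htail
    refine ContinuousLinearMap.opNorm_le_bound _ (Real.sqrt_nonneg _) fun x => ?_
    refine le_of_sq_le_sq ?_ (by positivity)
    have hsum_s : HasSum (fun k => if k ∈ s then ‖r k‖ ^ 2 else 0) (∑ k ∈ s, ‖r k‖ ^ 2) := by
      have := hasSum_sum_of_ne_finset_zero (L := SummationFilter.unconditional ℕ+) (s := s)
        (f := fun k => if k ∈ s then ‖r k‖ ^ 2 else 0)
        (fun k hk => if_neg hk)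
      rwa [Finset.sum_congr rfl (fun k hk => if_pos hk)] at this
    have htl := hrn.hasSum.sub hsum_s
    have hnn : 0 ≤ C - ∑ k ∈ s, ‖r k‖ ^ 2 := htl.nonneg fun k => by
      split_ifs <;> simp
    rw [mul_pow, Real.sq_sqrt hnn]
    refine hasSum_le (fun k => ?_) (SeqL2.norm_sq_eq ((Bs s - B) x)) (htl.mul_right (‖x‖ ^ 2))
    have : (Bs s - B) x k = Bs s x k - B x k := rfl
    rw [this, hBsapp, hBapp]
    split_ifs with h
    · simp
    · simpa using hle x k
  exact isCompactOperator_of_tendsto hlim (Filter.Eventually.of_forall hcomp)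

/-- The double series b_kl x_l y_k is absolutely summable because its terms are bounded by b_kl² +
x_l² y_k², so the order of summation may be exchanged. -/
theorem inner_matrix_comm {b : ℕ+ → ℕ+ → ℝ} (hb : Summable fun p : ℕ+ × ℕ+ => b p.1 p.2 ^ 2)
    (hsymm : ∀ k l, b k l = b l k) {B : SeqL2 →L[ℝ] SeqL2}
    (hB : ∀ x k, HasSum (fun l => b k l * x l) (B x k)) (x y : SeqL2) :
    inner ℝ (B x) y = inner ℝ x (B y) := by
  have hs : Summable fun p : ℕ+ × ℕ+ => b p.1 p.2 * x p.2 * y p.1 := by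
    have h2 := (SeqL2.norm_sq_eq y).summable.mul_of_nonneg (SeqL2.norm_sq_eq x).summable
      (fun _ => sq_nonneg _) (fun _ => sq_nonneg _)
    refine Summable.of_norm_bounded (hb.add h2) fun p => ?_
    rw [Real.norm_eq_abs, abs_le]
    constructor <;> nlinarith [sq_nonneg (b p.1 p.2 + x p.2 * y p.1),
      sq_nonneg (b p.1 p.2 - x p.2 * y p.1), sq_nonneg (b p.1 p.2), sq_nonneg (x p.2 * y p.1)]
  have h1 : inner ℝ (B x) y = ∑' k, ∑' l, b k l * x l * y k := by
    rw [← (SeqL2.inner_hasSum (B x) y).tsum_eq]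
    refine tsum_congr fun k => ?_
    rw [← (hB x k).tsum_eq, tsum_mul_right]
  have h2 : inner ℝ x (B y) = ∑' l, ∑' k, b k l * x l * y k := by
    rw [← (SeqL2.inner_hasSum x (B y)).tsum_eq]
    refine tsum_congr fun l => ?_
    rw [← (hB y l).tsum_eq, ← tsum_mul_left]
    refine tsum_congr fun k => ?_
    rw [hsymm l k]; ring
  rw [h1, h2]
  exact (Summable.tsum_comm' (f := fun k l => b k l * x l * y k) hs (fun k => hs.prod_factor k)
    (fun l => hs.prod_symm.prod_factor l)).symm

open Classical in
/-- The truncation of a sequence to a finite set of indices. -/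
noncomputable def SeqL2.trunc (x : SeqL2) (s : Finset ℕ+) : SeqL2 :=
  ∑ k ∈ s, lp.single (E := fun _ : ℕ+ => ℝ) 2 k (x k)

theorem SeqL2.tendsto_trunc (x : SeqL2) : Filter.Tendsto x.trunc Filter.atTop (nhds x) :=
  lp.hasSum_single (by norm_num) x

open Classical in
theorem SeqL2.trunc_apply (x : SeqL2) (s : Finset ℕ+) (k : ℕ+) :
    x.trunc s k = if k ∈ s then x k else 0 := by
  simp only [SeqL2.trunc, lp.coeFn_sum, Finset.sum_apply]
  simp [lp.single_apply, Pi.single_apply]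

theorem inner_trunc {b : ℕ+ → ℕ+ → ℝ} {B : SeqL2 →L[ℝ] SeqL2}
    (hB : ∀ x k, HasSum (fun l => b k l * x l) (B x k)) (x : SeqL2) (s : Finset ℕ+) :
    inner ℝ (x.trunc s + B (x.trunc s)) (x.trunc s) =
      ∑ k ∈ s, x k ^ 2 + ∑ k ∈ s, ∑ l ∈ s, b k l * x k * x l := by
  have hBs : ∀ k, B (x.trunc s) k = ∑ l ∈ s, b k l * x l := by
    intro k
    refine (hB (x.trunc s) k).unique ?_
    have := hasSum_sum_of_ne_finset_zero (L := SummationFilter.unconditional ℕ+) (s := s)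
        (f := fun l => b k l * x.trunc s l)
      (fun l hl => by rw [SeqL2.trunc_apply, if_neg hl, mul_zero])
    rwa [Finset.sum_congr rfl (fun l hl => by rw [SeqL2.trunc_apply, if_pos hl])] at this
  refine (SeqL2.inner_hasSum _ _).unique ?_
  have := hasSum_sum_of_ne_finset_zero (L := SummationFilter.unconditional ℕ+) (s := s)
    (f := fun k => (x.trunc s + B (x.trunc s)) k * x.trunc s k)
    (fun l hl => by rw [SeqL2.trunc_apply, if_neg hl, mul_zero])
  convert this using 1
  rw [← Finset.sum_add_distrib]
  refine Finset.sum_congr rfl fun k hk => ?_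
  have e : (x.trunc s + B (x.trunc s)) k = x.trunc s k + B (x.trunc s) k := rfl
  rw [e, hBs, SeqL2.trunc_apply, if_pos hk, add_mul, Finset.sum_mul, sq]
  congr 1
  exact Finset.sum_congr rfl fun l _ => by ring

theorem tendsto_inner_trunc (B : SeqL2 →L[ℝ] SeqL2) (x : SeqL2) :
    Filter.Tendsto (fun s => inner ℝ (x.trunc s + B (x.trunc s)) (x.trunc s)) Filter.atTop
      (nhds (inner ℝ (x + B x) x)) := by
  have h := x.tendsto_trunc
  exact (h.add ((B.continuous.tendsto x).comp h)).inner h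

/-- As B is compact and -1 is not an eigenvalue, ‖x‖ ≤ K‖Tx‖ for T = I + B. As T is symmetric and
nonnegative, Cauchy–Schwarz for the form ⟨Tx, y⟩ gives ‖Tx‖² ≤ M⟨Tx, x⟩. The two bounds combine. -/
theorem exists_coercive {B : SeqL2 →L[ℝ] SeqL2} (hcomp : IsCompactOperator B)
    (hsymm : ∀ x y, inner ℝ (B x) y = inner ℝ x (B y))
    (hpos : ∀ x, 0 ≤ inner ℝ (x + B x) x) (hinj : ∀ x, x + B x = 0 → x = 0) :
    ∃ c > 0, ∀ x, c * ‖x‖ ^ 2 ≤ inner ℝ (x + B x) x := by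
  have hnot : ¬ Module.End.HasEigenvalue (B : Module.End ℝ SeqL2) (-1) := by
    intro h
    obtain ⟨v, hv⟩ := h.exists_hasEigenvector
    have h1 : B v = (-1 : ℝ) • v := hv.apply_eq_smul
    exact hv.2 (hinj v (by rw [h1]; simp))
  obtain ⟨K, hK⟩ := IsCompactOperator.antilipschitz_of_not_hasEigenvalue hcomp
    (by norm_num : (-1 : ℝ) ≠ 0) hnot
  have hT : ∀ x, ‖x‖ ≤ K * ‖x + B x‖ := by
    intro x
    have := hK.le_mul_dist x 0
    simpa [add_comm] using this
  set M := 1 + ‖B‖ with hM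
  have hM0 : 0 < M := by positivity
  have hTn : ∀ x, ‖x + B x‖ ≤ M * ‖x‖ := fun x => by
    rw [hM, add_mul, one_mul]
    exact (norm_add_le _ _).trans (by gcongr; exact B.le_opNorm x)
  have hsq : ∀ x, ‖x + B x‖ ^ 2 ≤ M * inner ℝ (x + B x) x := by
    intro x
    set T := x + B x with hTx
    -- Cauchy–Schwarz via the discriminant: the form of I + B is evaluated on x + s(x + Bx), and
    -- symmetry turns the mixed terms into 2s‖x + Bx‖².
    have hquad : ∀ s : ℝ, 0 ≤ inner ℝ (T + B T) T * (s * s) + 2 * ‖T‖ ^ 2 * s + inner ℝ T x := by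
      intro s
      have h := hpos (x + s • T)
      have e : x + s • T + B (x + s • T) = T + s • (T + B T) := by
        rw [map_add, map_smul, hTx]; module
      rw [e, inner_add_left, inner_add_right, inner_add_right, real_inner_smul_left,
        real_inner_smul_left, real_inner_smul_right, real_inner_smul_right] at h
      have e2 : inner ℝ (T + B T) x = ‖T‖ ^ 2 := by
        rw [inner_add_left, hsymm, ← inner_add_right, ← hTx, real_inner_self_eq_norm_sq]
      rw [e2, real_inner_self_eq_norm_sq] at h
      nlinarith
    have hd := discrim_le_zero hquad
    rw [discrim] at hd
    have h3 : inner ℝ (T + B T) T ≤ M * ‖T‖ ^ 2 := by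
      refine (real_inner_le_norm _ _).trans ?_
      have := hTn T
      nlinarith [norm_nonneg T]
    have h4 : 0 ≤ inner ℝ T x := hpos x
    rcases eq_or_ne (‖T‖) 0 with h0 | h0
    · rw [h0]; simpa using mul_nonneg hM0.le h4
    · have h5 : 0 < ‖T‖ ^ 2 := by positivity
      have h6 : ‖T‖ ^ 2 * ‖T‖ ^ 2 ≤ M * inner ℝ T x * ‖T‖ ^ 2 := by nlinarith
      exact le_of_mul_le_mul_right h6 h5
  -- K² + 1 replaces K² so that the denominator is positive even when K = 0.
  refine ⟨1 / ((K ^ 2 + 1) * M), by positivity, fun x => ?_⟩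
  have h1 : ‖x‖ ^ 2 ≤ (K ^ 2 + 1) * (M * inner ℝ (x + B x) x) := by
    calc ‖x‖ ^ 2 ≤ (K * ‖x + B x‖) ^ 2 := pow_le_pow_left₀ (norm_nonneg _) (hT x) 2
      _ = K ^ 2 * ‖x + B x‖ ^ 2 := by ring
      _ ≤ (K ^ 2 + 1) * ‖x + B x‖ ^ 2 := by nlinarith [sq_nonneg ‖x + B x‖]
      _ ≤ _ := by gcongr; exact hsq x
  rw [one_div, inv_mul_le_iff₀ (by positivity), mul_assoc]
  exact h1

end operator


/-! ### Injectivity of the Gaussian transform, and the energy of cosine densities. -/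

theorem gaussian_eq_mul (t : ℝ) (z u : ℂ) : Real.exp (-(2 * t * ‖z - u‖ ^ 2)) =
    Real.exp (-(2 * t * ‖u‖ ^ 2)) *
      (Real.exp (-(2 * t * ‖z‖ ^ 2)) * Real.exp (z.re * (4 * t * u.re) + z.im * (4 * t * u.im))) := by
  rw [← Real.exp_add, ← Real.exp_add]
  congr 1
  simp only [← Complex.normSq_eq_norm_sq, Complex.normSq_apply, Complex.sub_re, Complex.sub_im]
  ring

/-- A Gaussian centred at u is a constant times a fixed positive weight times the exponential of a
real linear function of ζ, and every linear function occurs as u varies. The span of these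
exponentials is an algebra separating points, so Stone–Weierstrass applies, and the weight can be
divided out. -/
theorem functional_eq_zero_of_gaussian {X : Type*} [TopologicalSpace X] [CompactSpace X]
    (ζ : C(X, ℂ)) (hζ : Function.Injective ζ) (Λ : C(X, ℝ) →L[ℝ] ℝ) {t : ℝ} (ht : 0 < t)
    (h : ∀ u : ℂ, Λ ⟨fun x => Real.exp (-(2 * t * ‖ζ x - u‖ ^ 2)), by fun_prop⟩ = 0) : Λ = 0 := by
  let w : C(X, ℝ) := ⟨fun x => Real.exp (-(2 * t * ‖ζ x‖ ^ 2)), by fun_prop⟩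
  let winv : C(X, ℝ) := ⟨fun x => Real.exp (2 * t * ‖ζ x‖ ^ 2), by fun_prop⟩
  let e : ℂ → C(X, ℝ) := fun v => ⟨fun x => Real.exp ((ζ x).re * v.re + (ζ x).im * v.im),
    by fun_prop⟩
  have he : ∀ v, Λ (w * e v) = 0 := by
    intro v
    have h1 := h ((1 / (4 * t) : ℝ) * v)
    set u : ℂ := (1 / (4 * t) : ℝ) * v with hu
    have h2 : (⟨fun x => Real.exp (-(2 * t * ‖ζ x - u‖ ^ 2)), by fun_prop⟩ : C(X, ℝ)) =
        Real.exp (-(2 * t * ‖u‖ ^ 2)) • (w * e v) := by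
      ext x
      change Real.exp (-(2 * t * ‖ζ x - u‖ ^ 2)) = Real.exp (-(2 * t * ‖u‖ ^ 2)) *
        (Real.exp (-(2 * t * ‖ζ x‖ ^ 2)) * Real.exp ((ζ x).re * v.re + (ζ x).im * v.im))
      rw [gaussian_eq_mul]
      congr 4
      · rw [hu, Complex.re_ofReal_mul]; field_simp
      · rw [hu, Complex.im_ofReal_mul]; field_simp
    rw [h2, map_smul, smul_eq_mul] at h1
    exact (mul_eq_zero.1 h1).resolve_left (Real.exp_pos _).ne'
  -- The exponentials form a multiplicative monoid, so the algebra they generate is merely their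
  -- linear span.
  let E : Multiplicative ℂ →* C(X, ℝ) :=
    { toFun := fun v => e v.toAdd
      map_one' := by ext x; simp [e]
      map_mul' := fun v v' => by
        ext x
        change Real.exp _ = Real.exp _ * Real.exp _
        rw [← Real.exp_add]
        congr 1
        simp; ring }
  let A : Subalgebra ℝ C(X, ℝ) := Algebra.adjoin ℝ (MonoidHom.mrange E : Set C(X, ℝ))
  have hA : ∀ g ∈ A, Λ (w * g) = 0 := by
    intro g hg
    have hg' : g ∈ Submodule.span ℝ (MonoidHom.mrange E : Set C(X, ℝ)) := by
      have h1 : g ∈ Subalgebra.toSubmodule A := hg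
      rwa [Algebra.adjoin_eq_span, Submonoid.closure_eq] at h1
    clear hg
    induction hg' using Submodule.span_induction with
    | mem x hx =>
      obtain ⟨v, rfl⟩ := hx
      exact he v.toAdd
    | zero => simp
    | add x y _ _ hx hy => rw [mul_add, map_add, hx, hy, add_zero]
    | smul c x _ hx => rw [mul_smul_comm, map_smul, hx, smul_zero]
  have hsep : A.SeparatesPoints := by
    intro x y hxy
    have hne : ζ x ≠ ζ y := fun h0 => hxy (hζ h0)
    -- In the direction ζ x - ζ y the two exponents differ by |ζ x - ζ y|².
    refine ⟨e (ζ x - ζ y), ⟨e (ζ x - ζ y), Algebra.subset_adjoin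
      ⟨Multiplicative.ofAdd (ζ x - ζ y), rfl⟩, rfl⟩, fun h0 => ?_⟩
    have h1 := Real.exp_injective h0
    simp only [Complex.sub_re, Complex.sub_im] at h1
    have h2 : ((ζ x).re - (ζ y).re) ^ 2 + ((ζ x).im - (ζ y).im) ^ 2 = 0 := by linarith
    apply hne
    apply Complex.ext <;> nlinarith [sq_nonneg ((ζ x).re - (ζ y).re),
      sq_nonneg ((ζ x).im - (ζ y).im)]
  have htop := ContinuousMap.subalgebra_topologicalClosure_eq_top_of_separatesPoints A hsep
  have hall : ∀ g, Λ (w * g) = 0 := by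
    intro g
    have hg : g ∈ closure (A : Set C(X, ℝ)) := by
      rw [← Subalgebra.topologicalClosure_coe, htop]; trivial
    have hcl : IsClosed {g : C(X, ℝ) | Λ (w * g) = 0} :=
      isClosed_eq (by fun_prop) continuous_const
    exact closure_minimal (fun g hg => hA g hg) hcl hg
  ext g
  have h1 := hall (winv * g)
  have h2 : w * (winv * g) = g := by
    ext x
    change Real.exp _ * (Real.exp _ * g x) = g x
    rw [← mul_assoc, ← Real.exp_add]
    simp
  rw [h2] at h1
  simpa using h1

/-- `F` is the regular part of the logarithmic kernel along the curve `ζ`, parametrized by the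
angle. -/
structure IsLogKernel (ζ : ℝ → ℂ) (F : ℝ × ℝ → ℝ) : Prop where
  contDiff : ContDiff ℝ 2 F
  symm : ∀ x y, F (x, y) = F (y, x)
  continuous : Continuous ζ
  injOn : InjOn ζ (Icc 0 Real.pi)
  log_eq : ∀ x ∈ Icc 0 Real.pi, ∀ y ∈ Icc 0 Real.pi, x ≠ y →
    Real.log ‖ζ x - ζ y‖ = Real.log |Real.cos x - Real.cos y| + F (x, y)

theorem ae_angleMeasure_prod : ∀ᵐ p ∂(angleMeasure.prod angleMeasure),
    p.1 ∈ Icc 0 Real.pi ∧ p.2 ∈ Icc 0 Real.pi ∧ p.1 ≠ p.2 := by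
  have hm : MeasurableSet {p : ℝ × ℝ | p.1 ∈ Icc 0 Real.pi ∧ p.2 ∈ Icc 0 Real.pi ∧ p.1 ≠ p.2} := by
    refine (measurable_fst measurableSet_Icc).inter ((measurable_snd measurableSet_Icc).inter ?_)
    exact (measurableSet_eq_fun measurable_fst measurable_snd).compl
  refine (Measure.ae_prod_mem_iff_ae_ae_mem hm).2 ?_
  filter_upwards [ae_angleMeasure_mem] with x hx
  filter_upwards [ae_angleMeasure_mem, ae_angleMeasure_ne x] with y hy hxy
  exact ⟨hx, hy, hxy⟩

namespace IsLogKernel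
variable {ζ : ℝ → ℂ} {F : ℝ × ℝ → ℝ}

theorem log_ae (h : IsLogKernel ζ F) :
    (fun p : ℝ × ℝ => Real.log ‖ζ p.1 - ζ p.2‖) =ᵐ[angleMeasure.prod angleMeasure]
      fun p => Real.log |Real.cos p.1 - Real.cos p.2| + F p := by
  filter_upwards [ae_angleMeasure_prod] with p hp
  exact h.log_eq _ hp.1 _ hp.2.1 hp.2.2

theorem ne_ae (h : IsLogKernel ζ F) :
    ∀ᵐ p ∂(angleMeasure.prod angleMeasure), ζ p.1 ≠ ζ p.2 := by
  filter_upwards [ae_angleMeasure_prod] with p hp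
  exact fun h0 => hp.2.2 (h.injOn hp.1 hp.2.1 h0)

theorem _root_.MeasureTheory.Integrable.mul_continuous_angleMeasure_prod {f g : ℝ × ℝ → ℝ}
    (hf : Integrable f (angleMeasure.prod angleMeasure)) (hg : Continuous g) :
    Integrable (fun p => f p * g p) (angleMeasure.prod angleMeasure) := by
  obtain ⟨C, hC⟩ := (isCompact_Icc.prod isCompact_Icc : IsCompact
    (Icc 0 Real.pi ×ˢ Icc 0 Real.pi)).exists_bound_of_continuousOn hg.continuousOn
  refine hf.mul_bdd (c := C) hg.aestronglyMeasurable ?_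
  filter_upwards [ae_angleMeasure_prod] with p hp
  exact hC p ⟨hp.1, hp.2.1⟩

theorem integrable_log (h : IsLogKernel ζ F) :
    Integrable (fun p : ℝ × ℝ => Real.log ‖ζ p.1 - ζ p.2‖) (angleMeasure.prod angleMeasure) :=
  (integrable_log_abs_cos_sub_cos_prod.add
    h.contDiff.continuous.integrable_angleMeasure_prod).congr h.log_ae.symm

/-- The logarithmic energy of a continuous density of total mass zero, as an integral of
squares. -/
theorem lintegral_gaussTransform_sq (h : IsLogKernel ζ F) {m : ℝ → ℝ} (hm : Continuous m)
    (hm0 : ∫ x, m x ∂angleMeasure = 0) {E : ℝ}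
    (hE : ∫ p, Real.log ‖ζ p.1 - ζ p.2‖ * (m p.1 * m p.2) ∂(angleMeasure.prod angleMeasure) = -E) :
    0 ≤ E ∧ ∫⁻ t in Ioi (0 : ℝ), ∫⁻ u, ENNReal.ofReal
      (gaussTransform angleMeasure ζ m t u * gaussTransform angleMeasure ζ m t u) =
        ENNReal.ofReal (Real.pi / 2 * E) := by
  have hmi := hm.integrable_angleMeasure
  have hζ := h.continuous.measurable
  have hlog := h.integrable_log.mul_continuous_angleMeasure_prod
    (g := fun p : ℝ × ℝ => m p.1 * m p.2) (by fun_prop)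
  obtain ⟨h1, h2⟩ := log_energy_eq_integral_gaussian hζ hζ hmi hmi h.ne_ae hlog
  have hpair := fun (t : ℝ) (ht : 0 < t) => gaussTransform_pairing hζ hζ hmi hmi ht
  have hpi := Real.pi_pos
  have e : ∀ t ∈ Ioi (0 : ℝ), t⁻¹ * ((∫ p, Real.exp (-(‖ζ p.1 - ζ p.2‖ ^ 2 * t)) *
      (m p.1 * m p.2) ∂(angleMeasure.prod angleMeasure)) -
        Real.exp (-t) * ((∫ x, m x ∂angleMeasure) * ∫ y, m y ∂angleMeasure)) =
      t⁻¹ * (4 * t / Real.pi * ∫ u, gaussTransform angleMeasure ζ m t u *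
        gaussTransform angleMeasure ζ m t u) := by
    intro t ht
    have ht : 0 < t := ht
    -- Total mass zero removes the term exp(-t), so only the integral of a square remains.
    rw [hm0, (hpair t ht).2]
    field_simp
    ring
  have hfinite := h1.congr ((ae_restrict_mem measurableSet_Ioi).mono e)
  rw [setIntegral_congr_fun measurableSet_Ioi e, hE] at h2
  have henergy : ∫ t in Ioi (0 : ℝ), t⁻¹ * (4 * t / Real.pi *
      ∫ u, gaussTransform angleMeasure ζ m t u * gaussTransform angleMeasure ζ m t u) = 2 * E := by
    rw [h2]; ring
  exact ⟨energy_nonneg henergy, lintegral_sq_eq_of_energy (fun t ht => (hpair t ht).1)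
    hfinite henergy⟩

/-- The matrix of the regular part of the logarithmic kernel. -/
noncomputable def _root_.kernelMatrix (F : ℝ × ℝ → ℝ) (k l : ℕ+) : ℝ :=
  Real.sqrt ((k : ℝ) * (l : ℝ)) * (-(cosCoeff F k l / 2))

theorem _root_.kernelMatrix_eq (F : ℝ × ℝ → ℝ) (k l : ℕ+) :
    kernelMatrix F k l = -(Real.sqrt (k : ℝ) * Real.sqrt (l : ℝ) * (cosCoeff F k l / 2)) := by
  rw [kernelMatrix, Real.sqrt_mul (by positivity)]; ring

theorem _root_.kernelMatrix_sq (F : ℝ × ℝ → ℝ) (k l : ℕ+) :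
    kernelMatrix F k l ^ 2 = (k : ℝ) * l * (cosCoeff F k l ^ 2 / 4) := by
  rw [kernelMatrix, mul_pow, Real.sq_sqrt (by positivity)]; ring

theorem summable_weighted_pnat (h : IsLogKernel ζ F) : Summable fun p : ℕ+ × ℕ+ =>
    (1 + ((p.1 : ℕ) : ℝ) ^ 2) * (1 + ((p.2 : ℕ) : ℝ) ^ 2) * cosCoeff F p.1 p.2 ^ 2 :=
  (summable_weighted_sq_cosCoeff h.contDiff).comp_injective
    (i := fun p : ℕ+ × ℕ+ => ((p.1 : ℕ), (p.2 : ℕ)))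
    (fun p q hpq => by
      simp only [Prod.mk.injEq, PNat.coe_inj] at hpq
      exact Prod.ext hpq.1 hpq.2)

theorem summable_kernelMatrix_sq (h : IsLogKernel ζ F) :
    Summable fun p : ℕ+ × ℕ+ => kernelMatrix F p.1 p.2 ^ 2 := by
  refine Summable.of_nonneg_of_le (fun _ => sq_nonneg _) (fun p => ?_) h.summable_weighted_pnat
  rw [kernelMatrix_sq]
  have h1 : (p.1 : ℝ) ≤ 1 + (p.1 : ℝ) ^ 2 := by nlinarith [sq_nonneg ((p.1 : ℝ) - 1)]
  have h2 : (p.2 : ℝ) ≤ 1 + (p.2 : ℝ) ^ 2 := by nlinarith [sq_nonneg ((p.2 : ℝ) - 1)]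
  refine mul_le_mul (mul_le_mul h1 h2 (by positivity) (by positivity)) ?_ (by positivity)
    (by positivity)
  linarith [sq_nonneg (cosCoeff F p.1 p.2)]

theorem kernelMatrix_comm (h : IsLogKernel ζ F) (k l : ℕ+) :
    kernelMatrix F k l = kernelMatrix F l k := by
  rw [kernelMatrix, kernelMatrix, cosCoeff_comm h.symm, mul_comm (k : ℝ)]

/-- The density with finitely many cosine coefficients `√k x_k`. -/
noncomputable def _root_.cosDensity (x : ℕ+ → ℝ) (s : Finset ℕ+) (φ : ℝ) : ℝ :=
  ∑ k ∈ s, Real.sqrt (k : ℝ) * x k * Real.cos ((k : ℕ) * φ)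

theorem _root_.continuous_cosDensity (x : ℕ+ → ℝ) (s : Finset ℕ+) :
    Continuous (cosDensity x s) := by
  unfold cosDensity; fun_prop

theorem _root_.integral_cosDensity (x : ℕ+ → ℝ) (s : Finset ℕ+) :
    ∫ φ, cosDensity x s φ ∂angleMeasure = 0 := by
  simp only [cosDensity]
  rw [integral_finsetSum _ fun k _ => Continuous.integrable_angleMeasure (by fun_prop)]
  refine Finset.sum_eq_zero fun k _ => ?_
  rw [integral_const_mul, integral_cos_nat_mul, if_neg k.ne_zero, mul_zero]

/-- The factors √k cancel the eigenvalues π/k of the segment kernel, so that part yields the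
identity matrix. The regular part F yields `kernelMatrix`. -/
theorem energy_cosDensity (h : IsLogKernel ζ F) (x : ℕ+ → ℝ) (s : Finset ℕ+) :
    ∫ p, Real.log ‖ζ p.1 - ζ p.2‖ * (cosDensity x s p.1 * cosDensity x s p.2)
      ∂(angleMeasure.prod angleMeasure) = -(Real.pi ^ 2 / 2 * (∑ k ∈ s, x k ^ 2 +
        ∑ k ∈ s, ∑ l ∈ s, kernelMatrix F k l * x k * x l)) := by
  have hc := continuous_cosDensity x s
  have hcc : Continuous fun p : ℝ × ℝ => cosDensity x s p.1 * cosDensity x s p.2 := by fun_prop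
  have hF := h.contDiff.continuous
  have e : (fun p : ℝ × ℝ => Real.log ‖ζ p.1 - ζ p.2‖ *
      (cosDensity x s p.1 * cosDensity x s p.2)) =ᵐ[angleMeasure.prod angleMeasure]
      fun p => Real.log |Real.cos p.1 - Real.cos p.2| *
        (cosDensity x s p.1 * cosDensity x s p.2) +
        F p * (cosDensity x s p.1 * cosDensity x s p.2) := by
    filter_upwards [h.log_ae] with p hp
    rw [hp, add_mul]
  have i1 := integrable_log_abs_cos_sub_cos_prod.mul_continuous_angleMeasure_prod hcc
  have i2 : Integrable (fun p : ℝ × ℝ => F p * (cosDensity x s p.1 * cosDensity x s p.2))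
      (angleMeasure.prod angleMeasure) := (hF.fun_mul hcc).integrable_angleMeasure_prod
  rw [integral_congr_ae e, integral_add i1 i2, integral_prod _ i1]
  have hcos : ∀ k : ℕ+, ∫ φ, cosDensity x s φ * Real.cos ((k : ℕ) * φ) ∂angleMeasure =
      if k ∈ s then Real.pi / 2 * (Real.sqrt (k : ℝ) * x k) else 0 := by
    intro k
    simp only [cosDensity, Finset.sum_mul, mul_assoc]
    rw [integral_finsetSum _ fun k _ => Continuous.integrable_angleMeasure (by fun_prop)]
    simp_rw [integral_const_mul, integral_cos_mul_cos]
    simp only [PNat.coe_inj, PNat.ne_zero, if_false]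
    rw [Finset.sum_congr rfl (g := fun j => if j = k then Real.pi / 2 * (Real.sqrt (k : ℝ) * x k)
      else 0)]
    · simp
    · intro j _
      split_ifs with hj
      · subst hj; ring
      · ring
  have e1 : ∫ y, ∫ z, Real.log |Real.cos y - Real.cos z| * (cosDensity x s y * cosDensity x s z)
      ∂angleMeasure ∂angleMeasure = -(Real.pi ^ 2 / 2 * ∑ k ∈ s, x k ^ 2) := by
    have inner : ∀ᵐ y ∂angleMeasure, ∫ z, Real.log |Real.cos y - Real.cos z| *
        (cosDensity x s y * cosDensity x s z) ∂angleMeasure =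
        ∑ k ∈ s, -(Real.pi / k * (Real.sqrt (k : ℝ) * x k)) *
          (cosDensity x s y * Real.cos ((k : ℕ) * y)) := by
      filter_upwards [ae_angleMeasure_mem] with y hy
      have hl := integrable_log_abs_cos_sub_cos hy
      have : ∀ z, Real.log |Real.cos y - Real.cos z| * (cosDensity x s y * cosDensity x s z) =
          ∑ k ∈ s, cosDensity x s y * (Real.sqrt (k : ℝ) * x k) *
            (Real.log |Real.cos y - Real.cos z| * Real.cos ((k : ℕ) * z)) := by
        intro z
        conv_lhs => rw [cosDensity.eq_def x s z]
        rw [Finset.mul_sum, Finset.mul_sum]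
        exact Finset.sum_congr rfl fun k _ => by ring
      simp_rw [this]
      rw [integral_finsetSum _ fun k _ =>
        (hl.mul_continuous_angleMeasure (by fun_prop)).const_mul _]
      refine Finset.sum_congr rfl fun k _ => ?_
      rw [integral_const_mul, integral_log_abs_cos_sub_cos_mul_cos hy k.ne_zero]
      ring
    rw [integral_congr_ae inner, integral_finsetSum _ fun k _ =>
      Continuous.integrable_angleMeasure (by fun_prop), Finset.mul_sum, ← Finset.sum_neg_distrib]
    refine Finset.sum_congr rfl fun k hk => ?_
    rw [integral_const_mul, hcos, if_pos hk]
    have hk0 : (0 : ℝ) < k := by exact_mod_cast k.pos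
    have hs : Real.sqrt (k : ℝ) * Real.sqrt (k : ℝ) = k := Real.mul_self_sqrt hk0.le
    field_simp
    linear_combination (-(x k ^ 2)) * hs
  have e2 : ∫ p, F p * (cosDensity x s p.1 * cosDensity x s p.2)
      ∂(angleMeasure.prod angleMeasure) =
      -(Real.pi ^ 2 / 2 * ∑ k ∈ s, ∑ l ∈ s, kernelMatrix F k l * x k * x l) := by
    have : ∀ p : ℝ × ℝ, F p * (cosDensity x s p.1 * cosDensity x s p.2) =
        ∑ k ∈ s, ∑ l ∈ s, (Real.sqrt (k : ℝ) * x k * (Real.sqrt (l : ℝ) * x l)) *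
          (F p * (Real.cos ((k : ℕ) * p.1) * Real.cos ((l : ℕ) * p.2))) := by
      intro p
      rw [cosDensity, cosDensity, Finset.sum_mul_sum, Finset.mul_sum]
      refine Finset.sum_congr rfl fun k _ => ?_
      rw [Finset.mul_sum]
      exact Finset.sum_congr rfl fun l _ => by ring
    simp_rw [this]
    rw [integral_finsetSum _ fun k _ => Continuous.integrable_angleMeasure_prod (by fun_prop),
      Finset.mul_sum, ← Finset.sum_neg_distrib]
    refine Finset.sum_congr rfl fun k _ => ?_
    rw [integral_finsetSum _ fun l _ => Continuous.integrable_angleMeasure_prod (by fun_prop),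
      Finset.mul_sum, ← Finset.sum_neg_distrib]
    refine Finset.sum_congr rfl fun l _ => ?_
    rw [integral_const_mul]
    have := pairing_cos_cos F k.ne_zero l.ne_zero
    rw [pairing] at this
    rw [this, kernelMatrix_eq]
    ring
  rw [e1, e2]; ring

end IsLogKernel


/-! ### Injectivity and coercivity of the operator of a logarithmic kernel. -/

/-- The cosine coefficients of a continuous function on `[0, π]`. -/
noncomputable def angleCoeff (g : C(Icc 0 Real.pi, ℝ)) (k : ℕ+) : ℝ :=
  ∫ φ, IccExtend Real.pi_pos.le g φ * Real.cos ((k : ℕ) * φ) ∂angleMeasure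

theorem sum_angleCoeff_sq_le (g : C(Icc 0 Real.pi, ℝ)) (s : Finset ℕ+) :
    ∑ k ∈ s, angleCoeff g k ^ 2 ≤ (Real.pi * ‖g‖) ^ 2 := by
  have hc : Continuous (IccExtend Real.pi_pos.le g) := g.continuous.Icc_extend'
  have h := orthogonalSeq_cos.bessel hc (s.map ⟨PNat.val, PNat.coe_injective⟩)
  rw [Finset.sum_map] at h
  have hpi := Real.pi_pos
  refine h.trans ?_
  have h1 : ∫ x, IccExtend Real.pi_pos.le g x * IccExtend Real.pi_pos.le g x ∂angleMeasure ≤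
      ∫ _, ‖g‖ ^ 2 ∂angleMeasure := by
    refine integral_mono (hc.mul hc).integrable_angleMeasure (integrable_const _) fun x => ?_
    simp only [IccExtend, Function.comp_apply]
    rw [← sq, ← sq_abs]
    exact pow_le_pow_left₀ (abs_nonneg _) (g.norm_coe_le_norm _) 2
  have h2 := integral_cos_nat_mul 0
  simp at h2
  rw [integral_const, h2, smul_eq_mul] at h1
  calc Real.pi * _ ≤ Real.pi * (Real.pi * ‖g‖ ^ 2) := by gcongr
    _ = _ := by ring

/-- The functional on continuous functions given by a density with square summable cosine
coefficients. -/
theorem exists_functional_of_cos_coeff (m : SeqL2) :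
    ∃ Λ : C(Icc 0 Real.pi, ℝ) →L[ℝ] ℝ, ∀ g, HasSum (fun k => m k * angleCoeff g k) (Λ g) := by
  have hs : ∀ g, Summable fun k => angleCoeff g k ^ 2 := fun g =>
    summable_of_sum_le (fun _ => sq_nonneg _) (sum_angleCoeff_sq_le g)
  have hint : ∀ (g : C(Icc 0 Real.pi, ℝ)) (k : ℕ+), Integrable
      (fun φ => IccExtend Real.pi_pos.le g φ * Real.cos ((k : ℕ) * φ)) angleMeasure := fun g k => by
    have hc : Continuous (IccExtend Real.pi_pos.le g) := g.continuous.Icc_extend'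
    exact Continuous.integrable_angleMeasure (by fun_prop)
  let L : C(Icc 0 Real.pi, ℝ) →ₗ[ℝ] ℝ :=
    { toFun := fun g => inner ℝ m (SeqL2.mk (angleCoeff g) (hs g))
      map_add' := fun f g => by
        rw [← inner_add_right]
        congr 1
        ext k
        change angleCoeff (f + g) k = angleCoeff f k + angleCoeff g k
        rw [angleCoeff, angleCoeff, angleCoeff, ← integral_add (hint f k) (hint g k)]
        congr 1; ext φ
        simp [IccExtend, add_mul]
      map_smul' := fun c f => by
        rw [RingHom.id_apply, smul_eq_mul, ← real_inner_smul_right]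
        congr 1
        ext k
        change angleCoeff (c • f) k = c * angleCoeff f k
        rw [angleCoeff, angleCoeff, ← integral_const_mul]
        congr 1; ext φ
        simp [IccExtend, mul_assoc] }
  refine ⟨L.mkContinuous (‖m‖ * Real.pi) fun g => ?_, fun g => ?_⟩
  · refine (abs_real_inner_le_norm m (SeqL2.mk (angleCoeff g) (hs g))).trans ?_
    rw [mul_assoc]
    refine mul_le_mul_of_nonneg_left ?_ (norm_nonneg _)
    refine le_of_sq_le_sq ?_ (by have := Real.pi_pos; positivity)
    rw [← (SeqL2.norm_sq_eq _).tsum_eq]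
    exact (hs g).tsum_le_of_sum_le (sum_angleCoeff_sq_le g)
  · exact SeqL2.inner_hasSum m (SeqL2.mk (angleCoeff g) (hs g))

namespace IsLogKernel
variable {ζ : ℝ → ℂ} {F : ℝ × ℝ → ℝ}

/-- B gains half a derivative: by the weighted summability of the coefficients, ∑ k b_kl² is still
finite. -/
theorem summable_sqrt_mul_operator_sq (h : IsLogKernel ζ F) {B : SeqL2 →L[ℝ] SeqL2}
    (hB : ∀ x k, HasSum (fun l => kernelMatrix F k l * x l) (B x k)) (x : SeqL2) :
    Summable fun k : ℕ+ => (Real.sqrt (k : ℝ) * B x k) ^ 2 := by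
  have hs : Summable fun p : ℕ+ × ℕ+ => (p.1 : ℝ) * kernelMatrix F p.1 p.2 ^ 2 := by
    refine Summable.of_nonneg_of_le (fun _ => by positivity) (fun p => ?_)
      h.summable_weighted_pnat
    rw [kernelMatrix_sq]
    have h1 : (p.1 : ℝ) * p.1 ≤ 1 + (p.1 : ℝ) ^ 2 := by nlinarith
    have h2 : (p.2 : ℝ) ≤ 1 + (p.2 : ℝ) ^ 2 := by nlinarith [sq_nonneg ((p.2 : ℝ) - 1)]
    have h3 : cosCoeff F p.1 p.2 ^ 2 / 4 ≤ cosCoeff F p.1 p.2 ^ 2 := by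
      linarith [sq_nonneg (cosCoeff F p.1 p.2)]
    calc _ = (p.1 : ℝ) * p.1 * p.2 * (cosCoeff F p.1 p.2 ^ 2 / 4) := by ring
      _ ≤ _ := mul_le_mul (mul_le_mul h1 h2 (by positivity) (by positivity)) h3 (by positivity)
        (by positivity)
  refine Summable.of_nonneg_of_le (fun _ => sq_nonneg _) (fun k => ?_)
    (hs.prod.mul_right (‖x‖ ^ 2))
  have hrow : Summable fun l => kernelMatrix F k l ^ 2 := h.summable_kernelMatrix_sq.prod_factor k
  have hin : B x k = inner ℝ (SeqL2.mk _ hrow) x :=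
    (hB x k).unique (SeqL2.inner_hasSum (SeqL2.mk _ hrow) x)
  change _ ≤ (∑' l, (k : ℝ) * kernelMatrix F k l ^ 2) * ‖x‖ ^ 2
  rw [mul_pow, Real.sq_sqrt (by positivity), hin, ← sq_abs, tsum_mul_left, mul_assoc]
  refine mul_le_mul_of_nonneg_left ?_ (by positivity)
  have := pow_le_pow_left₀ (abs_nonneg _) (abs_real_inner_le_norm (SeqL2.mk _ hrow) x) 2
  rw [mul_pow, ← (SeqL2.norm_sq_eq (SeqL2.mk _ hrow)).tsum_eq] at this
  exact this

-- The equation x = -Bx improves x, so √k x_k is square summable and the densities `cosDensity` of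
-- growing truncations converge weakly to a functional Λ. Their energies tend to a multiple of ⟨x +
-- Bx, x⟩ = 0. By Fatou the Gaussian transform of Λ vanishes for some t, whence Λ = 0 and x = 0.
open Filter Topology in
theorem eq_zero_of_add_eq_zero (h : IsLogKernel ζ F) {B : SeqL2 →L[ℝ] SeqL2}
    (hB : ∀ x k, HasSum (fun l => kernelMatrix F k l * x l) (B x k)) (x : SeqL2)
    (hx : x + B x = 0) : x = 0 := by
  have hBx : ∀ k, x k = -B x k := fun k => by
    have : (x + B x) k = 0 := by rw [hx]; rfl
    exact eq_neg_of_add_eq_zero_left this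
  have hm : Summable fun k : ℕ+ => (Real.sqrt (k : ℝ) * x k) ^ 2 := by
    simpa only [hBx, mul_neg, neg_sq] using h.summable_sqrt_mul_operator_sq hB x
  set m : SeqL2 := SeqL2.mk _ hm with hmdef
  obtain ⟨Λ, hΛ⟩ := exists_functional_of_cos_coeff m
  set ζI : C(Icc 0 Real.pi, ℂ) := ⟨fun φ => ζ φ, by have := h.continuous; fun_prop⟩ with hζI
  set e : ℝ → ℂ → C(Icc 0 Real.pi, ℝ) := fun t u =>
    ⟨fun φ => Real.exp (-(2 * t * ‖ζI φ - u‖ ^ 2)), by fun_prop⟩ with he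
  have hgt : ∀ (s : Finset ℕ+) t u, gaussTransform angleMeasure ζ (cosDensity x s) t u =
      ∑ k ∈ s, m k * angleCoeff (e t u) k := by
    intro s t u
    have hζc := h.continuous
    have h1 : gaussTransform angleMeasure ζ (cosDensity x s) t u =
        ∫ φ, ∑ k ∈ s, m k * (IccExtend Real.pi_pos.le (e t u) φ * Real.cos ((k : ℕ) * φ))
          ∂angleMeasure := by
      rw [gaussTransform]
      refine integral_congr_ae ?_
      filter_upwards [ae_angleMeasure_mem] with φ hφ
      rw [cosDensity, Finset.mul_sum]
      refine Finset.sum_congr rfl fun k _ => ?_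
      rw [IccExtend_of_mem _ _ hφ]
      change _ = Real.sqrt (k : ℝ) * x k *
        (Real.exp (-(2 * t * ‖ζ φ - u‖ ^ 2)) * Real.cos ((k : ℕ) * φ))
      ring
    rw [h1, integral_finsetSum]
    · exact Finset.sum_congr rfl fun k _ => integral_const_mul _ _
    · intro k _
      have hc : Continuous (IccExtend Real.pi_pos.le (e t u)) := (e t u).continuous.Icc_extend'
      exact Continuous.integrable_angleMeasure (by fun_prop)
  -- A sequence is extracted from the net of finite sets, as needed for measurability of the limit
  -- and for Fatou.
  obtain ⟨σ, hσ⟩ := (atTop : Filter (Finset ℕ+)).exists_seq_tendsto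
  have hlim : ∀ t u, Tendsto
      (fun n => gaussTransform angleMeasure ζ (cosDensity x (σ n)) t u) atTop
      (𝓝 (Λ (e t u))) := fun t u => by
    simp_rw [hgt]
    have h0 : Tendsto (fun s : Finset ℕ+ => ∑ k ∈ s, m k * angleCoeff (e t u) k) atTop
      (𝓝 (Λ (e t u))) := hΛ (e t u)
    exact h0.comp hσ
  have hmeasn : ∀ n, Measurable fun q : ℝ × ℂ =>
      gaussTransform angleMeasure ζ (cosDensity x (σ n)) q.1 q.2 := fun n =>
    measurable_gaussTransform h.continuous.measurable (continuous_cosDensity _ _).measurable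
  have hmeas : Measurable fun q : ℝ × ℂ => Λ (e q.1 q.2) :=
    measurable_of_tendsto_metrizable hmeasn (tendsto_pi_nhds.2 fun q => hlim q.1 q.2)
  have hEn : ∀ n, ∫⁻ t in Ioi (0 : ℝ), ∫⁻ u, ENNReal.ofReal
      (gaussTransform angleMeasure ζ (cosDensity x (σ n)) t u *
        gaussTransform angleMeasure ζ (cosDensity x (σ n)) t u) =
      ENNReal.ofReal (Real.pi / 2 * (Real.pi ^ 2 / 2 *
        inner ℝ (x.trunc (σ n) + B (x.trunc (σ n))) (x.trunc (σ n)))) := fun n => by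
    rw [inner_trunc hB]
    exact (h.lintegral_gaussTransform_sq (continuous_cosDensity x (σ n))
      (integral_cosDensity _ _) (h.energy_cosDensity x (σ n))).2
  have hE0 : Tendsto (fun n => ENNReal.ofReal (Real.pi / 2 * (Real.pi ^ 2 / 2 *
      inner ℝ (x.trunc (σ n) + B (x.trunc (σ n))) (x.trunc (σ n))))) atTop (𝓝 0) := by
    have h1 := (tendsto_inner_trunc B x).comp hσ
    rw [hx, inner_zero_left] at h1
    have h2 := ENNReal.tendsto_ofReal ((h1.const_mul (Real.pi ^ 2 / 2)).const_mul (Real.pi / 2))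
    simpa using h2
  have hm2 : ∀ n, Measurable fun q : ℝ × ℂ => ENNReal.ofReal
      (gaussTransform angleMeasure ζ (cosDensity x (σ n)) q.1 q.2 *
        gaussTransform angleMeasure ζ (cosDensity x (σ n)) q.1 q.2) := fun n =>
    ((hmeasn n).mul (hmeasn n)).ennreal_ofReal
  -- Fatou's lemma is applied twice, in u and then in t.
  have hzero : ∫⁻ t in Ioi (0 : ℝ), ∫⁻ u, ENNReal.ofReal (Λ (e t u) * Λ (e t u)) = 0 := by
    refine le_antisymm ?_ zero_le
    calc ∫⁻ t in Ioi (0 : ℝ), ∫⁻ u, ENNReal.ofReal (Λ (e t u) * Λ (e t u))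
        ≤ ∫⁻ t in Ioi (0 : ℝ), liminf (fun n => ∫⁻ u, ENNReal.ofReal
          (gaussTransform angleMeasure ζ (cosDensity x (σ n)) t u *
            gaussTransform angleMeasure ζ (cosDensity x (σ n)) t u)) atTop := by
          refine lintegral_mono fun t => ?_
          refine le_trans (lintegral_mono fun u => ?_) (lintegral_liminf_le
            fun n => (hm2 n).comp measurable_prodMk_left)
          exact (ENNReal.tendsto_ofReal ((hlim t u).mul (hlim t u))).liminf_eq.ge
      _ ≤ liminf (fun n => ∫⁻ t in Ioi (0 : ℝ), ∫⁻ u, ENNReal.ofReal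
          (gaussTransform angleMeasure ζ (cosDensity x (σ n)) t u *
            gaussTransform angleMeasure ζ (cosDensity x (σ n)) t u)) atTop :=
          lintegral_liminf_le fun n => (hm2 n).lintegral_prod_right'
      _ = 0 := by simp_rw [hEn]; exact hE0.liminf_eq
  obtain ⟨t, ht, htu⟩ := exists_forall_eq_zero_of_lintegral_eq_zero
    (D := fun t u => Λ (e t u)) hmeas (fun t _ => by
      refine Λ.continuous.comp (ContinuousMap.continuous_of_continuous_uncurry _ ?_)
      simp only [he, Function.uncurry_def]
      change Continuous fun q : ℂ × Icc 0 Real.pi => Real.exp (-(2 * t * ‖ζI q.2 - q.1‖ ^ 2))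
      fun_prop) hzero
  have hΛ0 : Λ = 0 := functional_eq_zero_of_gaussian ζI
    (fun a b hab => Subtype.ext (h.injOn a.2 b.2 hab)) Λ ht htu
  ext k
  -- Evaluating Λ at a cosine isolates the coefficient √k x_k.
  have h1 := hΛ ⟨fun φ => Real.cos ((k : ℕ) * φ), by fun_prop⟩
  rw [hΛ0, zero_apply] at h1
  have hcoef : ∀ l : ℕ+, angleCoeff ⟨fun φ => Real.cos ((k : ℕ) * φ), by fun_prop⟩ l =
      if l = k then Real.pi / 2 else 0 := by
    intro l
    have h2 := integral_cos_mul_cos k l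
    simp only [PNat.coe_inj, k.ne_zero, if_false, eq_comm (a := k)] at h2
    rw [← h2, angleCoeff]
    refine integral_congr_ae ?_
    filter_upwards [ae_angleMeasure_mem] with φ hφ
    rw [IccExtend_of_mem _ _ hφ]
    rfl
  simp_rw [hcoef] at h1
  have h3 := h1.unique (hasSum_single k fun l hl => by rw [if_neg hl, mul_zero])
  rw [if_pos rfl] at h3
  have h4 : Real.sqrt (k : ℝ) * x k * (Real.pi / 2) = 0 := h3.symm
  have hk : Real.sqrt (k : ℝ) ≠ 0 := (Real.sqrt_pos.2 (by exact_mod_cast k.pos)).ne'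
  have hpi := Real.pi_pos.ne'
  simpa [hk, hpi] using h4

/-- The operator of the regular part of the logarithmic kernel is bounded below by more than
`-1`. -/
theorem exists_operator (h : IsLogKernel ζ F) : ∃ B : SeqL2 →L[ℝ] SeqL2,
    (∀ x k, HasSum (fun l => kernelMatrix F k l * x l) (B x k)) ∧
    (∀ x y, inner ℝ (B x) y = inner ℝ x (B y)) ∧
    ∃ c > 0, ∀ x, c * ‖x‖ ^ 2 ≤ inner ℝ (x + B x) x := by
  obtain ⟨B, hB, hcomp⟩ := isCompactOperator_of_matrix h.summable_kernelMatrix_sq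
  have hsymm := inner_matrix_comm h.summable_kernelMatrix_sq h.kernelMatrix_comm hB
  refine ⟨B, hB, hsymm, exists_coercive hcomp hsymm (fun x => ?_)
    (h.eq_zero_of_add_eq_zero hB)⟩
  refine ge_of_tendsto' (tendsto_inner_trunc B x) fun s => ?_
  rw [inner_trunc hB]
  have h1 := (h.lintegral_gaussTransform_sq (continuous_cosDensity x s)
      (integral_cosDensity _ _) (h.energy_cosDensity x s)).1
  have hpi := Real.pi_pos
  exact nonneg_of_mul_nonneg_right h1 (by positivity)

end IsLogKernel


/-! ### The integral equation for the equilibrium density. -/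

theorem hasSum_of_eq {ι : Type*} {f g : ι → ℝ} {a : ℝ} (h : HasSum f a) (hfg : ∀ i, g i = f i) :
    HasSum g a := by
  rwa [funext hfg]

/-- Coefficients of an absolutely convergent cosine series with the decay of a `C²` function. -/
structure CosSeriesCoeff (c : ℕ → ℝ) : Prop where
  zero : c 0 = 1
  summable : Summable fun k : ℕ => (1 + (k : ℝ) ^ 2) * |c k|

namespace CosSeriesCoeff
variable {c : ℕ → ℝ}

theorem summable_abs (h : CosSeriesCoeff c) : Summable fun k => |c k| :=
  Summable.of_nonneg_of_le (fun _ => abs_nonneg _)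
    (fun k => by nlinarith [abs_nonneg (c k), sq_nonneg (k : ℝ)]) h.summable

theorem contDiff (h : CosSeriesCoeff c) :
    ContDiff ℝ 2 fun φ => ∑' k : ℕ, c k * Real.cos (k * φ) := by
  have hc : ∀ k n : ℕ, ContDiff ℝ (n : ℕ) fun φ : ℝ => c k * Real.cos ((k : ℕ) * φ) := fun k n => by
    fun_prop
  refine contDiff_tsum (N := (2 : ℕ)) (v := fun _ (k : ℕ) => (1 + (k : ℝ) ^ 2) * |c k|)
    (fun k => hc k 2) (fun _ _ => h.summable) fun n k x hn => ?_
  rw [norm_iteratedFDeriv_eq_norm_iteratedDeriv, iteratedDeriv_const_mul_field,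
    iteratedDeriv_comp_const_mul Real.contDiff_cos, norm_mul, norm_mul, mul_comm,
    Real.norm_eq_abs (c k), Real.norm_eq_abs (iteratedDeriv _ _ _)]
  refine mul_le_mul_of_nonneg_right ?_ (abs_nonneg _)
  refine (mul_le_of_le_one_right (norm_nonneg _) (Real.abs_iteratedDeriv_cos_le_one _ _)).trans ?_
  have hn2 : n ≤ 2 := by exact_mod_cast hn
  rw [norm_pow, Real.norm_natCast]
  interval_cases n
  · nlinarith [sq_nonneg (k : ℝ)]
  · nlinarith [sq_nonneg ((k : ℝ) - 1)]
  · linarith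

theorem integral_mul_cos (h : CosSeriesCoeff c) (l : ℕ) :
    ∫ φ, Real.cos (l * φ) * ∑' k : ℕ, c k * Real.cos (k * φ) ∂angleMeasure =
      Real.pi / cosWeight l * c l := by
  have hw : cosWeight l ≠ 0 := by unfold cosWeight; split_ifs <;> norm_num
  have h1 : HasSum (fun k : ℕ => ∫ φ, Real.cos (l * φ) * (c k * Real.cos (k * φ)) ∂angleMeasure)
      (∫ φ, ∑' k : ℕ, Real.cos (l * φ) * (c k * Real.cos (k * φ)) ∂angleMeasure) := by
    refine hasSum_integral_of_summable_integral_norm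
      (fun k => Continuous.integrable_angleMeasure (by fun_prop)) ?_
    refine Summable.of_nonneg_of_le (fun k => by positivity) (fun k => ?_)
      (h.summable_abs.mul_left (∫ _, (1 : ℝ) ∂angleMeasure))
    rw [← integral_mul_const]
    refine integral_mono (Continuous.integrable_angleMeasure (by fun_prop)) (integrable_const _)
      fun φ => ?_
    simp only [one_mul, norm_mul, Real.norm_eq_abs]
    have a1 := Real.abs_cos_le_one (l * φ)
    have a2 := Real.abs_cos_le_one (k * φ)
    calc |Real.cos (l * φ)| * (|c k| * |Real.cos (k * φ)|) ≤ 1 * (|c k| * 1) := by gcongr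
      _ = |c k| := by ring
  simp_rw [tsum_mul_left] at h1
  refine h1.unique ?_
  have h2 : ∀ k, ∫ φ, Real.cos (l * φ) * (c k * Real.cos (k * φ)) ∂angleMeasure =
      if k = l then Real.pi / cosWeight l * c l else 0 := fun k => by
    have h3 := cosWeight_mul_integral k l
    have h4 : ∫ φ, Real.cos (l * φ) * (c k * Real.cos (k * φ)) ∂angleMeasure =
        c k * ∫ φ, Real.cos (k * φ) * Real.cos (l * φ) ∂angleMeasure := by
      rw [← integral_const_mul]; congr 1; ext φ; ring
    rw [h4]
    split_ifs at h3 ⊢ with hkl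
    · rw [← hkl] at h3 hw ⊢; rw [← h3, mul_div_cancel_left₀ _ hw, mul_comm]
    · rw [(mul_eq_zero.1 h3).resolve_left hw, mul_zero]
  simp_rw [h2]
  exact hasSum_ite_eq l _

/-- Termwise integration is allowed because ∑ |c_k| converges and the logarithm is integrable. Each
cosine then contributes its eigenvalue, and the constant term contributes -π log 2. -/
theorem hasSum_integral_log (h : CosSeriesCoeff c) {x : ℝ} (hx : x ∈ Icc 0 Real.pi) :
    HasSum (fun k : ℕ => if k = 0 then -(Real.pi * Real.log 2) else
        -(Real.pi / k * c k * Real.cos (k * x)))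
      (∫ y, Real.log |Real.cos x - Real.cos y| * ∑' k : ℕ, c k * Real.cos (k * y)
        ∂angleMeasure) := by
  have hi := integrable_log_abs_cos_sub_cos hx
  have h1 : HasSum (fun k : ℕ => ∫ y, Real.log |Real.cos x - Real.cos y| *
        (c k * Real.cos (k * y)) ∂angleMeasure)
      (∫ y, ∑' k : ℕ, Real.log |Real.cos x - Real.cos y| * (c k * Real.cos (k * y))
        ∂angleMeasure) := by
    have hik : ∀ k : ℕ, Integrable (fun y => Real.log |Real.cos x - Real.cos y| *
        (c k * Real.cos (k * y))) angleMeasure := fun k =>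
      hi.mul_continuous_angleMeasure (by fun_prop)
    refine hasSum_integral_of_summable_integral_norm hik ?_
    refine Summable.of_nonneg_of_le (fun k => by positivity) (fun k => ?_)
      (h.summable_abs.mul_left (∫ y, |Real.log (|Real.cos x - Real.cos y|)| ∂angleMeasure))
    rw [← integral_mul_const]
    refine integral_mono (hik k).norm (hi.abs.mul_const _) fun φ => ?_
    simp only [norm_mul, Real.norm_eq_abs]
    have a2 := Real.abs_cos_le_one (k * φ)
    refine mul_le_mul_of_nonneg_left ?_ (abs_nonneg _)
    exact mul_le_of_le_one_right (abs_nonneg _) a2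
  simp_rw [tsum_mul_left] at h1
  convert h1 using 2 with k
  split_ifs with hk
  · subst hk
    simp_rw [h.zero, Nat.cast_zero, zero_mul, Real.cos_zero, mul_one]
    exact (integral_log_abs_cos_sub_cos hx).symm
  · have h4 : ∫ y, Real.log |Real.cos x - Real.cos y| * (c k * Real.cos (k * y)) ∂angleMeasure =
        c k * ∫ y, Real.log |Real.cos x - Real.cos y| * Real.cos (k * y) ∂angleMeasure := by
      rw [← integral_const_mul]; congr 1; ext φ; ring
    rw [h4, integral_log_abs_cos_sub_cos_mul_cos hx hk]
    ring

end CosSeriesCoeff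

namespace IsLogKernel
variable {ζ : ℝ → ℂ} {F : ℝ × ℝ → ℝ}

theorem integral_log_mul (h : IsLogKernel ζ F) {x : ℝ} (hx : x ∈ Icc 0 Real.pi) {g : ℝ → ℝ}
    (hg : Continuous g) : ∫ y, Real.log ‖ζ x - ζ y‖ * g y ∂angleMeasure =
      ∫ y, Real.log |Real.cos x - Real.cos y| * g y ∂angleMeasure +
        ∫ y, F (x, y) * g y ∂angleMeasure := by
  have hF := h.contDiff.continuous
  rw [← integral_add ((integrable_log_abs_cos_sub_cos hx).mul_continuous_angleMeasure hg)
    (Continuous.integrable_angleMeasure (by fun_prop))]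
  refine integral_congr_ae ?_
  filter_upwards [ae_angleMeasure_mem, ae_angleMeasure_ne x] with y hy hne
  rw [h.log_eq x hx y hy hne, add_mul]

theorem hasSum_integral_kernel_mul (h : IsLogKernel ζ F) {x : ℝ} (hx : x ∈ Icc 0 Real.pi)
    {g : ℝ → ℝ} (hg : Continuous g) :
    HasSum (fun kl : ℕ × ℕ => cosCoeff F kl.1 kl.2 * Real.cos (kl.1 * x) *
      ∫ y, Real.cos (kl.2 * y) * g y ∂angleMeasure) (∫ y, F (x, y) * g y ∂angleMeasure) := by
  have h1 : HasSum (fun kl : ℕ × ℕ => ∫ y, cosCoeff F kl.1 kl.2 * (Real.cos (kl.1 * x) *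
        Real.cos (kl.2 * y)) * g y ∂angleMeasure)
      (∫ y, ∑' kl : ℕ × ℕ, cosCoeff F kl.1 kl.2 * (Real.cos (kl.1 * x) *
        Real.cos (kl.2 * y)) * g y ∂angleMeasure) := by
    refine hasSum_integral_of_summable_integral_norm
      (fun k => Continuous.integrable_angleMeasure (by fun_prop)) ?_
    refine Summable.of_nonneg_of_le (fun k => by positivity) (fun k => ?_)
      ((summable_abs_cosCoeff h.contDiff).mul_right (∫ y, |g y| ∂angleMeasure))
    rw [← integral_const_mul]
    refine integral_mono (Continuous.integrable_angleMeasure (by fun_prop))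
      (Continuous.integrable_angleMeasure (by fun_prop)) fun φ => ?_
    simp only [norm_mul (_ * _) (g φ), Real.norm_eq_abs]
    exact mul_le_mul_of_nonneg_right (abs_cos_mul_cos_le _ _ _) (abs_nonneg _)
  have h2 : ∫ y, ∑' kl : ℕ × ℕ, cosCoeff F kl.1 kl.2 * (Real.cos (kl.1 * x) *
        Real.cos (kl.2 * y)) * g y ∂angleMeasure = ∫ y, F (x, y) * g y ∂angleMeasure := by
    refine integral_congr_ae ?_
    filter_upwards [ae_angleMeasure_mem] with y hy
    exact ((hasSum_cosCoeff h.contDiff hx hy).mul_right (g y)).tsum_eq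
  rw [h2] at h1
  convert h1 using 2 with kl
  rw [← integral_const_mul]
  congr 1; ext y; ring

/-- The integral equation for the density of the equilibrium measure. -/
theorem integral_log_mul_eq_const (h : IsLogKernel ζ F) {c : ℕ → ℝ} (hc : CosSeriesCoeff c)
    (heq : ∀ k : ℕ, k ≠ 0 → HasSum (fun l => cosCoeff F k l * (c l / cosWeight l)) (c k / k)) :
    ∃ V, ∀ x ∈ Icc 0 Real.pi,
      ∫ y, Real.log ‖ζ x - ζ y‖ * ∑' k : ℕ, c k * Real.cos (k * y) ∂angleMeasure = V := by
  have hsum0 : Summable fun l => cosCoeff F 0 l * (c l / cosWeight l) := by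
    obtain ⟨M, hM⟩ : ∃ M, ∀ l, |c l / cosWeight l| ≤ M := by
      obtain ⟨M, hM⟩ := hc.summable_abs.tendsto_atTop_zero.bddAbove_range
      refine ⟨M, fun l => ?_⟩
      have : |c l / cosWeight l| ≤ |c l| := by
        rw [abs_div]
        refine div_le_self (abs_nonneg _) ?_
        unfold cosWeight; split_ifs <;> norm_num
      exact this.trans (hM ⟨l, rfl⟩)
    refine Summable.of_norm_bounded
      (((summable_abs_cosCoeff h.contDiff).prod_factor 0).mul_right M) fun l => ?_
    rw [norm_mul]
    exact mul_le_mul_of_nonneg_left (hM l) (norm_nonneg _)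
  refine ⟨-(Real.pi * Real.log 2) + Real.pi * ∑' l, cosCoeff F 0 l * (c l / cosWeight l),
    fun x hx => ?_⟩
  have hcont := hc.contDiff.continuous
  rw [h.integral_log_mul hx hcont]
  have h1 := hc.hasSum_integral_log hx
  have h2 := h.hasSum_integral_kernel_mul hx hcont
  simp_rw [hc.integral_mul_cos] at h2
  have h3 := h2.prod_fiberwise (g := fun k => if k = 0 then
      Real.pi * ∑' l, cosCoeff F 0 l * (c l / cosWeight l) else
      Real.pi / k * c k * Real.cos (k * x)) fun k => by
    split_ifs with hk
    · subst hk
      have h4 := hsum0.hasSum.mul_left Real.pi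
      refine hasSum_of_eq h4 fun l => ?_
      simp only [Nat.cast_zero, zero_mul, Real.cos_zero]; ring
    · have h4 := (heq k hk).mul_left (Real.pi * Real.cos (k * x))
      rw [show Real.pi / k * c k * Real.cos (k * x) = Real.pi * Real.cos (k * x) * (c k / k) by
        ring]
      refine hasSum_of_eq h4 fun l => ?_
      ring
  refine (h1.add h3).unique ?_
  convert hasSum_ite_eq (0 : ℕ) (-(Real.pi * Real.log 2) +
    Real.pi * ∑' l, cosCoeff F 0 l * (c l / cosWeight l)) using 2 with k
  split_ifs <;> ring

theorem summable_weighted_row (hF : ContDiff ℝ 2 F) :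
    Summable fun k : ℕ => (1 + (k : ℝ) ^ 2) * cosCoeff F k 0 ^ 2 := by
  refine Summable.of_nonneg_of_le (fun k => by positivity) (fun k => ?_)
    ((summable_weighted_sq_cosCoeff hF).comp_injective
      (i := fun k : ℕ => (k, 0)) fun a b hab => (Prod.ext_iff.1 hab).1)
  simp

/-- The coefficients of the equilibrium density. -/
theorem exists_cosSeriesCoeff (h : IsLogKernel ζ F) (hF : ContDiff ℝ 4 F)
    (heven : ∀ x y, F (-x, y) = F (x, y)) (hper : ∀ x y, F (x + 2 * Real.pi, y) = F (x, y)) :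
    ∃ c, CosSeriesCoeff c ∧
      ∀ k : ℕ, k ≠ 0 → HasSum (fun l => cosCoeff F k l * (c l / cosWeight l)) (c k / k) := by
  obtain ⟨B, hB, -, c₀, hc₀, hco⟩ := h.exists_operator
  have hrow : Summable fun k : ℕ+ => (1 + ((k : ℕ) : ℝ) ^ 2) * cosCoeff F k 0 ^ 2 :=
    (summable_weighted_row h.contDiff).comp_injective PNat.coe_injective
  have hr : Summable fun k : ℕ+ => (Real.sqrt (k : ℝ) * cosCoeff F k 0) ^ 2 := by
    refine Summable.of_nonneg_of_le (fun k => sq_nonneg _) (fun k => ?_) hrow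
    rw [mul_pow, Real.sq_sqrt (by positivity)]
    gcongr
    nlinarith [sq_nonneg ((k : ℝ) - 1)]
  -- Coercivity makes I + B invertible, by Lax–Milgram.
  have hunit : IsUnit (1 + B) :=
    ContinuousLinearMap.isUnit_of_forall_le_norm_inner_map _ (c := ⟨c₀, hc₀.le⟩) hc₀ fun x => by
      rw [mul_comm]
      exact (hco x).trans (le_abs_self _)
  -- With m_k = √k y_k, the equation (I + B)y = (√k c_k0) is m_k/k = c_k0 + ∑ c_kl m_l/2, the
  -- integral equation for a density with constant term 1.
  obtain ⟨y, hy⟩ := ((ContinuousLinearMap.isUnit_iff_bijective).1 hunit).2 (SeqL2.mk _ hr)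
  have hyk : ∀ k : ℕ+, y k = Real.sqrt (k : ℝ) * cosCoeff F k 0 - B y k := fun k => by
    have h1 : (y + B y) k = Real.sqrt (k : ℝ) * cosCoeff F k 0 := by
      rw [show y + B y = (1 + B) y by simp, hy]; rfl
    exact eq_sub_of_add_eq h1
  -- The factor √k is affordable because both the right-hand side and By decay faster than general
  -- ℓ² sequences.
  have hm : Summable fun k : ℕ+ => (Real.sqrt (k : ℝ) * y k) ^ 2 := by
    refine Summable.of_nonneg_of_le (fun k => sq_nonneg _) (fun k => ?_)
      ((hrow.add (h.summable_sqrt_mul_operator_sq hB y)).mul_left 2)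
    have h1 : (Real.sqrt (k : ℝ) * (Real.sqrt (k : ℝ) * cosCoeff F k 0)) ^ 2 ≤
        (1 + ((k : ℕ) : ℝ) ^ 2) * cosCoeff F k 0 ^ 2 := by
      rw [← mul_assoc, Real.mul_self_sqrt (by positivity), mul_pow]
      gcongr
      linarith
    rw [hyk, mul_sub]
    nlinarith [sq_nonneg (Real.sqrt (k : ℝ) * (Real.sqrt (k : ℝ) * cosCoeff F k 0) +
      Real.sqrt (k : ℝ) * B y k)]
  set m : SeqL2 := SeqL2.mk _ hm with hmdef
  have hmk : ∀ k : ℕ+, m k = Real.sqrt (k : ℝ) * y k := fun k => rfl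
  have hmeq : ∀ k : ℕ+, HasSum (fun l : ℕ+ => cosCoeff F k l * (m l / 2))
      (m k / (k : ℕ) - cosCoeff F k 0) := fun k => by
    have hk : (0 : ℝ) < (k : ℕ) := by exact_mod_cast k.pos
    have hs := Real.sqrt_pos.2 hk
    have hsq : Real.sqrt (k : ℝ) * Real.sqrt (k : ℝ) = ((k : ℕ) : ℝ) :=
      Real.mul_self_sqrt (by positivity)
    have h1 := (hB y k).mul_left (-(Real.sqrt ((k : ℕ) : ℝ))⁻¹)
    rw [show m k / (k : ℕ) - cosCoeff F k 0 = -(Real.sqrt ((k : ℕ) : ℝ))⁻¹ * B y k by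
      rw [hmk, hyk]
      rw [show ∀ a b : ℝ, Real.sqrt (k : ℝ) * (Real.sqrt (k : ℝ) * a - b) / ((k : ℕ) : ℝ) - a =
        (Real.sqrt (k : ℝ) * Real.sqrt (k : ℝ) / ((k : ℕ) : ℝ) - 1) * a -
          Real.sqrt (k : ℝ) / ((k : ℕ) : ℝ) * b from fun a b => by ring, hsq, div_self hk.ne',
        Real.sqrt_div_self]
      ring]
    refine hasSum_of_eq h1 fun l => ?_
    rw [kernelMatrix_eq, hmk]
    field_simp
  -- The value 1 at index 0 normalizes the density to total mass π.
  set c : ℕ → ℝ := fun k => if hk : 0 < k then m ⟨k, hk⟩ else 1 with hcdef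
  have hcp : ∀ k : ℕ+, c k = m k := fun k => dif_pos k.pos
  have hc0 : c 0 = 1 := by simp [hcdef]
  refine ⟨c, ⟨hc0, ?_⟩, fun k hk => ?_⟩
  · rw [← summable_pnat_iff_summable_nat]
    have h4 := summable_pow_four_cosCoeff hF heven hper
    have h4r : Summable fun k : ℕ+ => (((k : ℕ) : ℝ) ^ 4 * cosCoeff F k 0) ^ 2 :=
      h4.comp_injective (i := fun k : ℕ+ => ((k : ℕ), 0))
        fun a b hab => PNat.coe_injective (Prod.ext_iff.1 hab).1
    have h4p : Summable fun p : ℕ+ × ℕ+ => (((p.1 : ℕ) : ℝ) ^ 4 * cosCoeff F p.1 p.2) ^ 2 :=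
      h4.comp_injective (i := fun p : ℕ+ × ℕ+ => ((p.1 : ℕ), (p.2 : ℕ)))
        (PNat.coe_injective.prodMap PNat.coe_injective)
    -- The rows of k⁴c_kl are square summable. The equation determines c_k/k, so k³c_k is square
    -- summable; this suffices for ∑ (1 + k²)|c_k| < ∞, since 2k²|c_k| ≤ (k³c_k)² + k⁻².
    have hbound : ∀ k : ℕ+, (((k : ℕ) : ℝ) ^ 3 * c k) ^ 2 ≤
        2 * ((((k : ℕ) : ℝ) ^ 4 * cosCoeff F k 0) ^ 2 +
          (∑' l : ℕ+, (((k : ℕ) : ℝ) ^ 4 * cosCoeff F k l) ^ 2) * ‖m‖ ^ 2) := fun k => by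
      have hk : (0 : ℝ) < (k : ℕ) := by exact_mod_cast k.pos
      have hrw := h4p.prod_factor k
      have hin : ((k : ℕ) : ℝ) ^ 4 * (2 * (m k / (k : ℕ) - cosCoeff F k 0)) =
          inner ℝ (SeqL2.mk _ hrw) m := by
        refine HasSum.unique ?_ (SeqL2.inner_hasSum (SeqL2.mk _ hrw) m)
        refine hasSum_of_eq (((hmeq k).mul_left 2).mul_left (((k : ℕ) : ℝ) ^ 4)) fun l => ?_
        change ((k : ℕ) : ℝ) ^ 4 * cosCoeff F k l * m l = _
        ring
      have hle := pow_le_pow_left₀ (abs_nonneg _) (abs_real_inner_le_norm (SeqL2.mk _ hrw) m) 2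
      rw [mul_pow, ← (SeqL2.norm_sq_eq (SeqL2.mk _ hrw)).tsum_eq, sq_abs, ← hin] at hle
      have hle' : (((k : ℕ) : ℝ) ^ 4 * (2 * (m k / (k : ℕ) - cosCoeff F k 0))) ^ 2 ≤
        (∑' l : ℕ+, (((k : ℕ) : ℝ) ^ 4 * cosCoeff F k l) ^ 2) * ‖m‖ ^ 2 := hle
      have hid : ((k : ℕ) : ℝ) ^ 3 * c k = ((k : ℕ) : ℝ) ^ 4 * cosCoeff F k 0 +
          ((k : ℕ) : ℝ) ^ 4 * (2 * (m k / (k : ℕ) - cosCoeff F k 0)) / 2 := by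
        rw [hcp]; field_simp; ring
      rw [hid]
      nlinarith [sq_nonneg (((k : ℕ) : ℝ) ^ 4 * cosCoeff F k 0 -
        ((k : ℕ) : ℝ) ^ 4 * (2 * (m k / (k : ℕ) - cosCoeff F k 0)) / 2)]
    have hs3 : Summable fun k : ℕ+ => (((k : ℕ) : ℝ) ^ 3 * c k) ^ 2 :=
      Summable.of_nonneg_of_le (fun _ => sq_nonneg _) hbound
        ((h4r.add (h4p.prod.mul_right _)).mul_left 2)
    have hinv : Summable fun k : ℕ+ => (1 + ((k : ℕ) : ℝ) ^ 2)⁻¹ :=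
      summable_inv_one_add_sq.comp_injective PNat.coe_injective
    refine Summable.of_nonneg_of_le (fun _ => by positivity) (fun k => ?_)
      ((hs3.add hinv).mul_left 4)
    have hk : (1 : ℝ) ≤ (k : ℕ) := by exact_mod_cast k.pos
    have h5 : (((k : ℕ) : ℝ) ^ 3 * c k) ^ 2 = (((k : ℕ) : ℝ) ^ 3 * |c k|) ^ 2 := by
      rw [mul_pow, mul_pow, sq_abs]
    rw [h5]
    set a : ℝ := ((k : ℕ) : ℝ)
    have h6 : (1 + a ^ 2) * |c k| ≤ 2 * a ^ 2 * |c k| :=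
      mul_le_mul_of_nonneg_right (by nlinarith) (abs_nonneg _)
    have h7 : (a ^ 2)⁻¹ ≤ 2 * (1 + a ^ 2)⁻¹ := by
      rw [inv_le_iff_one_le_mul₀ (by positivity), ← div_eq_mul_inv, ← mul_div_right_comm,
        le_div_iff₀ (by positivity)]
      nlinarith
    have h8 : 2 * a ^ 2 * |c k| ≤ (a ^ 3 * |c k|) ^ 2 + (a ^ 2)⁻¹ := by
      have e : a ^ 2 * |c k| = (a ^ 3 * |c k|) * a⁻¹ := by field_simp
      have := two_mul_le_add_sq (a ^ 3 * |c k|) a⁻¹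
      rw [inv_pow] at this
      linarith
    have h9 : 0 ≤ (1 + a ^ 2)⁻¹ := by positivity
    nlinarith [sq_nonneg (a ^ 3 * |c k|)]
  · lift k to ℕ+ using Nat.pos_of_ne_zero hk
    have h1 := hmeq k
    simp_rw [← hcp] at h1
    have h2 : HasSum (fun l : ℕ+ => cosCoeff F k l * (c l / cosWeight l))
        (c k / (k : ℕ) - cosCoeff F k 0) := by
      refine hasSum_of_eq h1 fun l => ?_
      rw [cosWeight, if_neg l.ne_zero]
    rw [hasSum_pnat_iff (f := fun l : ℕ => cosCoeff F k l * (c l / cosWeight l))] at h2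
    simpa [hc0, cosWeight] using h2

/-- The density of the equilibrium measure in the angular variable. -/
theorem exists_density (h : IsLogKernel ζ F) (hF : ContDiff ℝ 4 F)
    (heven : ∀ x y, F (-x, y) = F (x, y)) (hper : ∀ x y, F (x + 2 * Real.pi, y) = F (x, y)) :
    ∃ w : ℝ → ℝ, ContDiff ℝ 2 w ∧ (∀ x, w (-x) = w x) ∧ (∀ x, w (x + 2 * Real.pi) = w x) ∧
      ∫ x, w x ∂angleMeasure = Real.pi ∧ ∃ V, ∀ x ∈ Icc 0 Real.pi,
        ∫ y, Real.log ‖ζ x - ζ y‖ * w y ∂angleMeasure = V := by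
  obtain ⟨c, hc, heq⟩ := h.exists_cosSeriesCoeff hF heven hper
  refine ⟨fun φ => ∑' k : ℕ, c k * Real.cos (k * φ), hc.contDiff, fun x => ?_, fun x => ?_, ?_,
    h.integral_log_mul_eq_const hc heq⟩
  · simp
  · refine tsum_congr fun k => ?_
    rw [mul_add, Real.cos_add_nat_mul_two_pi]
  · simpa [cosWeight, hc.zero] using hc.integral_mul_cos 0

end IsLogKernel


/-! ### Logarithmic potentials of densities on curves. -/

section posLog
open Real Filter Topology

theorem intervalIntegrable_posLog_div_sq (ε a b : ℝ) :
    IntervalIntegrable (fun x : ℝ => log⁺ (ε / x ^ 2)) volume a b := by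
  have hm : Measurable fun x : ℝ => log⁺ (ε / x ^ 2) :=
    continuous_posLog.measurable.comp (by fun_prop)
  have hb : IntervalIntegrable (fun x : ℝ => log⁺ ε + 2 * |log x|) volume a b :=
    intervalIntegrable_const.add (intervalIntegral.intervalIntegrable_log'.abs.const_mul 2)
  refine hb.mono_fun hm.aestronglyMeasurable (Eventually.of_forall fun x => ?_)
  beta_reduce
  rw [norm_of_nonneg posLog_nonneg, norm_of_nonneg (add_nonneg posLog_nonneg (by positivity)),
    div_eq_mul_inv]
  refine posLog_mul.trans (add_le_add le_rfl ?_)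
  rw [← inv_pow, posLog_pow]
  refine mul_le_mul_of_nonneg_left ?_ (by norm_num)
  rw [posLog_apply, log_inv]
  exact max_le (abs_nonneg _) (neg_le_abs _)

/-- A majorant, uniform in the position of the pole, for integrals of `log⁺ (ε / x²)`. -/
noncomputable def posLogMass (ε : ℝ) : ℝ := ∫ x in (-π)..π, log⁺ (ε / x ^ 2)

/-- For ε < 1 the integrands are dominated by the case ε = 1, whose singularity at 0 is logarithmic.
-/
theorem tendsto_posLogMass : Tendsto posLogMass (𝓝[>] 0) (𝓝 0) := by
  have h := intervalIntegral.tendsto_integral_filter_of_dominated_convergence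
    (F := fun ε x : ℝ => log⁺ (ε / x ^ 2)) (f := fun _ => (0 : ℝ)) (a := -π) (b := π)
    (μ := volume) (l := 𝓝[>] (0 : ℝ)) (fun x => log⁺ (1 / x ^ 2))
    (Eventually.of_forall fun ε =>
      (continuous_posLog.measurable.comp (by fun_prop)).aestronglyMeasurable) ?_
    (intervalIntegrable_posLog_div_sq 1 _ _) ?_
  · rw [intervalIntegral.integral_zero] at h
    exact h
  · filter_upwards [Ioo_mem_nhdsGT (zero_lt_one' ℝ)] with ε hε
    refine Eventually.of_forall fun x _ => ?_
    rw [norm_of_nonneg posLog_nonneg]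
    have := hε.1.le
    exact posLog_le_posLog (by positivity) (div_le_div_of_nonneg_right hε.2.le (sq_nonneg _))
  · refine Eventually.of_forall fun x _ => ?_
    have h1 : Continuous fun ε : ℝ => log⁺ (ε / x ^ 2) := by fun_prop
    simpa using (h1.tendsto 0).mono_left nhdsWithin_le_nhds

theorem integral_posLog_comp_sub_le {ε x₀ : ℝ} (hx₀ : x₀ ∈ Icc 0 π) :
    Integrable (fun x => log⁺ (ε / (x - x₀) ^ 2)) angleMeasure ∧
      ∫ x, log⁺ (ε / (x - x₀) ^ 2) ∂angleMeasure ≤ posLogMass ε := by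
  constructor
  · rw [integrable_angleMeasure_iff]
    have h := (intervalIntegrable_posLog_div_sq ε (0 - x₀) (π - x₀)).comp_sub_right x₀
    simpa using h
  · rw [integral_angleMeasure, intervalIntegral.integral_comp_sub_right
      (f := fun x => log⁺ (ε / x ^ 2))]
    exact intervalIntegral.integral_mono_interval (by linarith [hx₀.2]) (by linarith [pi_pos])
      (by linarith [hx₀.1]) (Eventually.of_forall fun x => posLog_nonneg)
      (intervalIntegrable_posLog_div_sq _ _ _)

/-- The first two terms are max(log r, log t). So log t is a truncation that is continuous in t,
minus a nonnegative error supported on t ≤ r. -/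
theorem log_add_posLog_sub_posLog {r t : ℝ} (hr : 0 < r) (ht : t ≠ 0) :
    log r + log⁺ (r⁻¹ * t) - log⁺ (r / t) = log t := by
  have h := posLog_sub_posLog_inv (x := r⁻¹ * t)
  rw [mul_inv, inv_inv, ← div_eq_mul_inv, log_mul (inv_ne_zero hr.ne') ht, log_inv] at h
  linarith

end posLog

/-- A curve on `[0, π]` whose chords are bounded below by the square of the parameter distance. -/
structure IsSeparatedCurve (a : ℝ → ℂ) (c : ℝ) : Prop where
  continuous : Continuous a
  pos : 0 < c
  le_norm : ∀ x ∈ Icc 0 Real.pi, ∀ y ∈ Icc 0 Real.pi, c * (y - x) ^ 2 ≤ ‖a x - a y‖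

/-- The logarithmic potential of a density on a curve. -/
noncomputable def logPotential (a : ℝ → ℂ) (w : ℝ → ℝ) (z : ℂ) : ℝ :=
  ∫ φ, Real.log ‖z - a φ‖ * w φ ∂angleMeasure

namespace IsSeparatedCurve
open Real Filter Topology
variable {a : ℝ → ℂ} {c : ℝ} {w : ℝ → ℝ}

/-- For x take a parameter of a point of the curve nearest to z, so that every chord from a(x) is at
most twice the distance to z. This controls the singularity of the potential uniformly in z. -/
theorem exists_le_norm_sub (h : IsSeparatedCurve a c) (z : ℂ) :
    ∃ x ∈ Icc 0 π, ∀ y ∈ Icc 0 π, c / 2 * (y - x) ^ 2 ≤ ‖z - a y‖ := by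
  have ha := h.continuous
  obtain ⟨x, hx, hmin⟩ := (isCompact_Icc (a := (0 : ℝ)) (b := π)).exists_isMinOn
    (nonempty_Icc.2 pi_pos.le) (f := fun x => ‖z - a x‖) (by fun_prop)
  refine ⟨x, hx, fun y hy => ?_⟩
  have h1 := h.le_norm x hx y hy
  have h2 : ‖z - a x‖ ≤ ‖z - a y‖ := hmin hy
  have h3 := norm_sub_le (z - a y) (z - a x)
  rw [sub_sub_sub_cancel_left] at h3
  linarith

theorem ae_ne (h : IsSeparatedCurve a c) (z : ℂ) : ∀ᵐ φ ∂angleMeasure, ‖z - a φ‖ ≠ 0 := by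
  obtain ⟨x, -, hx⟩ := h.exists_le_norm_sub z
  filter_upwards [ae_angleMeasure_mem, ae_angleMeasure_ne x] with φ hφ hne
  have h1 : 0 < (φ - x) ^ 2 := by have := sub_ne_zero.2 hne.symm; positivity
  have := h.pos
  exact (lt_of_lt_of_le (by positivity) (hx φ hφ)).ne'

theorem measurable_posLog_div (h : IsSeparatedCurve a c) (z : ℂ) (r : ℝ) :
    Measurable fun φ => log⁺ (r / ‖z - a φ‖) := by
  have := h.continuous.measurable
  exact continuous_posLog.measurable.comp (by fun_prop)

theorem integral_posLog_le (h : IsSeparatedCurve a c) (z : ℂ) {r : ℝ} (hr : 0 ≤ r) :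
    Integrable (fun φ => log⁺ (r / ‖z - a φ‖)) angleMeasure ∧
      ∫ φ, log⁺ (r / ‖z - a φ‖) ∂angleMeasure ≤ posLogMass (2 * r / c) := by
  obtain ⟨x, hxm, hx⟩ := h.exists_le_norm_sub z
  obtain ⟨h1, h2⟩ := integral_posLog_comp_sub_le (ε := 2 * r / c) hxm
  have hpos := h.pos
  have hle : ∀ᵐ φ ∂angleMeasure, log⁺ (r / ‖z - a φ‖) ≤ log⁺ (2 * r / c / (φ - x) ^ 2) := by
    filter_upwards [ae_angleMeasure_mem, ae_angleMeasure_ne x] with φ hφ hne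
    have h1 : 0 < (φ - x) ^ 2 := by have := sub_ne_zero.2 hne.symm; positivity
    refine posLog_le_posLog (by positivity) ?_
    rw [show 2 * r / c / (φ - x) ^ 2 = r / (c / 2 * (φ - x) ^ 2) by field_simp]
    exact div_le_div_of_nonneg_left hr (by positivity) (hx φ hφ)
  have hint : Integrable (fun φ => log⁺ (r / ‖z - a φ‖)) angleMeasure := by
    refine h1.mono' (h.measurable_posLog_div z r).aestronglyMeasurable ?_
    filter_upwards [hle] with φ hφ
    rwa [norm_of_nonneg posLog_nonneg]
  exact ⟨hint, (integral_mono_ae hint h1 hle).trans h2⟩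

theorem integrable_abs_log (h : IsSeparatedCurve a c) (z : ℂ) :
    Integrable (fun φ => log⁺ ‖z - a φ‖ + log⁺ (1 / ‖z - a φ‖)) angleMeasure := by
  have ha := h.continuous
  exact (Continuous.integrable_angleMeasure (by fun_prop)).add
    (h.integral_posLog_le z zero_le_one).1

theorem _root_.Real.abs_log_le_posLog (t : ℝ) : |log t| ≤ log⁺ t + log⁺ (1 / t) := by
  have h1 := posLog_sub_posLog_inv (x := t)
  have h2 := posLog_nonneg (x := t)
  have h3 := posLog_nonneg (x := t⁻¹)
  rw [one_div, abs_le]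
  constructor <;> linarith

theorem integrable_log (h : IsSeparatedCurve a c) (z : ℂ) :
    Integrable (fun φ => log ‖z - a φ‖) angleMeasure := by
  have ha := h.continuous.measurable
  refine (h.integrable_abs_log z).mono' (Measurable.aestronglyMeasurable (by fun_prop))
    (Eventually.of_forall fun φ => ?_)
  exact Real.abs_log_le_posLog _

theorem _root_.Continuous.exists_bound_angle {f : ℝ → ℝ} (hf : Continuous f) :
    ∃ M, 0 < M ∧ ∀ x ∈ Icc 0 π, |f x| ≤ M := by
  obtain ⟨M, hM⟩ := (isCompact_Icc (a := (0 : ℝ)) (b := π)).exists_bound_of_continuousOn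
    hf.continuousOn
  exact ⟨max M 1, by positivity, fun x hx => (hM x hx).trans (le_max_left _ _)⟩

theorem integrable_posLog_mul (h : IsSeparatedCurve a c) (hw : Continuous w) (z : ℂ) {r : ℝ}
    (hr : 0 ≤ r) : Integrable (fun φ => log⁺ (r / ‖z - a φ‖) * w φ) angleMeasure :=
  (h.integral_posLog_le z hr).1.mul_continuous_angleMeasure hw

theorem logPotential_eq (h : IsSeparatedCurve a c) (hw : Continuous w) (z : ℂ) {r : ℝ}
    (hr : 0 < r) : logPotential a w z =
      ∫ φ, (log r + log⁺ (r⁻¹ * ‖z - a φ‖)) * w φ ∂angleMeasure -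
        ∫ φ, log⁺ (r / ‖z - a φ‖) * w φ ∂angleMeasure := by
  have ha := h.continuous
  rw [← integral_sub (Continuous.integrable_angleMeasure (by fun_prop))
    (h.integrable_posLog_mul hw z hr.le), logPotential]
  refine integral_congr_ae ?_
  filter_upwards [h.ae_ne z] with φ hφ
  rw [← sub_mul, log_add_posLog_sub_posLog hr hφ]

theorem abs_integral_posLog_mul_le (h : IsSeparatedCurve a c) (hw : Continuous w) {M : ℝ}
    (hM : ∀ x ∈ Icc 0 π, |w x| ≤ M) (z : ℂ) {r : ℝ} (hr : 0 ≤ r) :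
    |∫ φ, log⁺ (r / ‖z - a φ‖) * w φ ∂angleMeasure| ≤ posLogMass (2 * r / c) * M := by
  obtain ⟨h1, h2⟩ := h.integral_posLog_le z hr
  have hM0 : 0 ≤ M := (abs_nonneg _).trans (hM 0 ⟨le_rfl, pi_pos.le⟩)
  refine (abs_integral_le_integral_abs).trans ?_
  refine le_trans ?_ (mul_le_mul_of_nonneg_right h2 hM0)
  rw [← integral_mul_const]
  refine integral_mono_ae (h.integrable_posLog_mul hw z hr).abs (h1.mul_const M) ?_
  filter_upwards [ae_angleMeasure_mem] with φ hφ
  rw [abs_mul, abs_of_nonneg posLog_nonneg]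
  exact mul_le_mul_of_nonneg_left (hM φ hφ) posLog_nonneg

/-- The potential is the uniform limit, as r decreases to 0, of potentials with the logarithm
truncated at r. The error is at most `posLogMass (2 * r / c)` times a bound for w, independently of
z. -/
theorem continuous_logPotential (h : IsSeparatedCurve a c) (hw : Continuous w) :
    Continuous (logPotential a w) := by
  have ha := h.continuous
  have hc := h.pos
  obtain ⟨M, hM0, hM⟩ := hw.exists_bound_angle
  have hlim : Tendsto (fun r : ℝ => posLogMass (2 * r / c) * M) (𝓝[>] 0) (𝓝 0) := by
    have h1 : Tendsto (fun r : ℝ => 2 * r / c) (𝓝[>] 0) (𝓝[>] 0) := by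
      refine tendsto_nhdsWithin_iff.2 ⟨?_, ?_⟩
      · have h2 : Continuous fun r : ℝ => 2 * r / c := by fun_prop
        simpa using (h2.tendsto 0).mono_left nhdsWithin_le_nhds
      · filter_upwards [self_mem_nhdsWithin] with r hr
        have : 0 < r := hr
        exact mem_Ioi.2 (by positivity)
    simpa using (tendsto_posLogMass.comp h1).mul_const M
  have hu : TendstoUniformly
      (fun (r : ℝ) z => ∫ φ, (log r + log⁺ (r⁻¹ * ‖z - a φ‖)) * w φ ∂angleMeasure)
      (logPotential a w) (𝓝[>] 0) := by
    rw [Metric.tendstoUniformly_iff]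
    intro ε hε
    filter_upwards [hlim.eventually_lt_const hε, self_mem_nhdsWithin] with r hr hr0 z
    rw [dist_comm, h.logPotential_eq hw z hr0, Real.dist_eq, sub_sub_cancel]
    exact (h.abs_integral_posLog_mul_le hw hM z (le_of_lt hr0)).trans_lt hr
  refine hu.continuous (Frequently.of_forall fun r => ?_)
  simp_rw [integral_angleMeasure]
  exact intervalIntegral.continuous_parametric_intervalIntegral_of_continuous' (by fun_prop) 0 π

theorem exists_norm_le (h : IsSeparatedCurve a c) : ∃ A, 0 < A ∧ ∀ x ∈ Icc 0 π, ‖a x‖ ≤ A := by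
  obtain ⟨A, hA, h1⟩ := h.continuous.norm.exists_bound_angle
  exact ⟨A, hA, fun x hx => by simpa using h1 x hx⟩

/-- The average of log|· - a| over a circle is max(log r, log|z - a|), which exceeds log|z - a| by
log⁺(r/|z - a|). Fubini transfers this to the potential, so the mean value defect shows the density
near z. -/
theorem circleAverage_logPotential (h : IsSeparatedCurve a c) (hw : Continuous w) (z : ℂ) {r : ℝ}
    (hr : 0 < r) : circleAverage (logPotential a w) z r = logPotential a w z +
      ∫ φ, log⁺ (r / ‖z - a φ‖) * w φ ∂angleMeasure := by
  have ha := h.continuous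
  obtain ⟨A, hA0, hA⟩ := h.exists_norm_le
  obtain ⟨M, hM0, hM⟩ := hw.exists_bound_angle
  have hcm : Measurable fun p : ℝ × ℝ => circleMap z r p.1 - a p.2 :=
    (((continuous_circleMap z r).comp continuous_fst).sub (ha.comp continuous_snd)).measurable
  have hint : Integrable (fun p : ℝ × ℝ => log ‖circleMap z r p.1 - a p.2‖ * w p.2)
      ((volume.restrict (Ioc 0 (2 * π))).prod angleMeasure) := by
    -- A bound uniform on the circle: |log| is split into log⁺ of the distance, bounded by
    -- compactness, and log⁺ of its inverse, bounded by `posLogMass`.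
    have hb : ∀ θ, ∫ φ, |log ‖circleMap z r θ - a φ‖ * w φ| ∂angleMeasure ≤
        (∫ _, log⁺ (‖z‖ + r + A) ∂angleMeasure + posLogMass (2 * 1 / c)) * M := fun θ => by
      obtain ⟨h1, h2⟩ := h.integral_posLog_le (circleMap z r θ) zero_le_one
      refine le_trans ?_ (mul_le_mul_of_nonneg_right (add_le_add le_rfl h2) hM0.le)
      rw [← integral_add (integrable_const _) h1, ← integral_mul_const]
      refine integral_mono_ae ((h.integrable_log _).mul_continuous_angleMeasure hw).abs
        (((integrable_const _).add h1).mul_const _) ?_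
      filter_upwards [ae_angleMeasure_mem] with φ hφ
      rw [abs_mul]
      refine mul_le_mul ?_ (hM φ hφ) (abs_nonneg _) (add_nonneg posLog_nonneg posLog_nonneg)
      refine (Real.abs_log_le_posLog _).trans (add_le_add ?_ le_rfl)
      refine posLog_le_posLog (norm_nonneg _) ((norm_sub_le _ _).trans (add_le_add ?_ (hA φ hφ)))
      rw [circleMap]
      refine (norm_add_le _ _).trans (add_le_add le_rfl ?_)
      rw [norm_mul, Complex.norm_exp_ofReal_mul_I, mul_one, Complex.norm_real, norm_of_nonneg hr.le]
    have hs : ∀ θ, Integrable (fun φ => log ‖circleMap z r θ - a φ‖ * w φ) angleMeasure :=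
      fun θ => (h.integrable_log _).mul_continuous_angleMeasure hw
    have hms : Measurable fun p : ℝ × ℝ => log ‖circleMap z r p.1 - a p.2‖ * w p.2 :=
      (Real.measurable_log.comp hcm.norm).mul (hw.measurable.comp measurable_snd)
    exact integrable_prod_of_bound hms.aestronglyMeasurable
      (Eventually.of_forall hs) (Eventually.of_forall hb)
  have hswap : ∫ θ in (0 : ℝ)..(2 * π), logPotential a w (circleMap z r θ) =
      ∫ φ, (2 * π * (log r + log⁺ (r⁻¹ * ‖z - a φ‖))) * w φ ∂angleMeasure := by
    rw [intervalIntegral.integral_of_le (by positivity)]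
    simp only [logPotential]
    rw [integral_integral_swap hint]
    congr 1; ext φ
    rw [integral_mul_const]
    congr 1
    have h1 := circleAverage_log_norm_sub_const_eq_log_radius_add_posLog (a := a φ) (c := z) hr.ne'
    rw [← h1, circleAverage, smul_eq_mul, mul_inv_cancel_left₀ (by positivity),
      intervalIntegral.integral_of_le (by positivity)]
  rw [circleAverage, hswap, h.logPotential_eq hw z hr, sub_add_cancel, smul_eq_mul,
    ← integral_const_mul]
  congr 1; ext φ
  have := pi_pos
  field_simp

/-- Far away log|z - a(φ)| differs from log|z| by at most log 2, so the potential grows like the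
total mass times log|z|. -/
theorem exists_lt_logPotential (h : IsSeparatedCurve a c) (hw : Continuous w)
    (hpos : 0 < ∫ φ, w φ ∂angleMeasure) (K : ℝ) : ∃ R, ∀ z, R ≤ ‖z‖ → K < logPotential a w z := by
  obtain ⟨A, hA0, hA⟩ := h.exists_norm_le
  set m := ∫ φ, w φ ∂angleMeasure with hm
  set J := ∫ φ, log 2 * |w φ| ∂angleMeasure with hJ
  refine ⟨max (2 * A) (exp ((K + J + 1) / m)), fun z hz => ?_⟩
  have hzA : 2 * A ≤ ‖z‖ := (le_max_left _ _).trans hz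
  have hz0 : 0 < ‖z‖ := by linarith
  have hlogz : (K + J + 1) / m ≤ log ‖z‖ := by
    rw [Real.le_log_iff_exp_le hz0]; exact (le_max_right _ _).trans hz
  rw [div_le_iff₀ hpos] at hlogz
  have h1 : log ‖z‖ * m - J ≤ logPotential a w z := by
    rw [hm, hJ, ← integral_const_mul, ← integral_sub
      (Continuous.integrable_angleMeasure (by fun_prop))
      (Continuous.integrable_angleMeasure (by fun_prop))]
    refine integral_mono_ae ((Continuous.integrable_angleMeasure (by fun_prop)).sub
      (Continuous.integrable_angleMeasure (by fun_prop)))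
      ((h.integrable_log z).mul_continuous_angleMeasure hw) ?_
    filter_upwards [ae_angleMeasure_mem] with φ hφ
    have h2 : ‖z‖ / 2 ≤ ‖z - a φ‖ := by
      have := norm_sub_norm_le z (a φ)
      linarith [hA φ hφ]
    have h3 : ‖z - a φ‖ ≤ 2 * ‖z‖ := by
      have := norm_sub_le z (a φ)
      linarith [hA φ hφ]
    have h4 : |log ‖z - a φ‖ - log ‖z‖| ≤ log 2 := by
      rw [abs_le]
      have e1 := Real.log_le_log (by positivity) h2
      have e2 := Real.log_le_log (by linarith) h3
      rw [Real.log_div hz0.ne' two_ne_zero] at e1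
      rw [Real.log_mul two_ne_zero hz0.ne'] at e2
      constructor <;> linarith
    have h5 : |(log ‖z - a φ‖ - log ‖z‖) * w φ| ≤ log 2 * |w φ| := by
      rw [abs_mul]; exact mul_le_mul_of_nonneg_right h4 (abs_nonneg _)
    have h6 := (abs_le.1 h5).1
    linarith
  linarith

end IsSeparatedCurve


/-! ### Geometry of a regular arc: touching discs and connectedness of the complement. -/

/-- The remainder is (s - t) times the increment of the divided difference from (t, t) to (s, t),
and the divided difference of a C² function is Lipschitz on compact sets. -/
theorem exists_taylor_bound {E : Type} [NormedAddCommGroup E] [NormedSpace ℝ E] [CompleteSpace E]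
    {f : ℝ → E} (hf : ContDiff ℝ 2 f) (a b : ℝ) : ∃ M, 0 < M ∧ ∀ s ∈ Icc a b, ∀ t ∈ Icc a b,
      ‖f s - f t - (s - t) • deriv f t‖ ≤ M * (s - t) ^ 2 := by
  have h1 : ContDiff ℝ 1 (dividedDiff f) := contDiff_dividedDiff (n := 1) hf
  obtain ⟨K, hK⟩ := h1.contDiffOn.exists_lipschitzOnWith (s := Icc a b ×ˢ Icc a b) one_ne_zero
    ((convex_Icc _ _).prod (convex_Icc _ _)) (isCompact_Icc.prod isCompact_Icc)
  refine ⟨K + 1, by positivity, fun s hs t ht => ?_⟩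
  have h2 := hK.dist_le_mul (s, t) ⟨hs, ht⟩ (t, t) ⟨ht, ht⟩
  rw [dividedDiff_self, dist_eq_norm, dist_prod_same_right, Real.dist_eq] at h2
  rw [← smul_dividedDiff (hf.of_le (by norm_num)) s t, ← smul_sub, norm_smul, Real.norm_eq_abs,
    ← sq_abs (s - t)]
  calc |s - t| * ‖dividedDiff f (s, t) - deriv f t‖ ≤ |s - t| * (K * |s - t|) := by gcongr
    _ ≤ (K + 1) * |s - t| ^ 2 := by nlinarith [sq_nonneg |s - t|]

/-- A regular parametrization of class `C⁵` over `[-1, 1]` of an arc with endpoints `±1`. -/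
structure IsRegularArc (q : ℝ → ℂ) : Prop where
  contDiff : ContDiff ℝ 5 q
  injOn : InjOn q (Icc (-1) 1)
  deriv_ne : ∀ s ∈ Icc (-1 : ℝ) 1, deriv q s ≠ 0
  left : q (-1) = -1
  right : q 1 = 1

/-- The vector `e` is normal to the arc `q` at `q s` (pointing outward at the endpoints). -/
def IsArcNormal (q : ℝ → ℂ) (s : ℝ) (e : ℂ) : Prop :=
  ∀ t ∈ Icc (-1 : ℝ) 1, (t - s) * inner ℝ (deriv q s) e ≤ 0

namespace IsRegularArc
variable {q : ℝ → ℂ}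

theorem contDiff_one (h : IsRegularArc q) : ContDiff ℝ 1 q := h.contDiff.of_le (by norm_num)

theorem contDiff_dividedDiff (h : IsRegularArc q) : ContDiff ℝ 4 (dividedDiff q) :=
  _root_.contDiff_dividedDiff (n := 4) h.contDiff

theorem dividedDiff_ne (h : IsRegularArc q) {s t : ℝ} (hs : s ∈ Icc (-1 : ℝ) 1)
    (ht : t ∈ Icc (-1 : ℝ) 1) : dividedDiff q (s, t) ≠ 0 := by
  rcases eq_or_ne s t with rfl | hne
  · rw [dividedDiff_self]; exact h.deriv_ne s hs
  · rw [dividedDiff_eq h.contDiff_one hne]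
    exact smul_ne_zero (inv_ne_zero (sub_ne_zero.2 hne))
      (sub_ne_zero.2 fun he => hne (h.injOn hs ht he))

theorem exists_le_norm_sub (h : IsRegularArc q) : ∃ m, 0 < m ∧ ∀ s ∈ Icc (-1 : ℝ) 1,
    ∀ t ∈ Icc (-1 : ℝ) 1, m * |s - t| ≤ ‖q s - q t‖ := by
  have hc := h.contDiff_dividedDiff.continuous
  obtain ⟨p, hp, hmin⟩ := ((isCompact_Icc (a := (-1 : ℝ)) (b := 1)).prod
    (isCompact_Icc (a := (-1 : ℝ)) (b := 1))).exists_isMinOn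
    ⟨(1, 1), by simp⟩ (f := fun p => ‖dividedDiff q p‖) (by fun_prop)
  refine ⟨_, norm_pos_iff.2 (h.dividedDiff_ne hp.1 hp.2), fun s hs t ht => ?_⟩
  rw [← smul_dividedDiff h.contDiff_one, norm_smul, mul_comm, Real.norm_eq_abs]
  exact mul_le_mul_of_nonneg_left (hmin (show (s, t) ∈ _ from ⟨hs, ht⟩)) (abs_nonneg _)

/-- Small balls that touch the arc along a normal contain no point of it. -/
theorem exists_tube (h : IsRegularArc q) : ∃ ρ₀ > 0, ∀ ρ ∈ Ioc 0 ρ₀, ∀ s ∈ Icc (-1 : ℝ) 1, ∀ e : ℂ,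
    ‖e‖ = 1 → IsArcNormal q s e → ∀ t ∈ Icc (-1 : ℝ) 1, ρ ≤ ‖q t - (q s + ρ • e)‖ := by
  obtain ⟨m, hm, hle⟩ := h.exists_le_norm_sub
  obtain ⟨M, hM, hT⟩ := exists_taylor_bound (h.contDiff.of_le (by norm_num)) (-1) 1
  -- Expanding the square gives at least (m² - 2ρM)(t - s)² + ρ², so any ρ ≤ m²/(2M) would do.
  refine ⟨m ^ 2 / (4 * M), by positivity, fun ρ hρ s hs e he hn t ht => ?_⟩
  refine le_of_sq_le_sq ?_ (norm_nonneg _)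
  have hd : 0 ≤ (t - s) ^ 2 := sq_nonneg _
  have h1 : inner ℝ (q t - q s) e ≤ M * (t - s) ^ 2 := by
    have h2 : q t - q s = (q t - q s - (t - s) • deriv q s) + (t - s) • deriv q s := by abel
    rw [h2, inner_add_left, real_inner_smul_left]
    have h3 := (real_inner_le_norm (q t - q s - (t - s) • deriv q s) e).trans
      (mul_le_mul_of_nonneg_right (hT t ht s hs) (norm_nonneg e))
    rw [he, mul_one] at h3
    linarith [hn t ht]
  have h4 : m ^ 2 * (t - s) ^ 2 ≤ ‖q t - q s‖ ^ 2 := by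
    rw [← sq_abs (t - s), ← mul_pow]
    exact pow_le_pow_left₀ (by positivity) (hle t ht s hs) 2
  have h5 : ρ * (4 * M) ≤ m ^ 2 := (le_div_iff₀ (by positivity)).1 hρ.2
  rw [← sub_sub, norm_sub_sq_real, real_inner_smul_right, norm_smul, he, mul_one, Real.norm_eq_abs,
    sq_abs]
  have h6 : ρ * inner ℝ (q t - q s) e ≤ ρ * (M * (t - s) ^ 2) :=
    mul_le_mul_of_nonneg_left h1 hρ.1.le
  have h7 := mul_le_mul_of_nonneg_right h5 hd
  have h8 : 0 ≤ m ^ 2 * (t - s) ^ 2 := by positivity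
  nlinarith

/-- First variation at a closest point. Only parameters between s and t are compared, so the
inequality is one-sided at the endpoints. -/
theorem exists_nearest (h : IsRegularArc q) (z : ℂ) : ∃ s ∈ Icc (-1 : ℝ) 1,
    IsArcNormal q s (z - q s) ∧ ∀ t ∈ Icc (-1 : ℝ) 1, ‖z - q s‖ ≤ ‖z - q t‖ := by
  have hq := h.contDiff.continuous
  obtain ⟨s, hs, hmin⟩ := (isCompact_Icc (a := (-1 : ℝ)) (b := 1)).exists_isMinOn
    (nonempty_Icc.2 (by norm_num)) (f := fun s => ‖z - q s‖) (by fun_prop)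
  refine ⟨s, hs, fun t ht => ?_, fun t ht => hmin ht⟩
  have hD := h.contDiff_dividedDiff.continuous
  have key : ∀ τ ∈ Ioc (0 : ℝ) 1, 2 * ((t - s) * inner ℝ (dividedDiff q (s + τ * (t - s), s))
      (z - q s)) ≤ τ * ‖(t - s) • dividedDiff q (s + τ * (t - s), s)‖ ^ 2 := by
    intro τ hτ
    have hmem : s + τ * (t - s) ∈ Icc (-1 : ℝ) 1 := by
      constructor <;> nlinarith [hs.1, hs.2, ht.1, ht.2, hτ.1, hτ.2]
    have h1 : ‖z - q s‖ ^ 2 ≤ ‖z - q (s + τ * (t - s))‖ ^ 2 :=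
      pow_le_pow_left₀ (norm_nonneg _) (hmin hmem) 2
    have h2 : z - q (s + τ * (t - s)) =
        (z - q s) - τ • ((t - s) • dividedDiff q (s + τ * (t - s), s)) := by
      have := smul_dividedDiff h.contDiff_one (s + τ * (t - s)) s
      rw [add_sub_cancel_left] at this
      rw [smul_smul, this]
      abel
    rw [h2, norm_sub_sq_real (z - q s), real_inner_smul_right, real_inner_smul_right, norm_smul,
      Real.norm_eq_abs, mul_pow, sq_abs, real_inner_comm] at h1
    have h3 : τ * (2 * ((t - s) * inner ℝ (dividedDiff q (s + τ * (t - s), s)) (z - q s))) ≤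
        τ * (τ * ‖(t - s) • dividedDiff q (s + τ * (t - s), s)‖ ^ 2) := by nlinarith
    exact le_of_mul_le_mul_left h3 hτ.1
  have hc1 : Continuous fun τ : ℝ => 2 * ((t - s) * inner ℝ
      (dividedDiff q (s + τ * (t - s), s)) (z - q s)) := by fun_prop
  have hc2 : Continuous fun τ : ℝ =>
      τ * ‖(t - s) • dividedDiff q (s + τ * (t - s), s)‖ ^ 2 := by fun_prop
  have := le_of_tendsto_of_tendsto ((hc1.tendsto 0).mono_left nhdsWithin_le_nhds)
    ((hc2.tendsto 0).mono_left (nhdsWithin_le_nhds (s := Ioi 0)))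
    (by filter_upwards [Ioc_mem_nhdsGT (zero_lt_one' ℝ)] with τ hτ using key τ hτ)
  simp only [zero_mul, add_zero, dividedDiff_self] at this
  linarith

/-- The unit tangent. -/
noncomputable def tangent (q : ℝ → ℂ) (s : ℝ) : ℂ := ‖deriv q s‖⁻¹ • deriv q s

theorem norm_tangent (h : IsRegularArc q) {s : ℝ} (hs : s ∈ Icc (-1 : ℝ) 1) :
    ‖tangent q s‖ = 1 := by
  have := norm_ne_zero_iff.2 (h.deriv_ne s hs)
  rw [tangent, norm_smul, norm_inv, norm_norm, inv_mul_cancel₀ this]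

theorem inner_deriv_mul_tangent (h : IsRegularArc q) {s : ℝ} (hs : s ∈ Icc (-1 : ℝ) 1) (u : ℂ) :
    inner ℝ (deriv q s) (u * tangent q s) = ‖deriv q s‖ * u.re := by
  have hn := norm_ne_zero_iff.2 (h.deriv_ne s hs)
  rw [tangent, mul_smul_comm, real_inner_smul_right, Complex.inner,
    show u * deriv q s * (starRingEnd ℂ) (deriv q s) =
      u * (deriv q s * (starRingEnd ℂ) (deriv q s)) by ring, Complex.mul_conj,
    Complex.re_mul_ofReal, Complex.normSq_eq_norm_sq]
  field_simp

theorem continuousOn_tangent (h : IsRegularArc q) : ContinuousOn (tangent q) (Icc (-1) 1) := by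
  have hd : Continuous (deriv q) := h.contDiff.continuous_deriv (by norm_num)
  exact ContinuousOn.smul (hd.norm.continuousOn.inv₀ fun s hs => norm_ne_zero_iff.2
    (h.deriv_ne s hs)) hd.continuousOn

/-- The parameters and directions that trace a loop around an arc. -/
def loopParam : Set (ℝ × ℝ) :=
  ((Icc (-1) 1 ×ˢ {Real.pi / 2} ∪ {1} ×ˢ Icc (-(Real.pi / 2)) (Real.pi / 2)) ∪
    Icc (-1) 1 ×ˢ {-(Real.pi / 2)}) ∪ {-1} ×ˢ Icc (Real.pi / 2) (3 * Real.pi / 2)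

theorem isPreconnected_loopParam : IsPreconnected loopParam := by
  have hpi := Real.pi_pos
  refine IsPreconnected.union (-1, Real.pi / 2) ?_ ?_ (IsPreconnected.union (1, -(Real.pi / 2))
    ?_ ?_ (IsPreconnected.union (1, Real.pi / 2) ?_ ?_ ?_ ?_) ?_) ?_
  · simp
  · simp; linarith
  · exact Or.inr ⟨rfl, le_rfl, by linarith⟩
  · simp
  · simp
  · simp; linarith
  · exact isPreconnected_Icc.prod isPreconnected_singleton
  · exact isPreconnected_singleton.prod isPreconnected_Icc
  · exact isPreconnected_Icc.prod isPreconnected_singleton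
  · exact isPreconnected_singleton.prod isPreconnected_Icc

theorem loopParam_fst {p : ℝ × ℝ} (hp : p ∈ loopParam) : p.1 ∈ Icc (-1 : ℝ) 1 := by
  rcases hp with ((hp | hp) | hp) | hp
  · exact hp.1
  · rw [show p.1 = 1 from hp.1]; simp
  · exact hp.1
  · rw [show p.1 = -1 from hp.1]; simp

/-- The direction at angle `α` from the tangent. -/
noncomputable def direction (q : ℝ → ℂ) (p : ℝ × ℝ) : ℂ :=
  Complex.exp (p.2 * Complex.I) * tangent q p.1

theorem norm_direction (h : IsRegularArc q) {p : ℝ × ℝ} (hp : p.1 ∈ Icc (-1 : ℝ) 1) :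
    ‖direction q p‖ = 1 := by
  rw [direction, norm_mul, Complex.norm_exp_ofReal_mul_I, h.norm_tangent hp, mul_one]

theorem isArcNormal_direction (h : IsRegularArc q) {p : ℝ × ℝ} (hp : p ∈ loopParam) :
    IsArcNormal q p.1 (direction q p) := by
  intro t ht
  rw [direction, h.inner_deriv_mul_tangent (loopParam_fst hp), Complex.exp_ofReal_mul_I_re]
  have hn := norm_nonneg (deriv q p.1)
  rcases hp with ((hp | hp) | hp) | hp
  · rw [show p.2 = Real.pi / 2 from hp.2]; simp
  · rw [show p.1 = 1 from hp.1]
    have := mul_nonneg (norm_nonneg (deriv q 1)) (Real.cos_nonneg_of_mem_Icc hp.2)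
    nlinarith [ht.2]
  · rw [show p.2 = -(Real.pi / 2) from hp.2]; simp
  · rw [show p.1 = -1 from hp.1]
    have h2 : Real.cos p.2 ≤ 0 := Real.cos_nonpos_of_pi_div_two_le_of_le hp.2.1
      (by linarith [hp.2.2])
    have := mul_nonpos_of_nonneg_of_nonpos (norm_nonneg (deriv q (-1))) h2
    nlinarith [ht.1]

/-- At an interior point t - s takes both signs, so a unit normal is ±i times the tangent. At an
endpoint the admissible directions form a closed half circle. These are the angles listed in
`loopParam`. -/
theorem exists_direction (h : IsRegularArc q) {s : ℝ} (hs : s ∈ Icc (-1 : ℝ) 1) {e : ℂ}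
    (he : ‖e‖ = 1) (hn : IsArcNormal q s e) : ∃ α, (s, α) ∈ loopParam ∧ e = direction q (s, α) := by
  have hT := h.norm_tangent hs
  have hpos := norm_pos_iff.2 (h.deriv_ne s hs)
  set u : ℂ := e * (starRingEnd ℂ) (tangent q s) with hu
  have hue : e = u * tangent q s := by
    rw [hu, mul_assoc, mul_comm ((starRingEnd ℂ) _), Complex.mul_conj, Complex.normSq_eq_norm_sq, hT]
    simp
  have hu1 : ‖u‖ = 1 := by rw [hu, norm_mul, Complex.norm_conj, he, hT, mul_one]
  have hre : ∀ t ∈ Icc (-1 : ℝ) 1, (t - s) * u.re ≤ 0 := fun t ht => by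
    have h1 := hn t ht
    rw [hue, h.inner_deriv_mul_tangent hs] at h1
    by_contra hcon
    push Not at hcon
    nlinarith [mul_pos hpos hcon]
  have hexp : ∀ v : ℂ, ‖v‖ = 1 → Complex.exp (v.arg * Complex.I) = v := fun v hv => by
    have := Complex.norm_mul_exp_arg_mul_I v
    rwa [hv, Complex.ofReal_one, one_mul] at this
  have hl := hre (-1) (by simp)
  have hr := hre 1 (by simp)
  rcases eq_or_lt_of_le hs.2 with rfl | hs1
  · refine ⟨u.arg, Or.inl (Or.inl (Or.inr ⟨rfl, ?_⟩)), ?_⟩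
    · exact abs_le.1 (Complex.abs_arg_le_pi_div_two_iff.2 (by linarith))
    · rw [direction, hexp u hu1]; exact hue
  rcases eq_or_lt_of_le hs.1 with rfl | hs2
  · refine ⟨(-u).arg + Real.pi, Or.inr ⟨rfl, ?_⟩, ?_⟩
    · have := abs_le.1 (Complex.abs_arg_le_pi_div_two_iff.2
        (show 0 ≤ (-u).re by rw [Complex.neg_re]; linarith))
      constructor <;> simp only [] <;> linarith [this.1, this.2]
    · rw [direction]
      push_cast
      rw [add_mul, Complex.exp_add, hexp (-u) (by rwa [norm_neg]), Complex.exp_pi_mul_I]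
      simpa using hue
  · have hre0 : u.re = 0 := by
      apply le_antisymm
      · exact nonpos_of_mul_nonpos_right hr (by linarith)
      · have : 0 ≤ (s + 1) * u.re := by linarith
        exact nonneg_of_mul_nonneg_right this (by linarith)
    have him : u.im = 1 ∨ u.im = -1 := by
      have h1 := Complex.sq_norm u
      rw [hu1, Complex.normSq_apply, hre0] at h1
      exact sq_eq_one_iff.1 (by linarith)
    rcases him with him | him
    · refine ⟨Real.pi / 2, Or.inl (Or.inl (Or.inl ⟨hs, rfl⟩)), ?_⟩
      have : u = Complex.I := Complex.ext (by simp [hre0]) (by simp [him])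
      rw [direction]
      push_cast
      rw [Complex.exp_pi_div_two_mul_I, ← this]
      exact hue
    · refine ⟨-(Real.pi / 2), Or.inl (Or.inr ⟨hs, rfl⟩), ?_⟩
      have : u = -Complex.I := Complex.ext (by simp [hre0]) (by simp [him])
      rw [direction]
      push_cast
      rw [neg_mul, Complex.exp_neg, Complex.exp_pi_div_two_mul_I, Complex.inv_I, ← this]
      exact hue

theorem continuousOn_direction (h : IsRegularArc q) : ContinuousOn (direction q) loopParam := by
  refine ContinuousOn.mul (by fun_prop) ?_
  exact h.continuousOn_tangent.comp continuousOn_fst fun p hp => loopParam_fst hp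

/-- The points at distance ρ along the normals form a connected loop off the arc. Every z off the
arc is joined to the loop by the straight segment along the normal through its nearest point. -/
theorem isPreconnected_compl (h : IsRegularArc q) : IsPreconnected (q '' Icc (-1) 1)ᶜ := by
  obtain ⟨ρ, hρ, htube⟩ := h.exists_tube
  have hq := h.contDiff.continuous
  have hout : ∀ r ∈ Ioc 0 ρ, ∀ s ∈ Icc (-1 : ℝ) 1, ∀ e : ℂ, ‖e‖ = 1 → IsArcNormal q s e →
      q s + r • e ∈ (q '' Icc (-1) 1)ᶜ := by
    rintro r hr s hs e he hn ⟨t, ht, hqt⟩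
    have := htube r hr s hs e he hn t ht
    rw [hqt, sub_self, norm_zero] at this
    exact this.not_gt hr.1
  set N := (fun p : ℝ × ℝ => q p.1 + ρ • direction q p) '' loopParam with hN
  have hNc : IsPreconnected N := isPreconnected_loopParam.image _
    ((hq.comp continuous_fst).continuousOn.add (h.continuousOn_direction.const_smul ρ))
  have hNsub : N ⊆ (q '' Icc (-1) 1)ᶜ := by
    rintro _ ⟨p, hp, rfl⟩
    exact hout ρ ⟨hρ, le_rfl⟩ p.1 (loopParam_fst hp) _ (h.norm_direction (loopParam_fst hp))
      (h.isArcNormal_direction hp)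
  have hx : ((1 : ℝ), Real.pi / 2) ∈ loopParam := Or.inl (Or.inl (Or.inl (by simp)))
  refine isPreconnected_of_forall (q 1 + ρ • direction q (1, Real.pi / 2)) fun z hz => ?_
  obtain ⟨s, hs, hn, hmin⟩ := h.exists_nearest z
  set d := ‖z - q s‖ with hd
  have hd0 : 0 < d := norm_pos_iff.2 (sub_ne_zero.2 fun he => hz ⟨s, hs, he.symm⟩)
  set e : ℂ := d⁻¹ • (z - q s) with he
  have he1 : ‖e‖ = 1 := by
    rw [he, norm_smul, norm_inv, Real.norm_of_nonneg hd0.le, ← hd, inv_mul_cancel₀ hd0.ne']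
  have hen : IsArcNormal q s e := fun t ht => by
    rw [he, real_inner_smul_right, mul_left_comm]
    exact mul_nonpos_of_nonneg_of_nonpos (by positivity) (hn t ht)
  have hze : z = q s + d • e := by rw [he, smul_inv_smul₀ hd0.ne']; abel
  obtain ⟨α, hα, hdir⟩ := h.exists_direction hs he1 hen
  have hy : q s + ρ • e ∈ N := ⟨(s, α), hα, by rw [hdir]⟩
  -- Up to ρ the touching disc keeps the segment off the arc. Between ρ and d, a point of the arc on
  -- the segment would be closer to z than the nearest point.
  have hseg : ∀ t ∈ uIcc d ρ, q s + t • e ∈ (q '' Icc (-1) 1)ᶜ := fun t ht => by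
    rcases mem_uIcc.1 ht with ht | ht
    · exact hout t ⟨hd0.trans_le ht.1, ht.2⟩ s hs e he1 hen
    · rintro ⟨t', ht', heq⟩
      have h1 := hmin t' ht'
      have ht0 : 0 < t := hρ.trans_le ht.1
      rw [heq, hze, add_sub_add_left_eq_sub, ← sub_smul, norm_smul, he1, mul_one, Real.norm_eq_abs,
        abs_of_nonneg (by linarith [ht.2])] at h1
      linarith
  refine ⟨N ∪ (fun t : ℝ => q s + t • e) '' uIcc d ρ, union_subset hNsub ?_, Or.inl ⟨_, hx, rfl⟩,
    Or.inr ⟨d, left_mem_uIcc, hze.symm⟩, ?_⟩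
  · rintro _ ⟨t, ht, rfl⟩; exact hseg t ht
  · refine IsPreconnected.union (q s + ρ • e) hy ⟨ρ, right_mem_uIcc, rfl⟩ hNc ?_
    exact isPreconnected_uIcc.image _ (by fun_prop)

end IsRegularArc


/-! ### Minimum principles from mean values. -/

section minimum
open Real Metric

theorem eq_on_sphere_of_circleAverage_le {f : ℂ → ℝ} {x : ℂ} {r m : ℝ} (hr : 0 < r)
    (hf : ContinuousOn f (sphere x r)) (hm : ∀ y ∈ sphere x r, m ≤ f y)
    (havg : circleAverage f x r ≤ m) : ∀ y ∈ sphere x r, f y = m := by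
  intro y hy
  by_contra hne
  have hlt : m < f y := lt_of_le_of_ne (hm y hy) (Ne.symm hne)
  have hy' := hy
  rw [← abs_of_pos hr, ← image_circleMap_Ioc] at hy'
  obtain ⟨θ, hθ, rfl⟩ := hy'
  have hmem : ∀ θ, circleMap x r θ ∈ sphere x r := circleMap_mem_sphere x hr.le
  have hcont : Continuous fun θ => f (circleMap x r θ) :=
    hf.comp_continuous (continuous_circleMap x r) hmem
  have hpos : 0 < ∫ θ in (0 : ℝ)..(2 * π), (f (circleMap x r θ) - m) :=
    intervalIntegral.integral_pos (by positivity) (hcont.sub continuous_const).continuousOn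
      (fun θ _ => sub_nonneg.2 (hm _ (hmem θ))) ⟨θ, Ioc_subset_Icc_self hθ, sub_pos.2 hlt⟩
  rw [intervalIntegral.integral_sub (hcont.intervalIntegrable _ _) intervalIntegrable_const,
    intervalIntegral.integral_const, sub_zero, smul_eq_mul] at hpos
  rw [circleAverage, smul_eq_mul, inv_mul_le_iff₀ (by positivity)] at havg
  linarith

/-- The minimum principle for functions with a local mean value property. -/
theorem le_of_circleAverage_eq {A O : Set ℂ} (hA : IsCompact A) {f : ℂ → ℝ}
    (hf : ContinuousOn f A) {m : ℝ}
    (hO : ∀ x ∈ O, ∃ r > 0, closedBall x r ⊆ A ∧ circleAverage f x r = f x)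
    (hm : ∀ x ∈ A \ O, m ≤ f x) : ∀ x ∈ A, m ≤ f x := by
  intro x hx
  obtain ⟨x₀, hx₀, hmin⟩ := hA.exists_isMinOn ⟨x, hx⟩ hf
  refine le_trans ?_ (hmin hx)
  by_contra hlt
  push Not at hlt
  have hK : IsCompact (A ∩ f ⁻¹' {f x₀}) :=
    hA.of_isClosed_subset (hf.preimage_isClosed_of_isClosed hA.isClosed isClosed_singleton)
      inter_subset_left
  -- Among the minimizers choose one with the largest real part. The minimum propagates to the
  -- circle around it, whose rightmost point has larger real part, so no connectedness is required.
  obtain ⟨y, hy, hmax⟩ := hK.exists_isMaxOn ⟨x₀, hx₀, rfl⟩ Complex.continuous_re.continuousOn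
  have hyO : y ∈ O := by
    by_contra hyO
    have h1 := hm y ⟨hy.1, hyO⟩
    rw [show f y = f x₀ from hy.2] at h1
    exact h1.not_gt hlt
  obtain ⟨r, hr, hball, havg⟩ := hO y hyO
  have hsub := sphere_subset_closedBall.trans hball
  have hs : y + r ∈ sphere y r := by
    rw [mem_sphere_iff_norm, add_sub_cancel_left, Complex.norm_real, norm_of_nonneg hr.le]
  have h2 := eq_on_sphere_of_circleAverage_le hr (hf.mono hsub) (fun z hz => hmin (hsub hz))
    (havg.trans hy.2).le (y + r) hs
  have h3 : (y + r : ℂ).re ≤ y.re := hmax ⟨hsub hs, h2⟩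
  rw [Complex.add_re, Complex.ofReal_re] at h3
  linarith

/-- The strong minimum principle for functions with a local mean value property. -/
theorem eq_zero_of_circleAverage_eq {Ω : Set ℂ} (hΩ : IsOpen Ω) (hc : IsPreconnected Ω) {f : ℂ → ℝ}
    (hf : Continuous f) (havg : ∀ x r, 0 < r → closedBall x r ⊆ Ω → circleAverage f x r = f x)
    (hpos : ∀ x, 0 ≤ f x) {x₀ : ℂ} (hx₀ : x₀ ∈ Ω) (h0 : f x₀ = 0) : ∀ x ∈ Ω, f x = 0 := by
  have hsub : Ω ⊆ Ω ∩ f ⁻¹' {0} := by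
    refine hc.subset_of_closure_inter_subset ?_ ⟨x₀, hx₀, hx₀, h0⟩ ?_
    · rw [Metric.isOpen_iff]
      rintro x ⟨hx, hx0⟩
      obtain ⟨ε, hε, hball⟩ := Metric.isOpen_iff.1 hΩ x hx
      refine ⟨ε, hε, fun y hy => ⟨hball hy, ?_⟩⟩
      rcases eq_or_ne y x with rfl | hne
      · exact hx0
      · have hd := dist_pos.2 hne
        have hx0' : f x = 0 := hx0
        refine eq_on_sphere_of_circleAverage_le hd hf.continuousOn (fun z _ => hpos z) ?_ y rfl
        rw [havg x _ hd ((closedBall_subset_ball hy).trans hball), hx0']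
    · rintro x ⟨hx, hxΩ⟩
      refine ⟨hxΩ, ?_⟩
      have h1 : closure (Ω ∩ f ⁻¹' {0}) ⊆ f ⁻¹' {0} :=
        closure_minimal inter_subset_right (isClosed_singleton.preimage hf)
      exact h1 hx
  exact fun x hx => (hsub hx).2

end minimum

/-! ### The Green function and nonnegativity of the density. -/

/-- The difference of cosines is a product of two half-angle sines, and Jordan's inequality bounds
each below by |x - y|/π. A quadratic bound is what survives at the endpoints, where cos has zero
derivative. -/
theorem sq_le_abs_cos_sub_cos {x y : ℝ} (hx : x ∈ Icc 0 Real.pi) (hy : y ∈ Icc 0 Real.pi) :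
    2 / Real.pi ^ 2 * (y - x) ^ 2 ≤ |Real.cos x - Real.cos y| := by
  have hpi := Real.pi_pos
  have h1 : |x - y| / Real.pi ≤ |Real.sin ((x + y) / 2)| := by
    have habs : |x - y| ≤ x + y ∧ |x - y| ≤ 2 * Real.pi - (x + y) := by
      constructor <;> rw [abs_le] <;> constructor <;> linarith [hx.1, hx.2, hy.1, hy.2]
    refine le_trans ?_ (le_abs_self _)
    rcases le_total ((x + y) / 2) (Real.pi / 2) with h | h
    · refine le_trans ?_ (Real.mul_le_sin (by linarith [hx.1, hy.1]) h)
      rw [div_mul_div_comm, mul_comm (2 : ℝ), mul_div_mul_right _ _ two_ne_zero]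
      gcongr
      exact habs.1
    · rw [← Real.sin_pi_sub]
      refine le_trans ?_ (Real.mul_le_sin (by linarith [hx.2, hy.2]) (by linarith))
      rw [div_mul_eq_mul_div]
      gcongr
      linarith [habs.2]
  have h2 : |x - y| / Real.pi ≤ |Real.sin ((x - y) / 2)| := by
    have h3 : |Real.sin ((x - y) / 2)| = |Real.sin (|x - y| / 2)| := by
      rcases abs_cases (x - y) with ⟨h, -⟩ | ⟨h, -⟩
      · rw [h]
      · rw [h, neg_div, Real.sin_neg, abs_neg]
    rw [h3]
    refine le_trans ?_ (le_abs_self _)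
    have h4 : |x - y| ≤ Real.pi := by
      rw [abs_le]; constructor <;> linarith [hx.1, hx.2, hy.1, hy.2]
    refine le_trans (le_of_eq ?_) (Real.mul_le_sin (by positivity) (by linarith))
    field_simp
  rw [Real.cos_sub_cos, abs_mul, abs_mul, abs_neg, abs_two]
  calc 2 / Real.pi ^ 2 * (y - x) ^ 2 = 2 * (|x - y| / Real.pi) * (|x - y| / Real.pi) := by
        rw [mul_assoc, ← sq, div_pow, sq_abs]; ring
    _ ≤ _ := by gcongr

namespace IsRegularArc
open Real Metric
variable {q : ℝ → ℂ}

theorem cos_mem (x : ℝ) : cos x ∈ Icc (-1 : ℝ) 1 := ⟨neg_one_le_cos x, cos_le_one x⟩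

theorem exists_isSeparatedCurve (h : IsRegularArc q) :
    ∃ c, IsSeparatedCurve (fun φ => q (cos φ)) c := by
  obtain ⟨m, hm, hle⟩ := h.exists_le_norm_sub
  have hq := h.contDiff.continuous
  refine ⟨m * (2 / π ^ 2), by fun_prop, by positivity, fun x hx y hy => ?_⟩
  refine le_trans ?_ (hle _ (cos_mem x) _ (cos_mem y))
  rw [mul_assoc]
  exact mul_le_mul_of_nonneg_left (sq_le_abs_cos_sub_cos hx hy) hm.le

end IsRegularArc

/-- A density on a regular arc whose potential is constant on the arc. -/
structure IsEquilibriumDensity (q : ℝ → ℂ) (w : ℝ → ℝ) (V : ℝ) : Prop where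
  arc : IsRegularArc q
  contDiff : ContDiff ℝ 2 w
  even : ∀ x, w (-x) = w x
  periodic : ∀ x, w (x + 2 * Real.pi) = w x
  integral : ∫ x, w x ∂angleMeasure = Real.pi
  potential : ∀ x ∈ Icc 0 Real.pi,
    logPotential (fun φ => q (Real.cos φ)) w (q (Real.cos x)) = V

namespace IsEquilibriumDensity
open Real Metric IsRegularArc
variable {q : ℝ → ℂ} {w : ℝ → ℝ} {V : ℝ}

/-- The Green function of the complement of the arc, up to a factor. -/
noncomputable def green (q : ℝ → ℂ) (w : ℝ → ℝ) (V : ℝ) (z : ℂ) : ℝ :=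
  logPotential (fun φ => q (cos φ)) w z - V

theorem continuous_green (h : IsEquilibriumDensity q w V) : Continuous (green q w V) := by
  obtain ⟨c, hc⟩ := h.arc.exists_isSeparatedCurve
  exact (hc.continuous_logPotential h.contDiff.continuous).sub continuous_const

theorem circleAverage_green (h : IsEquilibriumDensity q w V) (z : ℂ) {r : ℝ} (hr : 0 < r) :
    circleAverage (green q w V) z r =
      green q w V z + ∫ φ, log⁺ (r / ‖z - q (cos φ)‖) * w φ ∂angleMeasure := by
  obtain ⟨c, hc⟩ := h.arc.exists_isSeparatedCurve
  have hcont := hc.continuous_logPotential h.contDiff.continuous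
  unfold green
  rw [circleAverage_fun_sub (hcont.continuousOn.circleIntegrable hr.le)
    (circleIntegrable_const _ _ _), circleAverage_const,
    hc.circleAverage_logPotential h.contDiff.continuous z hr]
  ring

theorem circleAverage_green_of_subset (h : IsEquilibriumDensity q w V) {z : ℂ} {r : ℝ} (hr : 0 < r)
    (hsub : closedBall z r ⊆ (q '' Icc (-1) 1)ᶜ) :
    circleAverage (green q w V) z r = green q w V z := by
  rw [h.circleAverage_green z hr]
  have h1 : ∀ φ, log⁺ (r / ‖z - q (cos φ)‖) * w φ = 0 := fun φ => by
    have h2 : q (cos φ) ∉ closedBall z r := fun hmem => hsub hmem ⟨_, cos_mem φ, rfl⟩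
    rw [mem_closedBall_iff_norm', not_le] at h2
    rw [(posLog_eq_zero_iff _).2, zero_mul]
    rw [abs_of_nonneg (by positivity), div_le_one (by linarith)]
    exact h2.le
  simp [h1]

theorem green_arc (h : IsEquilibriumDensity q w V) {s : ℝ} (hs : s ∈ Icc (-1 : ℝ) 1) :
    green q w V (q s) = 0 := by
  have h1 := h.potential (arccos s) ⟨arccos_nonneg s, arccos_le_pi s⟩
  rw [cos_arccos hs.1 hs.2] at h1
  rw [green, h1, sub_self]

theorem exists_green_pos (h : IsEquilibriumDensity q w V) :
    ∃ R, ∀ z, R ≤ ‖z‖ → 0 < green q w V z := by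
  obtain ⟨c, hc⟩ := h.arc.exists_isSeparatedCurve
  obtain ⟨R, hR⟩ := hc.exists_lt_logPotential h.contDiff.continuous
    (by rw [h.integral]; exact pi_pos) V
  exact ⟨R, fun z hz => sub_pos.2 (hR z hz)⟩

theorem isOpen_compl (h : IsEquilibriumDensity q w V) : IsOpen (q '' Icc (-1) 1)ᶜ :=
  (isCompact_Icc.image h.arc.contDiff.continuous).isClosed.isOpen_compl

/-- The minimum principle on a large disc: the function is zero on the arc, positive far away, and
has the mean value property in between. -/
theorem green_nonneg (h : IsEquilibriumDensity q w V) (z : ℂ) : 0 ≤ green q w V z := by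
  obtain ⟨R, hR⟩ := h.exists_green_pos
  rcases le_or_gt R ‖z‖ with hz | hz
  · exact (hR z hz).le
  refine le_of_circleAverage_eq (isCompact_closedBall (0 : ℂ) R) (O := ball 0 R ∩ (q '' Icc (-1) 1)ᶜ)
    h.continuous_green.continuousOn (fun x hx => ?_) (fun x hx => ?_) z (by simpa using hz.le)
  · obtain ⟨r, hr, hsub⟩ := nhds_basis_closedBall.mem_iff.1
      ((isOpen_ball.inter h.isOpen_compl).mem_nhds hx)
    exact ⟨r, hr, (hsub.trans inter_subset_left).trans ball_subset_closedBall,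
      h.circleAverage_green_of_subset hr (hsub.trans inter_subset_right)⟩
  · by_cases hb : x ∈ ball 0 R
    · have : x ∈ q '' Icc (-1) 1 := by
        by_contra hcon
        exact hx.2 ⟨hb, hcon⟩
      obtain ⟨s, hs, rfl⟩ := this
      exact (h.green_arc hs).ge
    · exact (hR x (by simpa using hb)).le

/-- An interior zero would spread over the connected complement, contradicting positivity far away.
-/
theorem green_pos (h : IsEquilibriumDensity q w V) {z : ℂ} (hz : z ∉ q '' Icc (-1) 1) :
    0 < green q w V z := by
  refine lt_of_le_of_ne (h.green_nonneg z) fun h0 => ?_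
  have h1 := eq_zero_of_circleAverage_eq h.isOpen_compl h.arc.isPreconnected_compl
    h.continuous_green (fun x r hr hsub => h.circleAverage_green_of_subset hr hsub)
    h.green_nonneg (x₀ := z) hz h0.symm
  obtain ⟨R, hR⟩ := h.exists_green_pos
  have hpos := hR (|R| : ℝ) (by rw [Complex.norm_real, norm_of_nonneg (abs_nonneg _)]
                                exact le_abs_self R)
  have hout : ((|R| : ℝ) : ℂ) ∉ q '' Icc (-1) 1 := by
    rintro ⟨s, hs, he⟩
    rw [← he, h.green_arc hs] at hpos
    exact lt_irrefl _ hpos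
  exact hpos.ne' (h1 _ hout)

theorem normal_mem {s : ℝ} (hs : s ∈ Icc (-1 : ℝ) 1) : (s, π / 2) ∈ loopParam :=
  Or.inl (Or.inl (Or.inl ⟨hs, rfl⟩))

/-- If w < 0 near x, the mean value defect at q(cos x) is nonpositive. Since the Green function is
nonnegative and zero at the centre, it would vanish on a whole small circle, but the circle leaves
the arc along the normal. -/
theorem nonneg (h : IsEquilibriumDensity q w V) {x : ℝ} (hx : x ∈ Icc 0 π) : 0 ≤ w x := by
  by_contra hneg
  push Not at hneg
  obtain ⟨c, hc⟩ := h.arc.exists_isSeparatedCurve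
  have hcp := hc.pos
  obtain ⟨ρ, hρ, htube⟩ := h.arc.exists_tube
  have hev : ∀ᶠ φ in nhds x, w φ < 0 := h.contDiff.continuous.continuousAt.eventually_lt_const hneg
  obtain ⟨η, hη, hball⟩ := Metric.eventually_nhds_iff.1 hev
  -- Parameters at distance at least η from x lie outside the circle of radius cη², so only those
  -- with w < 0 contribute to the defect.
  set r := min ρ (c * η ^ 2) with hr
  have hr0 : 0 < r := lt_min hρ (by positivity)
  have havg : circleAverage (green q w V) (q (cos x)) r ≤ 0 := by
    rw [h.circleAverage_green _ hr0, h.green_arc (cos_mem x), zero_add]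
    refine integral_nonpos_of_ae ?_
    filter_upwards [ae_angleMeasure_mem] with φ hφ
    by_cases hd : |φ - x| < η
    · exact mul_nonpos_of_nonneg_of_nonpos posLog_nonneg (hball hd).le
    · have h1 : r ≤ ‖q (cos x) - q (cos φ)‖ := by
        refine (min_le_right _ _).trans (le_trans ?_ (hc.le_norm x hx φ hφ))
        rw [← sq_abs (φ - x)]
        push Not at hd
        gcongr
      have h2 : log⁺ (r / ‖q (cos x) - q (cos φ)‖) = 0 := by
        rw [posLog_eq_zero_iff, abs_of_nonneg (by positivity), div_le_one (by linarith)]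
        exact h1
      simp [h2]
  set e := direction q (cos x, π / 2) with he
  have he1 : ‖e‖ = 1 := h.arc.norm_direction (cos_mem x)
  have hs : q (cos x) + r • e ∈ sphere (q (cos x)) r := by
    rw [mem_sphere_iff_norm, add_sub_cancel_left, norm_smul, he1, mul_one, norm_of_nonneg hr0.le]
  have h0 := eq_on_sphere_of_circleAverage_le hr0 h.continuous_green.continuousOn
    (fun y _ => h.green_nonneg y) havg _ hs
  refine (h.green_pos ?_).ne' h0
  rintro ⟨t, ht, hqt⟩
  have h3 := htube r ⟨hr0, min_le_left _ _⟩ (cos x) (cos_mem x) e he1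
    (h.arc.isArcNormal_direction (normal_mem (cos_mem x))) t ht
  rw [hqt, sub_self, norm_zero] at h3
  exact h3.not_gt hr0

end IsEquilibriumDensity


/-! ### Strict positivity of the density by a Hopf-type comparison. -/

namespace IsEquilibriumDensity
open Real Metric IsRegularArc
variable {q : ℝ → ℂ} {w : ℝ → ℝ} {V : ℝ}

/-- Comparison with a multiple of the Green function of a disc that touches the arc. -/
theorem exists_hopf (h : IsEquilibriumDensity q w V) {c₀ : ℂ} {ρ : ℝ} (hρ : 0 < ρ)
    (hc₀ : ∀ t ∈ Icc (-1 : ℝ) 1, ρ ≤ ‖q t - c₀‖) :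
    ∃ k > 0, ∀ y, ρ / 2 ≤ ‖y - c₀‖ → k * (1 - ‖y - c₀‖ ^ 2 / ρ ^ 2) ≤ green q w V y := by
  have hball : ∀ y, ‖y - c₀‖ < ρ → y ∉ q '' Icc (-1) 1 := by
    rintro _ hy ⟨t, ht, rfl⟩
    exact (hc₀ t ht).not_gt hy
  obtain ⟨y₀, hy₀, hmin⟩ := (isCompact_closedBall c₀ (ρ / 2)).exists_isMinOn
    ⟨c₀, mem_closedBall_self (by positivity)⟩ h.continuous_green.continuousOn
  have hm : 0 < green q w V y₀ := h.green_pos (hball _ (by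
    rw [mem_closedBall_iff_norm] at hy₀; linarith))
  set m := green q w V y₀ with hmdef
  have hlog2 : 0 < log 2 := log_pos one_lt_two
  set k := m / log 2 with hk
  have hk0 : 0 < k := by positivity
  set f : ℂ → ℝ := fun y => green q w V y + k * (log ‖y - c₀‖ - log ρ) with hf
  have hA : IsCompact (closedBall c₀ ρ ∩ {y | ρ / 2 ≤ ‖y - c₀‖}) :=
    (isCompact_closedBall c₀ ρ).inter_right (isClosed_le continuous_const (by fun_prop))
  have hf0 : ∀ y ∈ closedBall c₀ ρ ∩ {y | ρ / 2 ≤ ‖y - c₀‖}, 0 ≤ f y := by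
    refine le_of_circleAverage_eq hA (O := {y | ‖y - c₀‖ < ρ} ∩ {y | ρ / 2 < ‖y - c₀‖}) ?_ ?_ ?_
    · refine h.continuous_green.continuousOn.add (continuousOn_const.mul (ContinuousOn.sub
        (ContinuousOn.log (by fun_prop) fun y hy => ?_) continuousOn_const))
      have : ρ / 2 ≤ ‖y - c₀‖ := hy.2
      exact (by linarith : 0 < ‖y - c₀‖).ne'
    · intro x hx
      have hopen : IsOpen ({y | ‖y - c₀‖ < ρ} ∩ {y | ρ / 2 < ‖y - c₀‖}) :=
        (isOpen_lt (by fun_prop) continuous_const).inter (isOpen_lt continuous_const (by fun_prop))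
      obtain ⟨r, hr, hsub⟩ := nhds_basis_closedBall.mem_iff.1 (hopen.mem_nhds hx)
      refine ⟨r, hr, fun y hy => ⟨?_, mem_ofPred.2 (mem_ofPred.1 (hsub hy).2).le⟩, ?_⟩
      · rw [mem_closedBall_iff_norm]; exact (hsub hy).1.le
      · have h1 : circleAverage (green q w V) x r = green q w V x :=
          h.circleAverage_green_of_subset hr fun y hy => hball y (hsub hy).1
        have hrx : r < ‖x - c₀‖ := by
          by_contra hcon
          push Not at hcon
          have : c₀ ∈ closedBall x r := by rwa [mem_closedBall_iff_norm']
          have h2 : ρ / 2 < ‖c₀ - c₀‖ := (hsub this).2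
          rw [sub_self, norm_zero] at h2
          linarith
        have h2 : circleAverage (fun y => log ‖y - c₀‖ - log ρ) x r = log ‖x - c₀‖ - log ρ := by
          rw [circleAverage_fun_sub (circleIntegrable_log_norm_sub_const r)
            (circleIntegrable_const _ _ _), circleAverage_const,
            circleAverage_log_norm_sub_const_eq_log_radius_add_posLog hr.ne', posLog_eq_log,
            log_mul (inv_ne_zero hr.ne') (by linarith), log_inv]
          · ring
          · rw [abs_of_nonneg (by positivity), inv_mul_eq_div, one_le_div hr]
            exact hrx.le
        have hi : CircleIntegrable (fun y => k • (log ‖y - c₀‖ - log ρ)) x r :=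
          ((circleIntegrable_log_norm_sub_const (a := c₀) (c := x) r).sub
            (circleIntegrable_const (log ρ) x r)).const_smul
        have h3 : f = fun y => green q w V y + k • (log ‖y - c₀‖ - log ρ) := rfl
        rw [h3, circleAverage_fun_add (h.continuous_green.continuousOn.circleIntegrable hr.le)
          hi, circleAverage_fun_smul, h1, h2]
    · rintro x ⟨⟨hx1, hx2⟩, hxO⟩
      rw [mem_closedBall_iff_norm] at hx1
      rcases eq_or_lt_of_le hx1 with he | hlt
      · rw [hf]; simp only [he, sub_self, mul_zero, add_zero]; exact h.green_nonneg x
      · have he : ‖x - c₀‖ = ρ / 2 := by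
          refine le_antisymm ?_ hx2
          by_contra hcon
          push Not at hcon
          exact hxO ⟨hlt, hcon⟩
        have h1 : m ≤ green q w V x := hmin (by rw [mem_closedBall_iff_norm, he])
        rw [hf]
        simp only [he]
        rw [log_div hρ.ne' two_ne_zero, hk]
        have : m / log 2 * (log ρ - log 2 - log ρ) = -m := by field_simp; ring
        rw [this]
        linarith
  -- The factor 1/2 comes from log|y - c₀| being half the logarithm of the square, combined with log
  -- s ≤ s - 1. Outside the disc the asserted lower bound is nonpositive.
  refine ⟨k / 2, by positivity, fun y hy => ?_⟩
  rcases le_or_gt ‖y - c₀‖ ρ with hle | hgt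
  · have h1 := hf0 y ⟨by rwa [mem_closedBall_iff_norm], hy⟩
    have hy0 : 0 < ‖y - c₀‖ := by linarith
    have h2 := log_le_sub_one_of_pos (show 0 < ‖y - c₀‖ ^ 2 / ρ ^ 2 by positivity)
    rw [log_div (by positivity) (by positivity), log_pow, log_pow] at h2
    push_cast at h2
    simp only [hf] at h1
    nlinarith
  · have h1 : 1 ≤ ‖y - c₀‖ ^ 2 / ρ ^ 2 := by
      rw [one_le_div (by positivity)]; gcongr
    have h2 : k / 2 * (1 - ‖y - c₀‖ ^ 2 / ρ ^ 2) ≤ 0 :=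
      mul_nonpos_of_nonneg_of_nonpos (by positivity) (by linarith)
    exact h2.trans (h.green_nonneg y)

/-- On a circle around the touching point the disc gives a lower bound linear in r in the direction
of its centre, hence a circle average of order r. -/
theorem le_circleAverage_of_hopf {f : ℂ → ℝ} (hf : Continuous f) (hpos : ∀ y, 0 ≤ f y) {z e : ℂ}
    (he : ‖e‖ = 1) {ρ k r : ℝ} (hρ : 0 < ρ) (hr : 0 < r) (hrρ : r ≤ ρ / 2)
    (hk : ∀ y, ρ / 2 ≤ ‖y - (z + ρ • e)‖ → k * (1 - ‖y - (z + ρ • e)‖ ^ 2 / ρ ^ 2) ≤ f y) :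
    k / (2 * ρ ^ 2) * (r * ρ - r ^ 2) ≤ circleAverage f z r := by
  rw [circleAverage_eq_integral_add e.arg, smul_eq_mul, le_inv_mul_iff₀ (by positivity)]
  have hexp : e = Complex.exp (e.arg * Complex.I) := by
    have := Complex.norm_mul_exp_arg_mul_I e
    rw [he, Complex.ofReal_one, one_mul] at this
    exact this.symm
  have hnorm : ∀ θ, ‖circleMap z r (θ + e.arg) - (z + ρ • e)‖ ^ 2 =
      r ^ 2 - 2 * r * ρ * cos θ + ρ ^ 2 := fun θ => by
    have h1 : circleMap z r (θ + e.arg) - (z + ρ • e) = (r * Complex.exp (θ * Complex.I) - ρ) * e := by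
      rw [circleMap]
      push_cast
      rw [add_mul, Complex.exp_add, ← hexp, Complex.real_smul]
      ring
    rw [h1, norm_mul, he, mul_one, Complex.sq_norm, Complex.normSq_apply]
    simp only [Complex.sub_re, Complex.sub_im, Complex.re_ofReal_mul, Complex.im_ofReal_mul,
      Complex.exp_ofReal_mul_I_re, Complex.exp_ofReal_mul_I_im, Complex.ofReal_re, Complex.ofReal_im]
    nlinarith [sin_sq_add_cos_sq θ]
  -- The lower bound is negative on part of the circle and its plain average is too. Since f ≥ 0, it
  -- may be multiplied by the weight (1 + cos θ)/2 ∈ [0, 1], after which the average is positive of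
  -- order r.
  have hle : ∀ θ, k / ρ ^ 2 * (2 * r * ρ * cos θ - r ^ 2) * ((1 + cos θ) / 2) ≤
      f (circleMap z r (θ + e.arg)) := fun θ => by
    have h1 := hnorm θ
    have h2 : ρ / 2 ≤ ‖circleMap z r (θ + e.arg) - (z + ρ • e)‖ := by
      refine le_of_sq_le_sq ?_ (norm_nonneg _)
      rw [h1]
      nlinarith [cos_le_one θ, mul_pos hr hρ]
    have h3 := hk _ h2
    rw [h1] at h3
    have h4 : k * (1 - (r ^ 2 - 2 * r * ρ * cos θ + ρ ^ 2) / ρ ^ 2) =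
        k / ρ ^ 2 * (2 * r * ρ * cos θ - r ^ 2) := by field_simp; ring
    rw [h4] at h3
    have h5 := hpos (circleMap z r (θ + e.arg))
    have h6 : 0 ≤ (1 + cos θ) / 2 := by linarith [neg_one_le_cos θ]
    have h7 : (1 + cos θ) / 2 ≤ 1 := by linarith [cos_le_one θ]
    exact (mul_le_mul_of_nonneg_right h3 h6).trans (mul_le_of_le_one_right h5 h7)
  have hint : ∫ θ in (0 : ℝ)..(2 * π),
      k / ρ ^ 2 * (2 * r * ρ * cos θ - r ^ 2) * ((1 + cos θ) / 2) =
      2 * π * (k / (2 * ρ ^ 2) * (r * ρ - r ^ 2)) := by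
    have e1 : ∀ θ, k / ρ ^ 2 * (2 * r * ρ * cos θ - r ^ 2) * ((1 + cos θ) / 2) =
        k / ρ ^ 2 * (r * ρ - r ^ 2 / 2) * cos θ + k / ρ ^ 2 * (r * ρ) * cos θ ^ 2 -
          k / ρ ^ 2 * (r ^ 2 / 2) := fun θ => by ring
    simp_rw [e1]
    rw [intervalIntegral.integral_sub (Continuous.intervalIntegrable (by fun_prop) _ _)
      intervalIntegrable_const, intervalIntegral.integral_add
      (Continuous.intervalIntegrable (by fun_prop) _ _)
      (Continuous.intervalIntegrable (by fun_prop) _ _), intervalIntegral.integral_const_mul,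
      intervalIntegral.integral_const_mul, integral_cos, integral_cos_sq,
      intervalIntegral.integral_const]
    simp
    field_simp
  rw [← hint]
  refine intervalIntegral.integral_mono_on (by positivity)
    (Continuous.intervalIntegrable (by fun_prop) _ _) (Continuous.intervalIntegrable ?_ _ _)
    fun θ _ => hle θ
  exact hf.comp ((continuous_circleMap z r).comp (by fun_prop))

/-- The even periodic extension of w is nonnegative, so a zero is a local minimum also at x = 0 and
x = π. -/
theorem deriv_eq_zero (h : IsEquilibriumDensity q w V) {x : ℝ} (hx : x ∈ Icc 0 π) (h0 : w x = 0) :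
    deriv w x = 0 := by
  have hmin : IsLocalMin w x := by
    have hpi := pi_pos
    filter_upwards [Ioo_mem_nhds (a := -π) (b := 2 * π) (by linarith [hx.1])
      (by linarith [hx.2])] with y hy
    rw [h0]
    rcases le_or_gt 0 y with hy0 | hy0
    · rcases le_or_gt y π with hyp | hyp
      · exact h.nonneg ⟨hy0, hyp⟩
      · rw [← h.even, ← h.periodic]
        exact h.nonneg ⟨by linarith [hy.2], by linarith⟩
    · rw [← h.even]
      exact h.nonneg ⟨by linarith, by linarith [hy.1]⟩
  exact hmin.deriv_eq_zero

/-- At a zero w is at most M(φ - x)², which the chord t controls: w ≤ (M/c)t. Since log⁺(r/t) ≤ r/t,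
the integrand is at most (M/c)r and lives on |φ - x| ≤ √(r/c). The average is therefore O(r^{3/2}),
too small for the linear lower bound. -/
theorem exists_circleAverage_le (h : IsEquilibriumDensity q w V) {x : ℝ} (hx : x ∈ Icc 0 π)
    (h0 : w x = 0) : ∃ c > 0, ∃ M > 0, ∀ r > 0,
      circleAverage (green q w V) (q (cos x)) r ≤ M * r * (2 * sqrt (r / c)) := by
  obtain ⟨c, hc⟩ := h.arc.exists_isSeparatedCurve
  have hcp := hc.pos
  obtain ⟨M, hM, hT⟩ := exists_taylor_bound h.contDiff 0 π
  refine ⟨c, hcp, M / c, by positivity, fun r hr => ?_⟩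
  set d := sqrt (r / c) with hd
  have hw : ∀ φ ∈ Icc 0 π, w φ ≤ M * (φ - x) ^ 2 := fun φ hφ => by
    have h1 := hT φ hφ x hx
    rw [h.deriv_eq_zero hx h0, h0, smul_zero, sub_zero, sub_zero] at h1
    exact (le_abs_self _).trans h1
  rw [h.circleAverage_green _ hr, h.green_arc (cos_mem x), zero_add]
  have hle : ∀ᵐ φ ∂angleMeasure, log⁺ (r / ‖q (cos x) - q (cos φ)‖) * w φ ≤
      (Icc (x - d) (x + d)).indicator (fun _ => M / c * r) φ := by
    filter_upwards [ae_angleMeasure_mem] with φ hφ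
    set t := ‖q (cos x) - q (cos φ)‖ with ht
    have ht1 : c * (φ - x) ^ 2 ≤ t := hc.le_norm x hx φ hφ
    rcases le_or_gt r t with hrt | hrt
    · have h2 : log⁺ (r / t) = 0 := by
        rw [posLog_eq_zero_iff, abs_of_nonneg (by positivity), div_le_one (by linarith)]
        exact hrt
      rw [h2, zero_mul]
      exact indicator_nonneg (fun _ _ => by positivity) _
    · have hmem : φ ∈ Icc (x - d) (x + d) := by
        have h3 : |φ - x| ≤ d := by
          refine abs_le_of_sq_le_sq' ?_ (sqrt_nonneg _) |> abs_le.2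
          rw [sq_sqrt (by positivity), le_div_iff₀ hcp]
          linarith
        rw [abs_le] at h3
        constructor <;> linarith [h3.1, h3.2]
      rw [indicator_of_mem hmem]
      rcases eq_or_lt_of_le (show 0 ≤ t from norm_nonneg _) with h0' | htpos
      · rw [← h0', div_zero, posLog_zero, zero_mul]; positivity
      · have h4 : log⁺ (r / t) ≤ r / t := by
          rw [posLog_apply]
          exact max_le (by positivity) ((log_le_sub_one_of_pos (by positivity)).trans (by linarith))
        have h5 : w φ ≤ M / c * t := by
          refine (hw φ hφ).trans ?_
          rw [div_mul_eq_mul_div, le_div_iff₀ hcp]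
          nlinarith
        calc log⁺ (r / t) * w φ ≤ r / t * (M / c * t) :=
              mul_le_mul h4 h5 (h.nonneg hφ) (by positivity)
          _ = M / c * r := by field_simp
  refine (integral_mono_ae ?_ ((integrable_const _).indicator measurableSet_Icc) hle).trans ?_
  · exact hc.integrable_posLog_mul h.contDiff.continuous (q (cos x)) hr.le
  · rw [integral_indicator_const _ measurableSet_Icc, smul_eq_mul, mul_comm]
    refine mul_le_mul_of_nonneg_left ?_ (by positivity)
    have h6 : angleMeasure.real (Icc (x - d) (x + d)) ≤ volume.real (Icc (x - d) (x + d)) := by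
      refine ENNReal.toReal_mono (by simp) ?_
      exact Measure.restrict_le_self _
    refine h6.trans ?_
    rw [Real.volume_real_Icc_of_le (by linarith [sqrt_nonneg (r / c)])]
    linarith

/-- The equilibrium density is positive. -/
theorem pos (h : IsEquilibriumDensity q w V) {x : ℝ} (hx : x ∈ Icc 0 π) : 0 < w x := by
  refine lt_of_le_of_ne (h.nonneg hx) fun h0 => ?_
  obtain ⟨c, hc, M, hM, hupper⟩ := h.exists_circleAverage_le hx h0.symm
  obtain ⟨ρ, hρ, htube⟩ := h.arc.exists_tube
  have he1 : ‖direction q (cos x, π / 2)‖ = 1 := h.arc.norm_direction (cos_mem x)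
  obtain ⟨k, hk, hhopf⟩ := h.exists_hopf hρ (htube ρ ⟨hρ, le_rfl⟩ (cos x) (cos_mem x) _ he1
    (h.arc.isArcNormal_direction (normal_mem (cos_mem x))))
  -- Chosen so that, once √(r/c) ≤ X, the upper bound is at most kr/(8ρ), half of the lower bound
  -- kr/(4ρ).
  set X := k / (16 * ρ * M) with hX
  have hX0 : 0 < X := by positivity
  set r := min (ρ / 2) (c * X ^ 2) with hr
  have hr0 : 0 < r := lt_min (by positivity) (by positivity)
  have h1 := le_circleAverage_of_hopf h.continuous_green h.green_nonneg he1 hρ hr0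
    (min_le_left _ _) hhopf
  have h2 := h1.trans (hupper r hr0)
  have h3 : sqrt (r / c) ≤ X := by
    rw [sqrt_le_left hX0.le, div_le_iff₀ hc, mul_comm]
    exact min_le_right _ _
  have hrρ : r ≤ ρ / 2 := min_le_left _ _
  have h4 : k / (4 * ρ) * r ≤ k / (2 * ρ ^ 2) * (r * ρ - r ^ 2) := by
    have : r * ρ / 2 ≤ r * ρ - r ^ 2 := by nlinarith
    calc k / (4 * ρ) * r = k / (2 * ρ ^ 2) * (r * ρ / 2) := by field_simp; ring
      _ ≤ _ := by gcongr
  have h5 : M * r * (2 * sqrt (r / c)) ≤ k / (8 * ρ) * r := by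
    calc M * r * (2 * sqrt (r / c)) ≤ M * r * (2 * X) := by gcongr
      _ = k / (8 * ρ) * r := by rw [hX]; field_simp; ring
  have h6 : 0 < k / (8 * ρ) * r := by positivity
  have h7 : k / (4 * ρ) * r = 2 * (k / (8 * ρ) * r) := by field_simp; ring
  linarith

end IsEquilibriumDensity


/-! ### Changes of the angular variable. -/

/-- The regular part of the logarithmic kernel of the arc `q` in the angular variable. -/
noncomputable def chordKernel (q : ℝ → ℂ) (p : ℝ × ℝ) : ℝ :=
  Real.log ‖dividedDiff q (Real.cos p.1, Real.cos p.2)‖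

namespace IsRegularArc
open Real
variable {q : ℝ → ℂ}

theorem contDiff_chordKernel (h : IsRegularArc q) : ContDiff ℝ 4 (chordKernel q) := by
  have h1 : ContDiff ℝ 4 fun p : ℝ × ℝ => dividedDiff q (cos p.1, cos p.2) :=
    h.contDiff_dividedDiff.comp (by fun_prop)
  have h0 : ∀ p : ℝ × ℝ, dividedDiff q (cos p.1, cos p.2) ≠ 0 := fun p =>
    h.dividedDiff_ne (cos_mem _) (cos_mem _)
  exact (h1.norm ℝ h0).log fun p => norm_ne_zero_iff.2 (h0 p)

theorem isLogKernel (h : IsRegularArc q) :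
    IsLogKernel (fun φ => q (cos φ)) (chordKernel q) where
  contDiff := h.contDiff_chordKernel.of_le (by norm_num)
  symm x y := by simp only [chordKernel]; rw [dividedDiff_comm h.contDiff_one]
  continuous := h.contDiff.continuous.comp continuous_cos
  injOn x hx y hy he := injOn_cos hx hy (h.injOn (cos_mem x) (cos_mem y) he)
  log_eq x hx y hy hne := by
    have hc := cos_ne_cos hx hy hne
    rw [← smul_dividedDiff h.contDiff_one, norm_smul, log_mul, Real.norm_eq_abs]
    · rfl
    · exact norm_ne_zero_iff.2 (sub_ne_zero.2 hc)
    · exact norm_ne_zero_iff.2 (h.dividedDiff_ne (cos_mem x) (cos_mem y))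

theorem exists_isEquilibriumDensity (h : IsRegularArc q) : ∃ w V, IsEquilibriumDensity q w V := by
  obtain ⟨w, hw, heven, hper, hint, V, hV⟩ := h.isLogKernel.exists_density h.contDiff_chordKernel
    (fun x y => by simp [chordKernel]) (fun x y => by simp [chordKernel])
  exact ⟨w, V, h, hw, heven, hper, hint, hV⟩

end IsRegularArc

/-- A change of the angular variable. -/
structure IsAngleChange (τ : ℝ → ℝ) : Prop where
  contDiff : ContDiff ℝ 3 τ
  bijective : Function.Bijective τ
  deriv_ne : ∀ x, deriv τ x ≠ 0
  odd : ∀ x, τ (-x) = -τ x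
  add_two_pi : ∀ x, τ (x + 2 * Real.pi) = τ x + 2 * Real.pi

section sinc
open Real

/-- The function `sin u / u`. -/
noncomputable def sincDiff (u : ℝ) : ℝ := dividedDiff sin (u, 0)

theorem contDiff_sincDiff : ContDiff ℝ 2 sincDiff :=
  (contDiff_dividedDiff (n := 2) contDiff_sin).comp (by fun_prop)

theorem mul_sincDiff (u : ℝ) : u * sincDiff u = sin u := by
  have := smul_dividedDiff (contDiff_sin (n := 1)) u 0
  rwa [sub_zero, sin_zero, sub_zero, smul_eq_mul] at this

theorem sincDiff_ne {u : ℝ} (h1 : -π < u) (h2 : u < π) : sincDiff u ≠ 0 := by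
  rcases eq_or_ne u 0 with rfl | hu
  · rw [sincDiff, dividedDiff_self]; simp
  · intro h0
    have := mul_sincDiff u
    rw [h0, mul_zero, eq_comm, sin_eq_zero_iff_of_lt_of_lt h1 h2] at this
    exact hu this

end sinc

namespace IsAngleChange
open Real Filter Topology
variable {τ : ℝ → ℝ}

theorem add_int_mul (h : IsAngleChange τ) (n : ℤ) (x : ℝ) :
    τ (x + n * (2 * π)) = τ x + n * (2 * π) := by
  have hp : Function.Periodic (fun x => τ x - x) (2 * π) := fun x => by
    simp only [h.add_two_pi]; ring
  have : τ (x + n * (2 * π)) - (x + n * (2 * π)) = τ x - x := hp.int_mul n x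
  linarith

theorem deriv_add_int_mul (h : IsAngleChange τ) (n : ℤ) (x : ℝ) :
    deriv τ (x + n * (2 * π)) = deriv τ x := by
  have h1 : (fun x => τ (x + n * (2 * π))) = fun x => τ x + n * (2 * π) :=
    funext (h.add_int_mul n)
  rw [← deriv_comp_add_const, h1, deriv_add_const]

theorem sin_half_ne (h : IsAngleChange τ) {x y : ℝ} (hne : sin ((x - y) / 2) ≠ 0) :
    sin ((τ x - τ y) / 2) ≠ 0 := by
  rw [sin_ne_zero_iff] at hne ⊢
  intro n hn
  refine hne n ?_
  have h1 : τ x = τ (y + n * (2 * π)) := by rw [h.add_int_mul]; linarith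
  have h2 := h.bijective.1 h1
  rw [h2]; ring

open Classical in
/-- The quotient of half-angle sines, extended continuously. -/
noncomputable def sineRatio (τ : ℝ → ℝ) (p : ℝ × ℝ) : ℝ :=
  if sin ((p.1 - p.2) / 2) = 0 then deriv τ p.1
  else sin ((τ p.1 - τ p.2) / 2) / sin ((p.1 - p.2) / 2)

theorem sineRatio_ne (h : IsAngleChange τ) (p : ℝ × ℝ) : sineRatio τ p ≠ 0 := by
  rw [sineRatio]
  split_ifs with h0
  · exact h.deriv_ne _
  · exact div_ne_zero (h.sin_half_ne h0) h0

theorem sineRatio_mul {x y : ℝ} (h0 : sin ((x - y) / 2) ≠ 0) :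
    sineRatio τ (x, y) * sin ((x - y) / 2) = sin ((τ x - τ y) / 2) := by
  rw [sineRatio, if_neg h0, div_mul_cancel₀ _ h0]

theorem sineRatio_sub (h : IsAngleChange τ) (n : ℤ) (x y : ℝ) :
    sineRatio τ (x + n * (2 * π), y) = sineRatio τ (x, y) := by
  have h1 : ∀ a b : ℝ, sin ((a + n * (2 * π) - b) / 2) = (-1) ^ n * sin ((a - b) / 2) := fun a b => by
    rw [← sin_add_int_mul_pi]; congr 1; ring
  have h2 : ((-1 : ℝ) ^ n) ≠ 0 := zpow_ne_zero _ (by norm_num)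
  simp only [sineRatio, h.add_int_mul, h.deriv_add_int_mul, h1, mul_eq_zero, h2, false_or]
  rw [mul_div_mul_left _ _ h2]

/-- Writing sin u = u·(sin u / u) in numerator and denominator removes the singularity at the
diagonal and leaves a divided difference of τ. -/
theorem sineRatio_eq_of_abs_lt (h : IsAngleChange τ) {x y : ℝ} (hxy : |x - y| < 2 * π) :
    sineRatio τ (x, y) = dividedDiff τ (x, y) * sincDiff ((τ x - τ y) / 2) /
      sincDiff ((x - y) / 2) := by
  have hc1 : ContDiff ℝ 1 τ := h.contDiff.of_le (by norm_num)
  rw [abs_lt] at hxy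
  rcases eq_or_ne x y with rfl | hne
  · have : sincDiff 0 = 1 := by rw [sincDiff, dividedDiff_self]; simp
    simp [sineRatio, dividedDiff_self, this]
  · have hs : sincDiff ((x - y) / 2) ≠ 0 := sincDiff_ne (by linarith) (by linarith)
    have h0 : sin ((x - y) / 2) ≠ 0 := by
      rw [← mul_sincDiff]
      exact mul_ne_zero (by rw [div_ne_zero_iff]; exact ⟨sub_ne_zero.2 hne, two_ne_zero⟩) hs
    rw [sineRatio, if_neg h0, div_eq_div_iff h0 hs, ← mul_sincDiff, ← mul_sincDiff ((x - y) / 2)]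
    have := smul_dividedDiff hc1 x y
    rw [smul_eq_mul] at this
    rw [← this]
    ring

/-- Where the denominator is nonzero this is a quotient of smooth functions. Near a zero x - y =
2πn, periodicity moves the point to the diagonal. The divided difference is what lowers C³ to C². -/
theorem contDiff_sineRatio (h : IsAngleChange τ) : ContDiff ℝ 2 (sineRatio τ) := by
  have hτ : ContDiff ℝ 2 τ := h.contDiff.of_le (by norm_num)
  have hD : ContDiff ℝ 2 (dividedDiff τ) := contDiff_dividedDiff (n := 2) h.contDiff
  have hS := contDiff_sincDiff
  refine contDiff_iff_contDiffAt.2 fun p => ?_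
  by_cases h0 : sin ((p.1 - p.2) / 2) = 0
  · obtain ⟨n, hn⟩ := sin_eq_zero_iff.1 h0
    set N : ℝ × ℝ → ℝ := fun p => dividedDiff τ (p.1 + (-n : ℤ) * (2 * π), p.2) *
      sincDiff ((τ (p.1 + (-n : ℤ) * (2 * π)) - τ p.2) / 2) /
        sincDiff ((p.1 + (-n : ℤ) * (2 * π) - p.2) / 2) with hN
    have hp : p.1 + (-n : ℤ) * (2 * π) - p.2 = 0 := by push_cast; linarith
    have hNd : ContDiffAt ℝ 2 N p := by
      refine ContDiffAt.div (ContDiff.contDiffAt ?_) (ContDiff.contDiffAt ?_) ?_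
      · exact (hD.comp (by fun_prop)).mul (hS.comp (by fun_prop))
      · exact hS.comp (by fun_prop)
      · rw [hp, zero_div]
        exact sincDiff_ne (by linarith [pi_pos]) pi_pos
    refine hNd.congr_of_eventuallyEq ?_
    have hcont : Continuous fun p : ℝ × ℝ => |p.1 + (-n : ℤ) * (2 * π) - p.2| := by fun_prop
    have hev : ∀ᶠ p' : ℝ × ℝ in 𝓝 p, |p'.1 + (-n : ℤ) * (2 * π) - p'.2| < 2 * π :=
      hcont.continuousAt.eventually_lt_const (by beta_reduce; rw [hp, abs_zero]; positivity)
    filter_upwards [hev] with p' hp'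
    rw [← h.sineRatio_sub (-n) p'.1 p'.2, h.sineRatio_eq_of_abs_lt hp']
  · have hd : ContDiffAt ℝ 2
        (fun p : ℝ × ℝ => sin ((τ p.1 - τ p.2) / 2) / sin ((p.1 - p.2) / 2)) p := by
      refine ContDiffAt.div (ContDiff.contDiffAt ?_) (ContDiff.contDiffAt ?_) h0
      · fun_prop
      · fun_prop
    refine hd.congr_of_eventuallyEq ?_
    have hcont : Continuous fun p : ℝ × ℝ => sin ((p.1 - p.2) / 2) := by fun_prop
    filter_upwards [hcont.continuousAt.eventually_ne h0] with p' hne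
    rw [sineRatio, if_neg hne]

/-- A change of the angular variable preserves the class of kernels with a regular part. -/
theorem isLogKernel (h : IsAngleChange τ) (hmaps : MapsTo τ (Icc 0 π) (Icc 0 π)) {ζ : ℝ → ℂ}
    {F : ℝ × ℝ → ℝ} (hF : IsLogKernel ζ F) : ∃ G, IsLogKernel (fun x => ζ (τ x)) G := by
  set H : ℝ × ℝ → ℝ := fun p => F (τ p.1, τ p.2) + log (sineRatio τ p) +
    log (sineRatio τ (p.1, -p.2)) with hH
  have hτ : ContDiff ℝ 2 τ := h.contDiff.of_le (by norm_num)
  have hR := h.contDiff_sineRatio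
  have hHd : ContDiff ℝ 2 H := by
    refine ((hF.contDiff.comp (by fun_prop)).add (hR.log h.sineRatio_ne)).add
      (ContDiff.log (hR.comp (by fun_prop)) fun p => h.sineRatio_ne _)
  have hlog : ∀ x ∈ Icc 0 π, ∀ y ∈ Icc 0 π, x ≠ y →
      log ‖ζ (τ x) - ζ (τ y)‖ = log |cos x - cos y| + H (x, y) := by
    intro x hx y hy hne
    rw [hF.log_eq _ (hmaps hx) _ (hmaps hy) fun he => hne (h.bijective.1 he)]
    have hc := cos_ne_cos hx hy hne
    have hc' : sin ((x + y) / 2) ≠ 0 ∧ sin ((x - y) / 2) ≠ 0 := by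
      have h1 := sub_ne_zero.2 hc
      rw [cos_sub_cos] at h1
      constructor <;> intro h0 <;> apply h1 <;> rw [h0] <;> ring
    -- Both half-angle sines in the product formula change by a factor `sineRatio`. Oddness of τ
    -- turns the one with x + y into the ratio at (x, -y).
    have h2 : cos (τ x) - cos (τ y) =
        (cos x - cos y) * sineRatio τ (x, y) * sineRatio τ (x, -y) := by
      rw [cos_sub_cos, cos_sub_cos, ← sineRatio_mul (τ := τ) hc'.2]
      have h3 := sineRatio_mul (τ := τ) (x := x) (y := -y) (by rw [sub_neg_eq_add]; exact hc'.1)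
      rw [h.odd, sub_neg_eq_add, sub_neg_eq_add] at h3
      rw [← h3]
      ring
    rw [h2, log_abs, log_abs, log_mul, log_mul]
    · simp only [hH]; ring
    · exact sub_ne_zero.2 hc
    · exact h.sineRatio_ne _
    · exact mul_ne_zero (sub_ne_zero.2 hc) (h.sineRatio_ne _)
    · exact h.sineRatio_ne _
  -- Averaging over the exchange of variables makes symmetry immediate for all arguments and keeps
  -- the logarithmic identity, which is itself symmetric.
  refine ⟨fun p => (H p + H (p.2, p.1)) / 2, ?_, fun x y => by simp only []; ring,
    hF.continuous.comp hτ.continuous, fun x hx y hy he => ?_, fun x hx y hy hne => ?_⟩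
  · exact (hHd.add (hHd.comp (by fun_prop))).div_const 2
  · exact h.bijective.1 (hF.injOn (hmaps hx) (hmaps hy) he)
  · have h1 := hlog x hx y hy hne
    have h2 := hlog y hy x hx hne.symm
    rw [norm_sub_rev, abs_sub_comm] at h2
    simp only []
    linarith

end IsAngleChange


/-! ### The equilibrium angle of a regular arc. -/

namespace IsEquilibriumDensity
open Real Filter Topology
variable {q : ℝ → ℂ} {w : ℝ → ℝ} {V : ℝ}

theorem pos_of_even_of_periodic {w : ℝ → ℝ} (heven : ∀ x, w (-x) = w x)
    (hper : ∀ x, w (x + 2 * π) = w x) (hpos : ∀ x ∈ Icc 0 π, 0 < w x) (x : ℝ) : 0 < w x := by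
  have hpi := pi_pos
  have hp : Function.Periodic w (2 * π) := hper
  obtain ⟨y, hy, hyx⟩ := hp.exists_mem_Ico₀ (by positivity) x
  rw [hyx]
  rcases le_or_gt y π with h | h
  · exact hpos y ⟨hy.1, h⟩
  · rw [← heven, ← hper]
    exact hpos _ ⟨by linarith [hy.2], by linarith⟩

/-- The distribution function of the equilibrium density. -/
noncomputable def angle (w : ℝ → ℝ) (x : ℝ) : ℝ := ∫ t in (0 : ℝ)..x, w t

theorem hasDerivAt_angle (h : IsEquilibriumDensity q w V) (x : ℝ) :
    HasDerivAt (angle w) (w x) x :=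
  intervalIntegral.integral_hasDerivAt_right (h.contDiff.continuous.intervalIntegrable _ _)
    h.contDiff.continuous.stronglyMeasurable.stronglyMeasurableAtFilter
    h.contDiff.continuous.continuousAt

theorem contDiff_angle (h : IsEquilibriumDensity q w V) : ContDiff ℝ 3 (angle w) := by
  have h1 : deriv (angle w) = w := funext fun x => (h.hasDerivAt_angle x).deriv
  refine (contDiff_succ_iff_deriv (n := 2)).2
    ⟨fun x => (h.hasDerivAt_angle x).differentiableAt, by simp, ?_⟩
  rw [h1]; exact h.contDiff

theorem pos' (h : IsEquilibriumDensity q w V) (x : ℝ) : 0 < w x :=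
  pos_of_even_of_periodic h.even h.periodic (fun _ hx => h.pos hx) x

theorem strictMono_angle (h : IsEquilibriumDensity q w V) : StrictMono (angle w) :=
  strictMono_of_deriv_pos fun x => by rw [(h.hasDerivAt_angle x).deriv]; exact h.pos' x

theorem angle_zero : angle w 0 = 0 := intervalIntegral.integral_same

theorem angle_pi (h : IsEquilibriumDensity q w V) : angle w π = π := by
  rw [angle, ← integral_angleMeasure, h.integral]

theorem angle_neg (h : IsEquilibriumDensity q w V) (x : ℝ) : angle w (-x) = -angle w x := by
  have := intervalIntegral.integral_comp_neg (f := w) (a := 0) (b := x)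
  simp_rw [h.even, neg_zero] at this
  rw [angle, angle, this, ← intervalIntegral.integral_symm]

theorem angle_add_two_pi (h : IsEquilibriumDensity q w V) (x : ℝ) :
    angle w (x + 2 * π) = angle w x + 2 * π := by
  have hi : ∀ a b, IntervalIntegrable w volume a b := fun a b =>
    h.contDiff.continuous.intervalIntegrable _ _
  have hp : Function.Periodic w (2 * π) := h.periodic
  have h1 := hp.intervalIntegral_add_eq x (-π)
  rw [show -π + 2 * π = π by ring] at h1
  have h2 : ∫ t in (-π)..π, w t = 2 * π := by
    rw [← intervalIntegral.integral_add_adjacent_intervals (hi _ 0) (hi 0 _),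
      intervalIntegral.integral_symm]
    have h3 := h.angle_neg π
    have h4 := h.angle_pi
    rw [angle] at h3 h4
    rw [h3, angle, h4]; ring
  rw [angle, angle, ← intervalIntegral.integral_add_adjacent_intervals (hi 0 x) (hi x _), h1, h2]

theorem surjective_angle (h : IsEquilibriumDensity q w V) : Function.Surjective (angle w) := by
  have hp : Function.Periodic (fun x => angle w x - x) (2 * π) := fun x => by
    simp only [h.angle_add_two_pi]; ring
  have hn : ∀ n : ℤ, angle w (n * (2 * π)) = n * (2 * π) := fun n => by
    have h1 : angle w (0 + n * (2 * π)) - (0 + n * (2 * π)) = angle w 0 - 0 := hp.int_mul n 0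
    rw [angle_zero, zero_add] at h1
    linarith
  intro y
  obtain ⟨n, hn1⟩ := exists_int_gt (|y| / (2 * π))
  rw [div_lt_iff₀ (by positivity)] at hn1
  have h1 := hn n
  have h2 := hn (-n)
  have hle : ((-n : ℤ) : ℝ) * (2 * π) ≤ n * (2 * π) := by
    push_cast
    linarith [abs_nonneg y]
  have := intermediate_value_Icc hle h.contDiff_angle.continuous.continuousOn
  rw [h1, h2] at this
  obtain ⟨x, -, hx⟩ := this (show y ∈ _ from
    ⟨by push_cast; linarith [neg_abs_le y], by linarith [le_abs_self y]⟩)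
  exact ⟨x, hx⟩

/-- The inverse of the distribution function as a homeomorphism. -/
noncomputable def angleHomeomorph (h : IsEquilibriumDensity q w V) : ℝ ≃ₜ ℝ :=
  (h.strictMono_angle.orderIsoOfSurjective _ h.surjective_angle).toHomeomorph

/-- The angle as a function of the equilibrium angle. -/
noncomputable def invAngle (h : IsEquilibriumDensity q w V) (y : ℝ) : ℝ := h.angleHomeomorph.symm y

theorem invAngle_angle (h : IsEquilibriumDensity q w V) (x : ℝ) : h.invAngle (angle w x) = x :=
  h.angleHomeomorph.symm_apply_apply x

theorem angle_invAngle (h : IsEquilibriumDensity q w V) (y : ℝ) : angle w (h.invAngle y) = y :=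
  h.angleHomeomorph.apply_symm_apply y

theorem invAngle_eq (h : IsEquilibriumDensity q w V) {x y : ℝ} (hxy : angle w x = y) :
    h.invAngle y = x := by rw [← hxy, h.invAngle_angle]

theorem strictMono_invAngle (h : IsEquilibriumDensity q w V) : StrictMono h.invAngle :=
  fun x y hxy => h.strictMono_angle.lt_iff_lt.1 (by rwa [h.angle_invAngle, h.angle_invAngle])

theorem invAngle_zero (h : IsEquilibriumDensity q w V) : h.invAngle 0 = 0 :=
  h.invAngle_eq angle_zero

theorem invAngle_pi (h : IsEquilibriumDensity q w V) : h.invAngle π = π :=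
  h.invAngle_eq h.angle_pi

/-- The distribution function is C³ because w is C², and positivity of w everywhere transfers this
to the inverse. -/
theorem contDiff_invAngle (h : IsEquilibriumDensity q w V) : ContDiff ℝ 3 h.invAngle :=
  h.angleHomeomorph.contDiff_symm_deriv (fun x => (h.pos' x).ne') h.hasDerivAt_angle
    h.contDiff_angle

theorem isAngleChange (h : IsEquilibriumDensity q w V) : IsAngleChange h.invAngle where
  contDiff := h.contDiff_invAngle
  bijective := h.angleHomeomorph.symm.bijective
  deriv_ne y h0 := by
    have h1 : HasDerivAt h.invAngle (deriv h.invAngle y) y :=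
      (h.contDiff_invAngle.differentiable (by norm_num) y).hasDerivAt
    have h2 := (h.hasDerivAt_angle (h.invAngle y)).comp y h1
    have h3 : angle w ∘ h.invAngle = id := funext h.angle_invAngle
    rw [h3, h0, mul_zero] at h2
    exact zero_ne_one (h2.unique (hasDerivAt_id y))
  odd y := h.invAngle_eq (by rw [h.angle_neg, h.angle_invAngle])
  add_two_pi y := h.invAngle_eq (by rw [h.angle_add_two_pi, h.angle_invAngle])

theorem mapsTo_invAngle (h : IsEquilibriumDensity q w V) :
    MapsTo h.invAngle (Icc 0 π) (Icc 0 π) := fun x hx => by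
  have h1 := h.strictMono_invAngle.monotone hx.1
  have h2 := h.strictMono_invAngle.monotone hx.2
  rw [h.invAngle_zero] at h1
  rw [h.invAngle_pi] at h2
  exact ⟨h1, h2⟩

theorem image_angle (h : IsEquilibriumDensity q w V) : angle w '' Ioc 0 π = Ioc 0 π := by
  have h1 := (h.strictMono_angle.orderIsoOfSurjective _ h.surjective_angle).image_Ioc 0 π
  have h2 : (h.strictMono_angle.orderIsoOfSurjective _ h.surjective_angle : ℝ → ℝ) = angle w := rfl
  rwa [h2, angle_zero, h.angle_pi] at h1

/-- Substitution y = ∫ w: in the new angle the equilibrium density becomes constant. -/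
theorem integral_comp_angle (h : IsEquilibriumDensity q w V) (g : ℝ → ℝ) :
    ∫ y, g y ∂angleMeasure = ∫ x, g (angle w x) * w x ∂angleMeasure := by
  have h1 := integral_image_eq_integral_abs_deriv_smul measurableSet_Ioc
    (fun x _ => (h.hasDerivAt_angle x).hasDerivWithinAt (s := Ioc 0 π))
    h.strictMono_angle.injective.injOn g
  rw [h.image_angle] at h1
  rw [angleMeasure, h1]
  congr 1; ext x
  rw [abs_of_pos (h.pos' x), smul_eq_mul, mul_comm]

end IsEquilibriumDensity

/-- The equilibrium parametrization of a regular arc in the angular variable. -/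
theorem IsRegularArc.exists_equilibriumAngle {q : ℝ → ℂ} (h : IsRegularArc q) :
    ∃ τ : ℝ → ℝ, Continuous τ ∧ StrictMono τ ∧ τ 0 = 0 ∧ τ Real.pi = Real.pi ∧
      (∃ F, IsLogKernel (fun x => q (Real.cos (τ x))) F) ∧
      ∃ V, ∀ x ∈ Icc 0 Real.pi, ∫ y, Real.log ‖q (Real.cos (τ x)) - q (Real.cos (τ y))‖
        ∂angleMeasure = V := by
  obtain ⟨w, V, hw⟩ := h.exists_isEquilibriumDensity
  refine ⟨hw.invAngle, hw.contDiff_invAngle.continuous, hw.strictMono_invAngle, hw.invAngle_zero,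
    hw.invAngle_pi, hw.isAngleChange.isLogKernel hw.mapsTo_invAngle h.isLogKernel, V,
    fun x hx => ?_⟩
  rw [hw.integral_comp_angle]
  simp_rw [hw.invAngle_angle]
  exact hw.potential _ (hw.mapsTo_invAngle hx)


/-! ### Positive definiteness of the energy, and measures on compact sets. -/

/-- The mutual logarithmic energy of `μ` and `ν` is an absolutely convergent integral. -/
structure HasFiniteLogPairing (μ ν : Measure ℂ) : Prop where
  ne : ∀ᵐ p ∂(μ.prod ν), p.1 ≠ p.2
  integrable : Integrable (fun p : ℂ × ℂ => Real.log ‖p.1 - p.2‖) (μ.prod ν)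

/-- The mutual logarithmic energy, with the opposite sign. -/
noncomputable def logPairing (μ ν : Measure ℂ) : ℝ := ∫ p, Real.log ‖p.1 - p.2‖ ∂(μ.prod ν)

section energy
variable {μ ν : Measure ℂ} [IsProbabilityMeasure μ] [IsProbabilityMeasure ν]

theorem HasFiniteLogPairing.gaussian (h : HasFiniteLogPairing μ ν) :
    (∀ t > 0, Integrable fun u => gaussTransform μ id 1 t u * gaussTransform ν id 1 t u) ∧
    IntegrableOn (fun t : ℝ => t⁻¹ * (4 * t / Real.pi *
      (∫ u, gaussTransform μ id 1 t u * gaussTransform ν id 1 t u) - Real.exp (-t))) (Ioi 0) ∧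
    ∫ t in Ioi (0 : ℝ), t⁻¹ * (4 * t / Real.pi *
      (∫ u, gaussTransform μ id 1 t u * gaussTransform ν id 1 t u) - Real.exp (-t)) =
      -(2 * logPairing μ ν) := by
  have h1 : ∀ σ : Measure ℂ, IsProbabilityMeasure σ → Integrable (1 : ℂ → ℝ) σ := fun σ _ =>
    integrable_const 1
  obtain ⟨h2, h3⟩ := log_energy_eq_integral_gaussian (m := 1) (n := 1) measurable_id measurable_id
    (h1 μ inferInstance) (h1 ν inferInstance) h.ne (by simpa using h.integrable)
  have hpair := fun (t : ℝ) (ht : 0 < t) => gaussTransform_pairing (m := 1) (n := 1) measurable_id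
    measurable_id (h1 μ inferInstance) (h1 ν inferInstance) ht
  have hpi := Real.pi_pos
  have e : ∀ t ∈ Ioi (0 : ℝ), t⁻¹ * ((∫ p, Real.exp (-(‖id p.1 - id p.2‖ ^ 2 * t)) *
      ((1 : ℂ → ℝ) p.1 * (1 : ℂ → ℝ) p.2) ∂(μ.prod ν)) -
        Real.exp (-t) * ((∫ x, (1 : ℂ → ℝ) x ∂μ) * ∫ y, (1 : ℂ → ℝ) y ∂ν)) =
      t⁻¹ * (4 * t / Real.pi *
      (∫ u, gaussTransform μ id 1 t u * gaussTransform ν id 1 t u) - Real.exp (-t)) := by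
    intro t ht
    have ht : 0 < t := ht
    rw [(hpair t ht).2]
    simp only [Pi.one_apply, integral_const, probReal_univ, smul_eq_mul, mul_one]
    field_simp
  refine ⟨fun t ht => (hpair t ht).1, h2.congr ((ae_restrict_mem measurableSet_Ioi).mono e), ?_⟩
  rw [← setIntegral_congr_fun measurableSet_Ioi e, h3, logPairing]
  simp

theorem continuous_gaussTransform_one (μ : Measure ℂ) [IsProbabilityMeasure μ] {t : ℝ}
    (ht : 0 ≤ t) : Continuous (gaussTransform μ id 1 t) :=
  continuous_gaussTransform measurable_id (integrable_const 1) ht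

/-- The logarithmic energy of a difference of probability measures is positive definite. -/
theorem logPairing_sub_nonneg (hμ : HasFiniteLogPairing μ μ) (hμν : HasFiniteLogPairing μ ν)
    (hν : HasFiniteLogPairing ν ν) :
    0 ≤ 2 * logPairing μ ν - logPairing μ μ - logPairing ν ν ∧
    (2 * logPairing μ ν - logPairing μ μ - logPairing ν ν = 0 →
      ∃ t > 0, ∀ u, gaussTransform μ id 1 t u = gaussTransform ν id 1 t u) := by
  obtain ⟨a1, a2, a3⟩ := hμ.gaussian
  obtain ⟨b1, b2, b3⟩ := hμν.gaussian
  obtain ⟨c1, c2, c3⟩ := hν.gaussian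
  set D : ℝ → ℂ → ℝ := fun t u => gaussTransform μ id 1 t u - gaussTransform ν id 1 t u with hD
  set E := 2 * logPairing μ ν - logPairing μ μ - logPairing ν ν with hE
  have hsq : ∀ t u, D t u * D t u = gaussTransform μ id 1 t u * gaussTransform μ id 1 t u -
      2 * (gaussTransform μ id 1 t u * gaussTransform ν id 1 t u) +
        gaussTransform ν id 1 t u * gaussTransform ν id 1 t u := fun t u => by
    simp only [hD]; ring
  have h1 : ∀ t > 0, Integrable fun u => D t u * D t u := fun t ht => by
    simp_rw [hsq]
    exact ((a1 t ht).sub ((b1 t ht).const_mul 2)).add (c1 t ht)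
  -- The three terms exp(-t) enter with coefficients 1, -2, 1 and cancel, since the difference of
  -- the two measures has mass zero.
  have e : ∀ t ∈ Ioi (0 : ℝ), (t⁻¹ * (4 * t / Real.pi *
      (∫ u, gaussTransform μ id 1 t u * gaussTransform μ id 1 t u) - Real.exp (-t)) -
      2 * (t⁻¹ * (4 * t / Real.pi *
      (∫ u, gaussTransform μ id 1 t u * gaussTransform ν id 1 t u) - Real.exp (-t)))) +
      t⁻¹ * (4 * t / Real.pi *
      (∫ u, gaussTransform ν id 1 t u * gaussTransform ν id 1 t u) - Real.exp (-t)) =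
      t⁻¹ * (4 * t / Real.pi * ∫ u, D t u * D t u) := by
    intro t ht
    have ht : 0 < t := ht
    simp_rw [hsq]
    have hab : Integrable fun u => gaussTransform μ id 1 t u * gaussTransform μ id 1 t u -
        2 * (gaussTransform μ id 1 t u * gaussTransform ν id 1 t u) :=
      (a1 t ht).sub ((b1 t ht).const_mul 2)
    rw [integral_add hab (c1 t ht),
      integral_sub (a1 t ht) ((b1 t ht).const_mul 2), integral_const_mul]
    ring
  have h2 := ((a2.sub (b2.const_mul 2)).add c2).congr
    ((ae_restrict_mem measurableSet_Ioi).mono e)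
  have h3 : ∫ t in Ioi (0 : ℝ), t⁻¹ * (4 * t / Real.pi * ∫ u, D t u * D t u) = 2 * E := by
    rw [← setIntegral_congr_fun measurableSet_Ioi e, integral_add (a2.fun_sub (b2.const_mul 2)) c2,
      integral_sub a2 (b2.const_mul 2), integral_const_mul, a3, b3, c3, hE]
    ring
  refine ⟨energy_nonneg h3, fun h0 => ?_⟩
  have h4 := lintegral_sq_eq_of_energy h1 h2 h3
  rw [h0, mul_zero, ENNReal.ofReal_zero] at h4
  obtain ⟨t, ht, hu⟩ := exists_forall_eq_zero_of_lintegral_eq_zero (D := D)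
    ((measurable_gaussTransform measurable_id measurable_one).sub
      (measurable_gaussTransform measurable_id measurable_one))
    (fun t ht => (continuous_gaussTransform_one μ (le_of_lt ht)).sub
      (continuous_gaussTransform_one ν (le_of_lt ht))) h4
  exact ⟨t, ht, fun u => sub_eq_zero.1 (hu u)⟩

end energy

theorem exists_integral_functional {X : Type*} [TopologicalSpace X] [CompactSpace X]
    [MeasurableSpace X] [BorelSpace X] (μ : Measure X) [IsFiniteMeasure μ] :
    ∃ Λ : C(X, ℝ) →L[ℝ] ℝ, ∀ f, Λ f = ∫ x, f x ∂μ := by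
  have hi : ∀ f : C(X, ℝ), Integrable f μ := fun f =>
    f.continuous.integrable_of_hasCompactSupport (HasCompactSupport.of_compactSpace _)
  refine ⟨LinearMap.mkContinuous
    { toFun := fun f => ∫ x, f x ∂μ
      map_add' := fun f g => integral_add (hi f) (hi g)
      map_smul' := fun c f => integral_const_mul c _ } (μ.real univ) fun f => ?_, fun f => rfl⟩
  have := norm_integral_le_of_norm_le_const (μ := μ) (f := f) (C := ‖f‖)
    (Filter.Eventually.of_forall f.norm_coe_le_norm)
  rw [mul_comm] at this
  exact this

/-- Probability measures on a compact set are determined by their Gaussian transforms. -/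
theorem measure_eq_of_gaussTransform_eq {K : Set ℂ} (hK : IsCompact K) {μ ν : Measure ℂ}
    [IsProbabilityMeasure μ] [IsProbabilityMeasure ν] (hμ : μ Kᶜ = 0) (hν : ν Kᶜ = 0) {t : ℝ}
    (ht : 0 < t) (h : ∀ u, gaussTransform μ id 1 t u = gaussTransform ν id 1 t u) : μ = ν := by
  have hcs : CompactSpace K := isCompact_iff_compactSpace.1 hK
  have hme : MeasurableEmbedding (Subtype.val : K → ℂ) :=
    MeasurableEmbedding.subtype_coe hK.measurableSet
  have hmap : ∀ σ : Measure ℂ, σ Kᶜ = 0 → (σ.comap (Subtype.val : K → ℂ)).map Subtype.val = σ :=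
    fun σ hσ => by
      rw [hme.map_comap, Subtype.range_coe]
      exact Measure.restrict_eq_self_of_ae_mem (mem_ae_iff.2 hσ)
  have hint : ∀ σ : Measure ℂ, σ Kᶜ = 0 → ∀ f : ℂ → ℝ,
      ∫ x : K, f x ∂(σ.comap Subtype.val) = ∫ z, f z ∂σ := fun σ hσ f => by
    conv_rhs => rw [← hmap σ hσ]
    rw [hme.integral_map]
  have hfin : ∀ σ : Measure ℂ, IsFiniteMeasure σ →
      IsFiniteMeasure (σ.comap (Subtype.val : K → ℂ)) := fun σ _ =>
    ⟨by rw [hme.comap_apply]; exact measure_lt_top _ _⟩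
  have hf1 := hfin μ inferInstance
  have hf2 := hfin ν inferInstance
  obtain ⟨Λ₁, h₁⟩ := exists_integral_functional (μ.comap (Subtype.val : K → ℂ))
  obtain ⟨Λ₂, h₂⟩ := exists_integral_functional (ν.comap (Subtype.val : K → ℂ))
  have h0 : Λ₁ - Λ₂ = 0 := by
    refine functional_eq_zero_of_gaussian ⟨Subtype.val, continuous_subtype_val⟩
      Subtype.val_injective _ ht fun u => ?_
    rw [sub_apply, h₁, h₂, sub_eq_zero]
    have e1 := hint μ hμ fun z => Real.exp (-(2 * t * ‖z - u‖ ^ 2))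
    have e2 := hint ν hν fun z => Real.exp (-(2 * t * ‖z - u‖ ^ 2))
    have e3 := h u
    simp only [gaussTransform, Pi.one_apply, mul_one, id] at e3
    exact e1.trans (e3.trans e2.symm)
  refine ext_of_forall_integral_eq_of_IsFiniteMeasure fun f => ?_
  rw [← hint μ hμ, ← hint ν hν]
  have h3 := congrArg (fun Λ => Λ ⟨fun x : K => f x, by fun_prop⟩) h0
  simp only [sub_apply, zero_apply, h₁, h₂] at h3
  exact sub_eq_zero.1 h3

section logEnergy

theorem ennrealLog_edist {z w : ℂ} (h : z ≠ w) :
    ENNReal.log (edist z w) = ((Real.log ‖z - w‖ : ℝ) : EReal) := by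
  rw [edist_dist, dist_eq_norm, ENNReal.log_ofReal_of_pos (norm_pos_iff.2 (sub_ne_zero.2 h))]

theorem measurable_log_edist : Measurable fun p : ℂ × ℂ => ENNReal.log (edist p.1 p.2) :=
  ENNReal.measurable_log.comp (measurable_fst.edist measurable_snd)

theorem measurable_neg_log_edist :
    Measurable fun p : ℂ × ℂ => (-ENNReal.log (edist p.1 p.2)).toENNReal :=
  measurable_log_edist.neg.ereal_toENNReal

variable {μ : Measure ℂ} [IsProbabilityMeasure μ]

theorem logEnergy_eq_prod : logEnergy μ =
    ((∫⁻ p, (-ENNReal.log (edist p.1 p.2)).toENNReal ∂(μ.prod μ) : ENNReal) : EReal) -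
      ((∫⁻ p, (ENNReal.log (edist p.1 p.2)).toENNReal ∂(μ.prod μ) : ENNReal) : EReal) := by
  rw [logEnergy, lintegral_prod _ measurable_neg_log_edist.aemeasurable,
    lintegral_prod _ measurable_log_edist.ereal_toENNReal.aemeasurable]

theorem logEnergy_of_hasFiniteLogPairing (h : HasFiniteLogPairing μ μ) :
    logEnergy μ = ((-logPairing μ μ : ℝ) : EReal) := by
  have e1 : ∫⁻ p, (-ENNReal.log (edist p.1 p.2)).toENNReal ∂(μ.prod μ) =
      ∫⁻ p, ENNReal.ofReal (-Real.log ‖p.1 - p.2‖) ∂(μ.prod μ) := by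
    refine lintegral_congr_ae ?_
    filter_upwards [h.ne] with p hp
    rw [ennrealLog_edist hp, ← EReal.coe_neg, EReal.toENNReal_of_ne_top (EReal.coe_ne_top _),
      EReal.toReal_coe]
  have e2 : ∫⁻ p, (ENNReal.log (edist p.1 p.2)).toENNReal ∂(μ.prod μ) =
      ∫⁻ p, ENNReal.ofReal (Real.log ‖p.1 - p.2‖) ∂(μ.prod μ) := by
    refine lintegral_congr_ae ?_
    filter_upwards [h.ne] with p hp
    rw [ennrealLog_edist hp, EReal.toENNReal_of_ne_top (EReal.coe_ne_top _), EReal.toReal_coe]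
  have hfin1 : ∫⁻ p, ENNReal.ofReal (-Real.log ‖p.1 - p.2‖) ∂(μ.prod μ) ≠ ⊤ :=
    h.integrable.neg.lintegral_lt_top.ne
  have hfin2 : ∫⁻ p, ENNReal.ofReal (Real.log ‖p.1 - p.2‖) ∂(μ.prod μ) ≠ ⊤ :=
    h.integrable.lintegral_lt_top.ne
  rw [logEnergy_eq_prod, e1, e2, logPairing,
    integral_eq_lintegral_pos_part_sub_lintegral_neg_part h.integrable, neg_sub, EReal.coe_sub,
    EReal.coe_ennreal_toReal hfin1, EReal.coe_ennreal_toReal hfin2]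

/-- On a compact set the energy is infinite or an absolutely convergent integral. -/
theorem logEnergy_eq_top_or {K : Set ℂ} (hK : IsCompact K) (hμ : μ Kᶜ = 0) :
    logEnergy μ = ⊤ ∨ HasFiniteLogPairing μ μ := by
  obtain ⟨R, hR0, hR⟩ : ∃ R > 0, ∀ z ∈ K, ‖z‖ ≤ R := hK.isBounded.exists_pos_norm_le
  have hae : ∀ᵐ z ∂μ, z ∈ K := mem_ae_iff.2 hμ
  have hmem : ∀ᵐ p ∂(μ.prod μ), p.1 ∈ K ∧ p.2 ∈ K :=
    (Measure.quasiMeasurePreserving_fst.ae hae).and (Measure.quasiMeasurePreserving_snd.ae hae)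
  set C := Real.log (2 * R) with hC
  have hle : ∀ᵐ p ∂(μ.prod μ), p.1 ≠ p.2 → Real.log ‖p.1 - p.2‖ ≤ C := by
    filter_upwards [hmem] with p hp hne
    refine Real.log_le_log (norm_pos_iff.2 (sub_ne_zero.2 hne)) ((norm_sub_le _ _).trans ?_)
    linarith [hR _ hp.1, hR _ hp.2]
  have hfin : ∫⁻ p, (ENNReal.log (edist p.1 p.2)).toENNReal ∂(μ.prod μ) ≠ ⊤ := by
    have h1 : ∫⁻ p, (ENNReal.log (edist p.1 p.2)).toENNReal ∂(μ.prod μ) ≤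
        ∫⁻ _, ENNReal.ofReal C ∂(μ.prod μ) := by
      refine lintegral_mono_ae ?_
      filter_upwards [hle] with p hp
      by_cases hne : p.1 = p.2
      · simp [hne]
      · rw [ennrealLog_edist hne, EReal.toENNReal_of_ne_top (EReal.coe_ne_top _), EReal.toReal_coe]
        exact ENNReal.ofReal_le_ofReal (hp hne)
    refine (h1.trans_lt ?_).ne
    simp
  -- Compactness has made the other part finite, so an infinite value here makes the energy
  -- infinite, and a finite one gives absolute convergence and a null diagonal.
  by_cases htop : ∫⁻ p, (-ENNReal.log (edist p.1 p.2)).toENNReal ∂(μ.prod μ) = ⊤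
  · left
    rw [logEnergy_eq_prod, htop, EReal.coe_ennreal_top,
      ← EReal.coe_ennreal_toReal hfin, EReal.top_sub_coe]
  · right
    have hne : ∀ᵐ p ∂(μ.prod μ), p.1 ≠ p.2 := by
      filter_upwards [ae_lt_top measurable_neg_log_edist htop] with p hp he
      simp [he] at hp
    refine ⟨hne, ?_⟩
    have hm : Measurable fun p : ℂ × ℂ => Real.log ‖p.1 - p.2‖ :=
      Real.measurable_log.comp (measurable_fst.sub measurable_snd).norm
    refine ⟨hm.aestronglyMeasurable, ?_⟩
    have hb : ∫⁻ p, ‖Real.log ‖p.1 - p.2‖‖ₑ ∂(μ.prod μ) ≤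
        ∫⁻ p, (-ENNReal.log (edist p.1 p.2)).toENNReal ∂(μ.prod μ) +
          ∫⁻ p, (ENNReal.log (edist p.1 p.2)).toENNReal ∂(μ.prod μ) := by
      rw [← lintegral_add_left measurable_neg_log_edist]
      refine lintegral_mono_ae ?_
      filter_upwards [hne] with p hp
      rw [ennrealLog_edist hp, ← EReal.coe_neg, EReal.toENNReal_of_ne_top (EReal.coe_ne_top _),
        EReal.toENNReal_of_ne_top (EReal.coe_ne_top _), EReal.toReal_coe, EReal.toReal_coe,
        Real.enorm_eq_ofReal_abs]
      rcases le_total 0 (Real.log ‖p.1 - p.2‖) with h0 | h0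
      · rw [abs_of_nonneg h0]; exact le_add_self
      · rw [abs_of_nonpos h0]; exact le_self_add
    exact hb.trans_lt (ENNReal.add_lt_top.2 ⟨lt_top_iff_ne_top.2 htop, lt_top_iff_ne_top.2 hfin⟩)

end logEnergy


/-! ### Uniqueness of the equilibrium measure and of its parametrization. -/

/-- A curve with a regular logarithmic kernel for which the angular measure is the equilibrium
measure. -/
structure IsEquilibriumCurve (ζ : ℝ → ℂ) (F : ℝ × ℝ → ℝ) (V : ℝ) : Prop where
  kernel : IsLogKernel ζ F
  potential : ∀ x ∈ Icc 0 Real.pi, ∫ y, Real.log ‖ζ x - ζ y‖ ∂angleMeasure = Real.pi * V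

/-- The image of the normalized angular measure. -/
noncomputable def curveMeasure (ζ : ℝ → ℂ) : Measure ℂ :=
  (ENNReal.ofReal Real.pi⁻¹ • angleMeasure).map ζ

theorem IsLogKernel.integrable_log_right {ζ : ℝ → ℂ} {F : ℝ × ℝ → ℝ} (h : IsLogKernel ζ F) {x : ℝ}
    (hx : x ∈ Icc 0 Real.pi) : Integrable (fun y => Real.log ‖ζ x - ζ y‖) angleMeasure := by
  have hF := h.contDiff.continuous
  refine ((integrable_log_abs_cos_sub_cos hx).add
    (Continuous.integrable_angleMeasure (f := fun y => F (x, y)) (by fun_prop))).congr ?_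
  filter_upwards [ae_angleMeasure_mem, ae_angleMeasure_ne x] with y hy hne
  exact (h.log_eq x hx y hy hne).symm

namespace IsEquilibriumCurve
open Real
variable {ζ : ℝ → ℂ} {F : ℝ × ℝ → ℝ} {V : ℝ}

theorem curveMeasure_apply (h : IsEquilibriumCurve ζ F V) {s : Set ℂ} (hs : MeasurableSet s) :
    curveMeasure ζ s = ENNReal.ofReal π⁻¹ * angleMeasure (ζ ⁻¹' s) := by
  rw [curveMeasure, Measure.map_apply h.kernel.continuous.measurable hs, Measure.smul_apply,
    smul_eq_mul]

theorem isProbabilityMeasure (h : IsEquilibriumCurve ζ F V) :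
    IsProbabilityMeasure (curveMeasure ζ) := by
  constructor
  rw [h.curveMeasure_apply MeasurableSet.univ, preimage_univ, angleMeasure,
    Measure.restrict_apply_univ, Real.volume_Ioc, sub_zero, ← ENNReal.ofReal_mul (by positivity),
    inv_mul_cancel₀ pi_pos.ne', ENNReal.ofReal_one]

theorem isCompact_image (h : IsEquilibriumCurve ζ F V) : IsCompact (ζ '' Icc 0 π) :=
  isCompact_Icc.image h.kernel.continuous

theorem ae_curveMeasure (h : IsEquilibriumCurve ζ F V) {p : ℂ → Prop}
    (hp : MeasurableSet {z | p z}) (hae : ∀ᵐ y ∂angleMeasure, p (ζ y)) :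
    ∀ᵐ z ∂(curveMeasure ζ), p z := by
  rw [curveMeasure, ae_map_iff h.kernel.continuous.aemeasurable hp]
  exact Measure.ae_smul_measure hae _

theorem curveMeasure_compl (h : IsEquilibriumCurve ζ F V) :
    curveMeasure ζ (ζ '' Icc 0 π)ᶜ = 0 := by
  have : ∀ᵐ z ∂(curveMeasure ζ), z ∈ ζ '' Icc 0 π := by
    refine h.ae_curveMeasure h.isCompact_image.measurableSet ?_
    filter_upwards [ae_angleMeasure_mem] with y hy
    exact ⟨y, hy, rfl⟩
  exact this

theorem mem_probabilityMeasuresOn (h : IsEquilibriumCurve ζ F V) :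
    curveMeasure ζ ∈ probabilityMeasuresOn (ζ '' Icc 0 π) :=
  ⟨h.isProbabilityMeasure, h.curveMeasure_compl⟩

theorem ae_ne (h : IsEquilibriumCurve ζ F V) {z : ℂ} (hz : z ∈ ζ '' Icc 0 π) :
    ∀ᵐ w ∂(curveMeasure ζ), z ≠ w := by
  obtain ⟨x, hx, rfl⟩ := hz
  refine h.ae_curveMeasure (p := fun w => ζ x ≠ w)
    (isClosed_eq continuous_const continuous_id).measurableSet.compl ?_
  filter_upwards [ae_angleMeasure_mem, ae_angleMeasure_ne x] with y hy hne he
  exact hne (h.kernel.injOn hx hy he)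

theorem integrable_log (h : IsEquilibriumCurve ζ F V) {z : ℂ} (hz : z ∈ ζ '' Icc 0 π) :
    Integrable (fun w => log ‖z - w‖) (curveMeasure ζ) ∧
      ∫ w, log ‖z - w‖ ∂(curveMeasure ζ) = V := by
  obtain ⟨x, hx, rfl⟩ := hz
  have hm : Measurable fun w : ℂ => log ‖ζ x - w‖ := by fun_prop
  have hζ := h.kernel.continuous.aemeasurable (μ := ENNReal.ofReal π⁻¹ • angleMeasure)
  constructor
  · rw [curveMeasure, integrable_map_measure hm.aestronglyMeasurable hζ]
    exact (h.kernel.integrable_log_right hx).smul_measure ENNReal.ofReal_ne_top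
  · rw [curveMeasure, integral_map hζ hm.aestronglyMeasurable, integral_smul_measure,
      h.potential x hx, ENNReal.toReal_ofReal (by positivity), smul_eq_mul,
      inv_mul_cancel_left₀ pi_pos.ne']

/-- Even if μ has infinite energy: |log| = 2 log⁺ - log, the first term is bounded on the compact
curve, and the second has the constant integral V at every point of it. -/
theorem hasFiniteLogPairing (h : IsEquilibriumCurve ζ F V) {μ : Measure ℂ}
    [IsProbabilityMeasure μ] (hμ : μ (ζ '' Icc 0 π)ᶜ = 0) :
    HasFiniteLogPairing μ (curveMeasure ζ) := by
  have hν := h.isProbabilityMeasure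
  have hae : ∀ᵐ z ∂μ, z ∈ ζ '' Icc 0 π := mem_ae_iff.2 hμ
  have hae' : ∀ᵐ z ∂(curveMeasure ζ), z ∈ ζ '' Icc 0 π := mem_ae_iff.2 h.curveMeasure_compl
  obtain ⟨R, hR0, hR⟩ : ∃ R > 0, ∀ z ∈ ζ '' Icc 0 π, ‖z‖ ≤ R :=
    h.isCompact_image.isBounded.exists_pos_norm_le
  constructor
  · rw [Measure.ae_prod_iff_ae_ae (p := fun p : ℂ × ℂ => p.1 ≠ p.2)
      (isClosed_eq continuous_fst continuous_snd).measurableSet.compl]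
    filter_upwards [hae] with z hz using h.ae_ne hz
  · have hm : Measurable fun p : ℂ × ℂ => log ‖p.1 - p.2‖ :=
      Real.measurable_log.comp (measurable_fst.sub measurable_snd).norm
    refine integrable_prod_of_bound (C := 2 * log⁺ (2 * R) - V) hm.aestronglyMeasurable
      (hae.mono fun z hz => (h.integrable_log hz).1) ?_
    filter_upwards [hae] with z hz
    obtain ⟨h1, h2⟩ := h.integrable_log hz
    have h3 : ∫ w, |log ‖z - w‖| ∂(curveMeasure ζ) ≤
        ∫ w, (2 * log⁺ (2 * R) - log ‖z - w‖) ∂(curveMeasure ζ) := by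
      refine integral_mono_ae h1.abs ((integrable_const _).sub h1) ?_
      filter_upwards [hae'] with w hw
      have h4 : log⁺ ‖z - w‖ ≤ log⁺ (2 * R) := by
        refine posLog_le_posLog (norm_nonneg _) ((norm_sub_le _ _).trans ?_)
        linarith [hR z hz, hR w hw]
      have h5 := half_mul_log_add_log_abs (x := ‖z - w‖)
      linarith
    refine h3.trans (le_of_eq ?_)
    rw [integral_sub (integrable_const _) h1, h2]
    simp

theorem logPairing_eq (h : IsEquilibriumCurve ζ F V) {μ : Measure ℂ}
    [IsProbabilityMeasure μ] (hμ : μ (ζ '' Icc 0 π)ᶜ = 0) : logPairing μ (curveMeasure ζ) = V := by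
  have hν := h.isProbabilityMeasure
  rw [logPairing, integral_prod _ (h.hasFiniteLogPairing hμ).integrable]
  have hae : ∀ᵐ z ∂μ, z ∈ ζ '' Icc 0 π := mem_ae_iff.2 hμ
  rw [integral_congr_ae (hae.mono fun z hz => (h.integrable_log hz).2)]
  simp

theorem logEnergy_curveMeasure (h : IsEquilibriumCurve ζ F V) :
    logEnergy (curveMeasure ζ) = ((-V : ℝ) : EReal) := by
  have hν := h.isProbabilityMeasure
  rw [logEnergy_of_hasFiniteLogPairing (h.hasFiniteLogPairing h.curveMeasure_compl),
    h.logPairing_eq h.curveMeasure_compl]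

/-- As the potential is constant on the curve, every μ pairs with the curve measure to V. Hence I[μ]
+ V is the energy of the difference of the two measures: it is nonnegative, and zero only if they
coincide. -/
theorem logEnergy_le (h : IsEquilibriumCurve ζ F V) {μ : Measure ℂ}
    (hμ : μ ∈ probabilityMeasuresOn (ζ '' Icc 0 π)) :
    ((-V : ℝ) : EReal) ≤ logEnergy μ ∧ (logEnergy μ ≤ ((-V : ℝ) : EReal) → μ = curveMeasure ζ) := by
  obtain ⟨hp, hμ0⟩ := hμ
  have hν := h.isProbabilityMeasure
  rcases logEnergy_eq_top_or h.isCompact_image hμ0 with htop | hfin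
  · rw [htop]
    exact ⟨le_top, fun hle => absurd (top_le_iff.1 hle) (EReal.coe_ne_top _)⟩
  · obtain ⟨h1, h2⟩ := logPairing_sub_nonneg hfin (h.hasFiniteLogPairing hμ0)
      (h.hasFiniteLogPairing h.curveMeasure_compl)
    rw [h.logPairing_eq hμ0, h.logPairing_eq h.curveMeasure_compl] at h1 h2
    rw [logEnergy_of_hasFiniteLogPairing hfin, EReal.coe_le_coe_iff, EReal.coe_le_coe_iff]
    refine ⟨by linarith, fun hle => ?_⟩
    obtain ⟨t, ht, hu⟩ := h2 (by linarith)
    exact measure_eq_of_gaussTransform_eq h.isCompact_image hμ0 h.curveMeasure_compl ht hu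

theorem isEquilibriumMeasure_iff (h : IsEquilibriumCurve ζ F V) {μ : Measure ℂ} :
    IsEquilibriumMeasure (ζ '' Icc 0 π) μ ↔ μ = curveMeasure ζ := by
  constructor
  · intro hμ
    refine (h.logEnergy_le hμ.1).2 ?_
    rw [← h.logEnergy_curveMeasure]
    exact hμ.2 _ h.mem_probabilityMeasuresOn
  · rintro rfl
    refine ⟨h.mem_probabilityMeasuresOn, fun μ hμ => ?_⟩
    rw [h.logEnergy_curveMeasure]
    exact (h.logEnergy_le hμ).1

theorem logCapacity_eq (h : IsEquilibriumCurve ζ F V) : logCapacity (ζ '' Icc 0 π) = exp V := by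
  have hinf : (⨅ μ ∈ probabilityMeasuresOn (ζ '' Icc 0 π), logEnergy μ) = ((-V : ℝ) : EReal) := by
    refine le_antisymm ?_ (le_iInf₂ fun μ hμ => (h.logEnergy_le hμ).1)
    rw [← h.logEnergy_curveMeasure]
    exact iInf₂_le _ h.mem_probabilityMeasuresOn
  rw [logCapacity, hinf, ← EReal.coe_neg, neg_neg, EReal.exp_coe,
    ENNReal.toReal_ofReal (exp_pos V).le]

theorem curveMeasure_image_Icc (h : IsEquilibriumCurve ζ F V) {x : ℝ} (hx : x ∈ Icc 0 π) :
    curveMeasure ζ (ζ '' Icc x π) = ENNReal.ofReal ((π - x) / π) := by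
  rw [h.curveMeasure_apply (isCompact_Icc.image h.kernel.continuous).measurableSet]
  have h1 : angleMeasure (ζ ⁻¹' (ζ '' Icc x π)) = angleMeasure (Icc x π) := by
    refine measure_congr ?_
    filter_upwards [ae_angleMeasure_mem] with y hy
    refine propext ⟨?_, fun hy' => ⟨y, hy', rfl⟩⟩
    rintro ⟨y', hy', he⟩
    rwa [← h.kernel.injOn ⟨hx.1.trans hy'.1, hy'.2⟩ hy he]
  have h2 : angleMeasure (Icc x π) = volume (Ioc x π) := by
    rw [angleMeasure, Measure.restrict_congr_set Ioc_ae_eq_Icc, Measure.restrict_apply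
      measurableSet_Icc, inter_eq_left.2 (Icc_subset_Icc_left hx.1), measure_congr Ioc_ae_eq_Icc]
  rw [h1, h2, Real.volume_Ioc, ← ENNReal.ofReal_mul (by positivity)]
  congr 1
  field_simp

end IsEquilibriumCurve


theorem integral_one_div_sqrt_one_sub_sq {t : ℝ} (ht : t ∈ Icc (-1 : ℝ) 1) :
    ∫ s in (-1 : ℝ)..t, 1 / Real.sqrt (1 - s ^ 2) = Real.pi - Real.arccos t := by
  have hd : ∀ s ∈ Ioo (-1 : ℝ) t, HasDerivAt Real.arcsin (1 / Real.sqrt (1 - s ^ 2)) s :=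
    fun s hs => Real.hasDerivAt_arcsin hs.1.ne' (hs.2.trans_le ht.2).ne
  have hc : ContinuousOn Real.arcsin (Icc (-1) t) := Real.continuous_arcsin.continuousOn
  -- The integrand is unbounded near -1. Its integrability follows from being the nonnegative
  -- derivative of the continuous function arcsin.
  have hi := intervalIntegral.integrableOn_deriv_of_nonneg hc hd (fun s _ => by positivity)
  rw [intervalIntegral.integral_eq_sub_of_hasDerivAt_of_le ht.1 hc hd
    ((intervalIntegrable_iff_integrableOn_Ioc_of_le ht.1).2 hi), Real.arcsin_neg, Real.arcsin_one,
    Real.arccos]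
  ring

namespace IsEquilibriumCurve
open Real
variable {ζ : ℝ → ℂ} {F : ℝ × ℝ → ℝ} {V : ℝ}

theorem image_arccos (ζ : ℝ → ℂ) {t : ℝ} (ht : t ∈ Icc (-1 : ℝ) 1) :
    (fun s => ζ (arccos s)) '' Icc (-1) t = ζ '' Icc (arccos t) π := by
  rw [← image_image ζ arccos, ContinuousOn.image_Icc_of_antitoneOn ht.1
    continuous_arccos.continuousOn (antitone_arccos.antitoneOn _), arccos_neg_one]

theorem isEquilibriumParametrization (h : IsEquilibriumCurve ζ F V) (h0 : ζ 0 = 1)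
    (hpi : ζ π = -1) : IsEquilibriumParametrization (ζ '' Icc 0 π) (curveMeasure ζ)
      (fun s => ζ (arccos s)) := by
  refine ⟨(h.kernel.continuous.comp continuous_arccos).continuousOn, ?_, ?_, ?_, ?_, ?_⟩
  · intro s hs t ht he
    exact arccos_injOn hs ht (h.kernel.injOn ⟨arccos_nonneg s, arccos_le_pi s⟩
      ⟨arccos_nonneg t, arccos_le_pi t⟩ he)
  · rw [image_arccos ζ (by simp), arccos_one]
  · simp [hpi]
  · simp [h0]
  · intro t ht
    rw [image_arccos ζ ht, h.curveMeasure_image_Icc ⟨arccos_nonneg t, arccos_le_pi t⟩,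
      integral_one_div_sqrt_one_sub_sq ht]
    congr 1
    ring

/-- Pull z back to the angle: z = ζ ∘ f with f continuous and injective, hence strictly decreasing
from π to 0. The measure of the initial arcs then forces f = arccos. -/
theorem eqOn_of_isEquilibriumParametrization (h : IsEquilibriumCurve ζ F V) (h0 : ζ 0 = 1)
    (hpi : ζ π = -1) {z : ℝ → ℂ}
    (hz : IsEquilibriumParametrization (ζ '' Icc 0 π) (curveMeasure ζ) z) :
    EqOn z (fun s => ζ (arccos s)) (Icc (-1) 1) := by
  obtain ⟨hcont, hinj, himg, hl, hr, hmeas⟩ := hz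
  have hex : ∀ t : Icc (-1 : ℝ) 1, ∃ x : Icc 0 π, ζ x = z t := fun t => by
    have : z t ∈ ζ '' Icc 0 π := himg ▸ ⟨t, t.2, rfl⟩
    obtain ⟨x, hx, he⟩ := this
    exact ⟨⟨x, hx⟩, he⟩
  choose φ hφ using hex
  have hφc : Continuous φ := by
    have hemb : Topology.IsClosedEmbedding ((Icc 0 π).domRestrict ζ) :=
      (h.kernel.continuous.comp continuous_subtype_val).isClosedEmbedding h.kernel.injOn.injective
    rw [hemb.isInducing.continuous_iff]
    refine hcont.domRestrict.congr fun t => ?_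
    exact (hφ t).symm
  let f : ℝ → ℝ := IccExtend (by norm_num : (-1 : ℝ) ≤ 1) fun t => (φ t : ℝ)
  have hf : ∀ t (ht : t ∈ Icc (-1 : ℝ) 1), f t = φ ⟨t, ht⟩ := fun t ht => IccExtend_of_mem _ _ ht
  have hfmem : ∀ t ∈ Icc (-1 : ℝ) 1, f t ∈ Icc 0 π := fun t ht => by
    rw [hf t ht]; exact (φ _).2
  have hfz : ∀ t ∈ Icc (-1 : ℝ) 1, ζ (f t) = z t := fun t ht => by rw [hf t ht, hφ]
  have hfc : ContinuousOn f (Icc (-1) 1) :=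
    (continuous_subtype_val.comp hφc).Icc_extend'.continuousOn
  have hfi : InjOn f (Icc (-1) 1) := fun s hs t ht he => hinj hs ht (by
    rw [← hfz s hs, ← hfz t ht, he])
  have hm1 : (-1 : ℝ) ∈ Icc (-1 : ℝ) 1 := by simp
  have hp1 : (1 : ℝ) ∈ Icc (-1 : ℝ) 1 := by simp
  have hf1 : f (-1) = π := h.kernel.injOn (hfmem _ hm1) ⟨pi_pos.le, le_rfl⟩ (by
    rw [hfz _ hm1, hl, hpi])
  have hf2 : f 1 = 0 := h.kernel.injOn (hfmem _ hp1) ⟨le_rfl, pi_pos.le⟩ (by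
    rw [hfz _ hp1, hr, h0])
  have hanti := hfc.strictAntiOn_of_injOn_Icc (by norm_num) (by rw [hf1, hf2]; exact pi_pos.le) hfi
  intro t ht
  have hsub : Icc (-1) t ⊆ Icc (-1 : ℝ) 1 := Icc_subset_Icc_right ht.2
  have h1 : z '' Icc (-1) t = ζ '' Icc (f t) π := by
    rw [← hf1, ← ContinuousOn.image_Icc_of_antitoneOn ht.1 (hfc.mono hsub)
      (hanti.antitoneOn.mono hsub), ← image_comp]
    exact image_congr fun s hs => (hfz s (hsub hs)).symm
  have h2 := hmeas t ht
  rw [h1, h.curveMeasure_image_Icc (hfmem t ht), integral_one_div_sqrt_one_sub_sq ht,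
    ENNReal.ofReal_eq_ofReal_iff (div_nonneg (by linarith [(hfmem t ht).2]) pi_pos.le)
    (mul_nonneg (by positivity) (by linarith [arccos_le_pi t]))] at h2
  have h3 : f t = arccos t := by
    field_simp at h2
    linarith
  rw [← hfz t ht, h3]

end IsEquilibriumCurve


/-! ### The arc-Grunsky coefficients as cosine coefficients. -/

theorem chebyshev_T_eval_cos (k : ℕ+) (x : ℝ) :
    (Polynomial.Chebyshev.T ℝ (k : ℕ)).eval (Real.cos x) = Real.cos ((k : ℕ) * x) := by
  simp [Polynomial.Chebyshev.T_real_cos]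

namespace IsEquilibriumCurve
open Real
variable {ζ : ℝ → ℂ} {F : ℝ × ℝ → ℝ} {V : ℝ}

theorem log_two_mul_logCapacity (h : IsEquilibriumCurve ζ F V) :
    log (2 * logCapacity (ζ '' Icc 0 π)) = V + log 2 := by
  rw [h.logCapacity_eq, log_mul two_ne_zero (exp_pos V).ne', log_exp, add_comm]

theorem integral_kernel (h : IsEquilibriumCurve ζ F V) {x : ℝ} (hx : x ∈ Icc 0 π) :
    ∫ y, F (x, y) ∂angleMeasure = π * (V + log 2) := by
  have h1 : ∫ y, F (x, y) ∂angleMeasure =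
      ∫ y, (log ‖ζ x - ζ y‖ - log |cos x - cos y|) ∂angleMeasure := by
    refine integral_congr_ae ?_
    filter_upwards [ae_angleMeasure_mem, ae_angleMeasure_ne x] with y hy hne
    rw [h.kernel.log_eq x hx y hy hne, add_sub_cancel_left]
  rw [h1, integral_sub (h.kernel.integrable_log_right hx) (integrable_log_abs_cos_sub_cos hx),
    h.potential x hx, integral_log_abs_cos_sub_cos hx]
  ring

/-- Integrating F in one variable gives a constant, because the potentials of both the curve and the
segment are constant. This is why the arc-Grunsky expansion starts at k, l ≥ 1, and the remaining
constant is log(2 cap γ). -/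
theorem cosCoeff_zero_right (h : IsEquilibriumCurve ζ F V) (k : ℕ) :
    cosCoeff F k 0 = if k = 0 then V + log 2 else 0 := by
  have hp : pairing F (fun x => cos (k * x)) (fun y => cos ((0 : ℕ) * y)) =
      π * (V + log 2) * ∫ x, cos (k * x) * cos ((0 : ℕ) * x) ∂angleMeasure := by
    rw [pairing_eq_integral h.kernel.contDiff.continuous (by fun_prop) (by fun_prop),
      ← integral_const_mul]
    refine integral_congr_ae ?_
    filter_upwards [ae_angleMeasure_mem] with x hx
    simp [h.integral_kernel hx]
  have hpi := pi_pos
  rw [cosCoeff, hp, integral_cos_mul_cos]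
  by_cases hk : k = 0
  · simp only [hk, cosWeight, if_true]
    field_simp
  · simp [hk]

theorem cosCoeff_zero_left (h : IsEquilibriumCurve ζ F V) {l : ℕ} (hl : l ≠ 0) :
    cosCoeff F 0 l = 0 := by
  rw [cosCoeff_comm h.kernel.symm, h.cosCoeff_zero_right, if_neg hl]

theorem log_quotient (h : IsEquilibriumCurve ζ F V) {x y : ℝ} (hx : x ∈ Icc 0 π)
    (hy : y ∈ Icc 0 π) (hne : x ≠ y) :
    log ‖(ζ x - ζ y) / ((cos x - cos y : ℝ) : ℂ)‖ = F (x, y) := by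
  have h1 : ζ x - ζ y ≠ 0 := sub_ne_zero.2 fun he => hne (h.kernel.injOn hx hy he)
  have h2 : cos x - cos y ≠ 0 := sub_ne_zero.2 (cos_ne_cos hx hy hne)
  rw [norm_div, Complex.norm_real, norm_eq_abs, log_div (norm_ne_zero_iff.2 h1) (abs_ne_zero.2 h2),
    h.kernel.log_eq x hx y hy hne, add_sub_cancel_left]

theorem hasSum_positive_cosCoeff (h : IsEquilibriumCurve ζ F V) {x y : ℝ} (hx : x ∈ Icc 0 π)
    (hy : y ∈ Icc 0 π) :
    HasSum (fun kl : ℕ+ × ℕ+ => cosCoeff F kl.1 kl.2 * (cos ((kl.1 : ℕ) * x) * cos ((kl.2 : ℕ) * y)))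
      (F (x, y) - (V + log 2)) := by
  have h1 := (hasSum_cosCoeff h.kernel.contDiff hx hy).sub
    (hasSum_ite_eq ((0, 0) : ℕ × ℕ) (V + log 2))
  have hinj : Function.Injective fun kl : ℕ+ × ℕ+ => ((kl.1 : ℕ), (kl.2 : ℕ)) := fun a b hab => by
    simp only [Prod.mk.injEq, PNat.coe_inj] at hab
    exact Prod.ext hab.1 hab.2
  refine hasSum_of_eq ((hinj.hasSum_iff ?_).2 h1) fun kl => ?_
  · rintro ⟨k, l⟩ hkl
    by_cases hl : l = 0
    · subst hl
      rw [h.cosCoeff_zero_right]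
      by_cases hk : k = 0 <;> simp [hk]
    · by_cases hk : k = 0
      · subst hk
        simp [h.cosCoeff_zero_left hl, hl]
      · exact absurd ⟨(⟨k, Nat.pos_of_ne_zero hk⟩, ⟨l, Nat.pos_of_ne_zero hl⟩), rfl⟩ hkl
  · simp

/-- With s = cos x the Chebyshev polynomials become cosines and the logarithm of the difference
quotient becomes F. The factor -1/2 is that of -2 in the definition of the coefficients. -/
theorem isArcGrunskyCoeff (h : IsEquilibriumCurve ζ F V) (h0 : ζ 0 = 1) (hpi : ζ π = -1) :
    IsArcGrunskyCoeff (ζ '' Icc 0 π) fun k l => -(cosCoeff F k l / 2) := by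
  refine ⟨curveMeasure ζ, fun s => ζ (arccos s), h.isEquilibriumMeasure_iff.2 rfl,
    h.isEquilibriumParametrization h0 hpi, _,
    HasSumUniformlyOn.of_norm_le_summable (u := fun kl : ℕ+ × ℕ+ => |cosCoeff F kl.1 kl.2|)
      ?_ ?_, ?_⟩
  · exact (summable_abs_cosCoeff h.kernel.contDiff).comp_injective
      (i := fun kl : ℕ+ × ℕ+ => ((kl.1 : ℕ), (kl.2 : ℕ))) fun a b hab => by
        simp only [Prod.mk.injEq, PNat.coe_inj] at hab
        exact Prod.ext hab.1 hab.2
  · rintro ⟨k, l⟩ ⟨s, t⟩ ⟨hs, ht, -⟩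
    simp only at hs ht ⊢
    rw [← cos_arccos hs.1 hs.2, ← cos_arccos ht.1 ht.2, chebyshev_T_eval_cos, chebyshev_T_eval_cos,
      mul_assoc, norm_eq_abs]
    refine (abs_cos_mul_cos_le _ _ _).trans ?_
    rw [abs_neg, abs_div, abs_two]
    linarith [abs_nonneg (cosCoeff F k l)]
  · rintro ⟨s, t⟩ ⟨hs, ht, hne⟩
    have hs' : cos (arccos s) = s := cos_arccos hs.1 hs.2
    have ht' : cos (arccos t) = t := cos_arccos ht.1 ht.2
    have hms : arccos s ∈ Icc 0 π := ⟨arccos_nonneg s, arccos_le_pi s⟩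
    have hmt : arccos t ∈ Icc 0 π := ⟨arccos_nonneg t, arccos_le_pi t⟩
    have hL := h.log_quotient hms hmt fun he => hne (by rw [← hs', ← ht', he])
    rw [hs', ht'] at hL
    have hS := ((h.hasSum_positive_cosCoeff hms hmt).div_const (-2)).tsum_eq
    have hS' : ∀ kl : ℕ+ × ℕ+, -(cosCoeff F kl.1 kl.2 / 2) *
        (Polynomial.Chebyshev.T ℝ (kl.1 : ℕ)).eval s *
        (Polynomial.Chebyshev.T ℝ (kl.2 : ℕ)).eval t =
        cosCoeff F kl.1 kl.2 * (cos ((kl.1 : ℕ) * arccos s) * cos ((kl.2 : ℕ) * arccos t)) / (-2) :=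
      fun kl => by
        rw [← chebyshev_T_eval_cos, ← chebyshev_T_eval_cos, hs', ht']
        ring
    simp only
    rw [hL, tsum_congr hS', hS, h.log_two_mul_logCapacity]
    ring

/-- The expansion is transported to the angles and integrated termwise against cos(mx) cos(ny).
Uniform convergence off the diagonal suffices because the diagonal is a null set. -/
theorem eq_of_isArcGrunskyCoeff (h : IsEquilibriumCurve ζ F V) (h0 : ζ 0 = 1) (hpi : ζ π = -1)
    {a : ℕ+ → ℕ+ → ℝ} (ha : IsArcGrunskyCoeff (ζ '' Icc 0 π) a) (m n : ℕ+) :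
    a m n = -(cosCoeff F m n / 2) := by
  obtain ⟨ν, z, hν, hz, S, hS, hlog⟩ := ha
  obtain rfl := h.isEquilibriumMeasure_iff.1 hν
  have hz := h.eqOn_of_isEquilibriumParametrization h0 hpi hz
  set A : Set (ℝ × ℝ) := {p | p.1 ∈ Icc 0 π ∧ p.2 ∈ Icc 0 π ∧ p.1 ≠ p.2}
  have hmaps : ∀ p ∈ A, (cos p.1, cos p.2) ∈ (Icc (-1 : ℝ) 1).offDiag := fun p hp =>
    ⟨cos_mem_Icc p.1, cos_mem_Icc p.2, cos_ne_cos hp.1 hp.2.1 hp.2.2⟩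
  have hSF : ∀ p ∈ A, S (cos p.1, cos p.2) = (V + log 2 - F p) / 2 := fun p hp => by
    have h1 := hlog _ (hmaps p hp)
    simp only at h1
    rw [hz (cos_mem_Icc p.1), hz (cos_mem_Icc p.2)] at h1
    simp only [arccos_cos hp.1.1 hp.1.2, arccos_cos hp.2.1.1 hp.2.1.2] at h1
    rw [h.log_quotient hp.1 hp.2.1 hp.2.2, h.log_two_mul_logCapacity] at h1
    linarith
  have hu : HasSumUniformlyOn
      (fun (kl : ℕ+ × ℕ+) (p : ℝ × ℝ) =>
        a kl.1 kl.2 * (cos ((kl.1 : ℕ) * p.1) * cos ((kl.2 : ℕ) * p.2)) *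
          (cos ((m : ℕ) * p.1) * cos ((n : ℕ) * p.2)))
      (fun p => (V + log 2 - F p) / 2 * (cos ((m : ℕ) * p.1) * cos ((n : ℕ) * p.2))) A := by
    rw [hasSumUniformlyOn_iff_tendstoUniformlyOn, Metric.tendstoUniformlyOn_iff] at hS ⊢
    intro ε hε
    filter_upwards [hS ε hε] with s hs p hp
    have h1 := hs _ (hmaps p hp)
    rw [hSF p hp] at h1
    simp only [chebyshev_T_eval_cos] at h1
    rw [← Finset.sum_mul, dist_eq, ← sub_mul, abs_mul]
    refine (mul_le_of_le_one_right (abs_nonneg _) ?_).trans_lt ?_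
    · simpa using abs_cos_mul_cos_le 1 ((m : ℕ) * p.1) ((n : ℕ) * p.2)
    · simpa only [dist_eq, mul_assoc] using h1
  have hF := h.kernel.contDiff.continuous
  have hI := hasSum_integral_of_hasSumUniformlyOn (μ := angleMeasure.prod angleMeasure)
    ae_angleMeasure_prod hu (fun kl => Continuous.integrable_angleMeasure_prod (by fun_prop))
    (Continuous.integrable_angleMeasure_prod (by fun_prop))
  have hne : ∀ k : ℕ+, (k : ℕ) ≠ 0 := fun k => k.ne_zero
  have hterm : ∀ kl : ℕ+ × ℕ+, ∫ p : ℝ × ℝ,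
      a kl.1 kl.2 * (cos ((kl.1 : ℕ) * p.1) * cos ((kl.2 : ℕ) * p.2)) *
        (cos ((m : ℕ) * p.1) * cos ((n : ℕ) * p.2)) ∂(angleMeasure.prod angleMeasure) =
      a kl.1 kl.2 * ((if kl.1 = m then π / 2 else 0) * if kl.2 = n then π / 2 else 0) := fun kl => by
    have := pairing_cos_mul_cos (a kl.1 kl.2) kl.1 kl.2 m n
    rw [integral_cos_mul_cos, integral_cos_mul_cos] at this
    simpa only [hne, if_false, PNat.coe_inj, pairing] using this
  simp only [hterm] at hI
  have h1 := hI.unique (hasSum_single (m, n) fun kl hkl => by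
    by_cases hk : kl.1 = m
    · by_cases hl : kl.2 = n
      · exact absurd (Prod.ext hk hl) hkl
      · simp [hl]
    · simp [hk])
  have h2 : ∫ p : ℝ × ℝ, (V + log 2 - F p) / 2 * (cos ((m : ℕ) * p.1) * cos ((n : ℕ) * p.2))
      ∂(angleMeasure.prod angleMeasure) = -(π ^ 2 / 8 * cosCoeff F m n) := by
    have hc := pairing_cos_mul_cos ((V + log 2) / 2) 0 0 m n
    rw [integral_cos_mul_cos, if_neg (hne m).symm, zero_mul, mul_zero] at hc
    have hp := pairing_cos_cos F (hne m) (hne n)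
    rw [pairing] at hc hp
    have e : ∀ p : ℝ × ℝ, (V + log 2 - F p) / 2 * (cos ((m : ℕ) * p.1) * cos ((n : ℕ) * p.2)) =
        (V + log 2) / 2 * (cos ((0 : ℕ) * p.1) * cos ((0 : ℕ) * p.2)) *
          (cos ((m : ℕ) * p.1) * cos ((n : ℕ) * p.2)) -
        2⁻¹ * (F p * (cos ((m : ℕ) * p.1) * cos ((n : ℕ) * p.2))) := fun p => by
      simp only [Nat.cast_zero, zero_mul, cos_zero]
      ring
    rw [integral_congr_ae (Filter.Eventually.of_forall e), integral_sub
      (Continuous.integrable_angleMeasure_prod (by fun_prop))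
      (Continuous.integrable_angleMeasure_prod (by fun_prop)), integral_const_mul, hc, hp]
    ring
  rw [h2] at h1
  simp only [if_true] at h1
  have hπ := pi_pos
  field_simp at h1
  linarith

end IsEquilibriumCurve


/-! ### From Hölder arcs to the theorem. -/

theorem IsHolderJordanArc.exists_isRegularArc {α : ℝ} (hα : 0 < α) {γ : Set ℂ}
    (hγ : IsHolderJordanArc (5 + α) γ) : ∃ q, IsRegularArc q ∧ q '' Icc (-1) 1 = γ := by
  obtain ⟨p, ⟨k, β, -, hβ1, hr, hp, -⟩, hinj, hd, h0, h1, himg⟩ := hγ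
  -- From 5 + α = k + β with α > 0 and β ≤ 1 follows k > 4, so five continuous derivatives are
  -- available.
  have hk : 5 ≤ k := by
    have h2 : (β : ℝ) ≤ 1 := hβ1
    have h3 : (4 : ℝ) < k := by linarith
    exact_mod_cast h3
  have hp5 : ContDiffOn ℝ 5 p (Icc 0 1) := hp.of_le (by exact_mod_cast hk)
  obtain ⟨g, hg, hpg⟩ := exists_contDiff_extension (zero_lt_one' ℝ) 5 (by exact_mod_cast hp5)
  have hg5 : ContDiff ℝ 5 g := by exact_mod_cast hg
  have hmap : ∀ s ∈ Icc (-1 : ℝ) 1, (1 + s) / 2 ∈ Icc (0 : ℝ) 1 := fun s hs =>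
    ⟨by linarith [hs.1], by linarith [hs.2]⟩
  refine ⟨fun s => g ((1 + s) / 2), ⟨by fun_prop, ?_, ?_, ?_, ?_⟩, ?_⟩
  · intro s hs t ht he
    simp only at he
    rw [← hpg (hmap s hs), ← hpg (hmap t ht)] at he
    linarith [hinj (hmap s hs) (hmap t ht) he]
  · intro s hs
    have h2 : HasDerivAt g (deriv g ((1 + s) / 2)) ((1 + s) / 2) :=
      (hg5.differentiable (by norm_num) _).hasDerivAt
    have h3 : HasDerivAt (fun s : ℝ => (1 + s) / 2) (1 / 2) s :=
      ((hasDerivAt_id s).const_add 1).div_const 2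
    rw [show deriv (fun s => g ((1 + s) / 2)) s = _ from (h2.scomp s h3).deriv]
    refine smul_ne_zero (by norm_num) ?_
    have h4 := (h2.hasDerivWithinAt (s := Icc 0 1)).congr (fun x hx => hpg hx) (hpg (hmap s hs))
    rw [← h4.derivWithin (uniqueDiffOn_Icc zero_lt_one _ (hmap s hs))]
    exact hd _ (hmap s hs)
  · norm_num
    rw [← hpg (by simp), h0]
  · norm_num
    rw [← hpg (by simp), h1]
  · rw [← himg, image_congr hpg]
    ext w
    constructor
    · rintro ⟨s, hs, rfl⟩
      exact ⟨_, hmap s hs, rfl⟩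
    · rintro ⟨t, ht, rfl⟩
      exact ⟨2 * t - 1, ⟨by linarith [ht.1], by linarith [ht.2]⟩, by simp⟩

theorem IsRegularArc.exists_isEquilibriumCurve {q : ℝ → ℂ} (h : IsRegularArc q) :
    ∃ ζ F V, IsEquilibriumCurve ζ F V ∧ ζ 0 = 1 ∧ ζ Real.pi = -1 ∧
      ζ '' Icc 0 Real.pi = q '' Icc (-1) 1 := by
  obtain ⟨τ, hc, hmono, h0, hpi, ⟨F, hF⟩, V, hV⟩ := h.exists_equilibriumAngle
  refine ⟨_, F, V / Real.pi, ⟨hF, fun x hx => ?_⟩, ?_, ?_, ?_⟩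
  · rw [hV x hx, mul_div_cancel₀ _ Real.pi_pos.ne']
  · simp [h0, h.right]
  · simp [hpi, h.left]
  · have h1 := hc.continuousOn.image_Icc_of_monotoneOn Real.pi_pos.le (hmono.monotone.monotoneOn _)
    have h2 := Real.continuousOn_cos.image_Icc_of_antitoneOn Real.pi_pos.le
      Real.strictAntiOn_cos.antitoneOn
    rw [h0, hpi] at h1
    rw [Real.cos_zero, Real.cos_pi] at h2
    rw [← image_image q (fun x => Real.cos (τ x)), ← image_image Real.cos τ, h1, h2]

namespace IsEquilibriumCurve
open Real
variable {ζ : ℝ → ℂ} {F : ℝ × ℝ → ℝ} {V : ℝ}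

theorem isArcGrunskyOperator_iff (h : IsEquilibriumCurve ζ F V) (h0 : ζ 0 = 1) (hpi : ζ π = -1)
    {B : SeqL2 →L[ℝ] SeqL2} : IsArcGrunskyOperator (ζ '' Icc 0 π) B ↔
      ∀ x k, HasSum (fun l => kernelMatrix F k l * x l) (B x k) := by
  constructor
  · rintro ⟨a, ha, hB⟩ x k
    refine hasSum_of_eq (hB x k) fun l => ?_
    rw [kernelMatrix, h.eq_of_isArcGrunskyCoeff h0 hpi ha]
  · exact fun hB => ⟨_, h.isArcGrunskyCoeff h0 hpi, hB⟩

end IsEquilibriumCurve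

section Coercive
variable {E : Type*} [NormedAddCommGroup E] [InnerProductSpace ℝ E]

theorem neg_smul_one_le_of_symmetric {B : E →L[ℝ] E} {κ : ℝ}
    (hsymm : ∀ x y, inner ℝ (B x) y = inner ℝ x (B y))
    (hB : ∀ x, -(κ * ‖x‖ ^ 2) ≤ inner ℝ (B x) x) : -(κ • (1 : E →L[ℝ] E)) ≤ B := by
  rw [ContinuousLinearMap.le_def, ContinuousLinearMap.isPositive_iff]
  constructor
  · intro x y
    simp [inner_add_left, inner_add_right, inner_smul_left, inner_smul_right, hsymm]
  · intro x
    have := hB x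
    simp only [sub_neg_eq_add, add_apply, smul_apply,
      one_apply_eq_self, inner_add_left, real_inner_smul_left,
      real_inner_self_eq_norm_sq]
    linarith

theorem neg_le_of_hasEigenvalue {B : E →L[ℝ] E} {κ lam : ℝ}
    (hB : ∀ x, -(κ * ‖x‖ ^ 2) ≤ inner ℝ (B x) x)
    (hlam : Module.End.HasEigenvalue (B : E →ₗ[ℝ] E) lam) : -κ ≤ lam := by
  obtain ⟨x, hx⟩ := hlam.exists_hasEigenvector
  have h1 : B x = lam • x := hx.apply_eq_smul
  have h2 := hB x
  rw [h1, real_inner_smul_left, real_inner_self_eq_norm_sq] at h2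
  have h3 : 0 < ‖x‖ ^ 2 := by
    have := norm_pos_iff.2 hx.2
    positivity
  nlinarith

theorem isUnit_one_add_smul [CompleteSpace E] {B : E →L[ℝ] E} {κ s : ℝ} (hκ0 : 0 ≤ κ) (hκ : κ < 1)
    (hB : ∀ x, -(κ * ‖x‖ ^ 2) ≤ inner ℝ (B x) x) (hs : s ∈ Icc (0 : ℝ) 1) :
    IsUnit (1 + s • B) := by
  refine ContinuousLinearMap.isUnit_of_forall_le_norm_inner_map _ (c := (1 - κ).toNNReal)
    (by simpa using hκ) fun x => ?_
  rw [Real.coe_toNNReal _ (by linarith), Real.norm_eq_abs]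
  refine le_trans ?_ (le_abs_self _)
  simp only [add_apply, smul_apply,
    one_apply_eq_self, inner_add_left, real_inner_smul_left,
    real_inner_self_eq_norm_sq]
  -- For s ≤ 1 the form of 1 + sB is at least 1 - sκ ≥ 1 - κ > 0 times ‖x‖².
  have h1 := mul_le_mul_of_nonneg_left (hB x) hs.1
  have h2 : 0 ≤ (1 - s) * (κ * ‖x‖ ^ 2) := mul_nonneg (by linarith [hs.2]) (by positivity)
  linarith

end Coercive


theorem mainTheorem7 (α : ℝ) (hα : 0 < α) (γ : Set ℂ) (hγ : IsHolderJordanArc (5 + α) γ) :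
    (∃! B : SeqL2 →L[ℝ] SeqL2, IsArcGrunskyOperator γ B) ∧
    ∀ B : SeqL2 →L[ℝ] SeqL2, IsArcGrunskyOperator γ B →
      ∃ κ : ℝ, 0 ≤ κ ∧ κ < 1 ∧
        -(κ • (1 : SeqL2 →L[ℝ] SeqL2)) ≤ B ∧
        (∀ lam : ℝ, Module.End.HasEigenvalue (B : SeqL2 →ₗ[ℝ] SeqL2) lam → -κ ≤ lam) ∧
        ∀ s ∈ Set.Icc (0 : ℝ) 1, IsUnit (1 + s • B) := by
  obtain ⟨q, hq, rfl⟩ := hγ.exists_isRegularArc hα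
  obtain ⟨ζ, F, V, hζ, h0, hpi, himg⟩ := hq.exists_isEquilibriumCurve
  rw [← himg]
  obtain ⟨B, hB, hsymm, c, hc, hcoer⟩ := hζ.kernel.exists_operator
  have huniq : ∀ B', IsArcGrunskyOperator (ζ '' Icc 0 Real.pi) B' → B' = B := fun B' hB' => by
    ext x k
    exact ((hζ.isArcGrunskyOperator_iff h0 hpi).1 hB' x k).unique (hB x k)
  refine ⟨⟨B, (hζ.isArcGrunskyOperator_iff h0 hpi).2 hB, huniq⟩, fun B' hB' => ?_⟩
  obtain rfl := huniq B' hB'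
  -- Coercivity with constant c allows κ = 1 - c. Capping c at 1 keeps κ nonnegative.
  have hlow : ∀ x, -((1 - min c 1) * ‖x‖ ^ 2) ≤ inner ℝ (B' x) x := fun x => by
    have h1 := hcoer x
    rw [inner_add_left, real_inner_self_eq_norm_sq] at h1
    have h2 : min c 1 * ‖x‖ ^ 2 ≤ c * ‖x‖ ^ 2 := by
      gcongr
      exact min_le_left _ _
    linarith
  have hκ0 : 0 ≤ 1 - min c 1 := sub_nonneg.2 (min_le_right _ _)
  have hκ1 : 1 - min c 1 < 1 := sub_lt_self _ (lt_min hc one_pos)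
  exact ⟨1 - min c 1, hκ0, hκ1, neg_smul_one_le_of_symmetric hsymm hlow,
    fun lam hlam => neg_le_of_hasEigenvalue hlow hlam,
    fun s hs => isUnit_one_add_smul hκ0 hκ1 hlow hs⟩
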